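/- Let $1\le k\le p$, $\alpha>0$ and $\beta>-\alpha/k$. Let $\mathrm{St}_{p,k}=\{U\in\mathbb C^{p\times k}: U^HU=I_k\}$, let $\mathcal H^{++}_k$ be the manifold of Hermitian positive definite $k\times k$ matrices, $\overline{\mathcal M}=\mathrm{St}_{p,k}\times\mathcal H^{++}_k$, and let $\pi:\overline{\mathcal M}\to\mathcal M$ be the quotient by the equivalence $(U,\Sigma)\sim(UO,O^H\Sigma O)$, $O$ unitary of size $k$. A tangent vector of $\overline{\mathcal M}$ at $\bar\theta=(U,\Sigma)$ is written as a pair of matrices $\bar\xi=(\xi_U,\xi_\Sigma)\in\mathbb C^{p\times k}\times\mathbb C^{k\times k}$. Write $\mathrm{herm}(Z)=\tfrac12(Z+Z^H)$. (0) The formula $$\langle\bar\xi,\bar\eta\rangle_{\bar\theta}=\mathrm{Re}\,\mathrm{tr}\bigl(\xi_U^H(I_p-\tfrac12UU^H)\eta_U\bigr)+\alpha\,\mathrm{tr}(\Sigma^{-1}\xi_\Sigma\Sigma^{-1}\eta_\Sigma)+\beta\,\mathrm{tr}(\Sigma^{-1}\xi_\Sigma)\,\mathrm{tr}(\Sigma^{-1}\eta_\Sigma)$$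 defines a smooth Riemannian metric on $\overline{\mathcal M}$, and there is a smooth Riemannian metric on $\mathcal M$ for which $\pi$ is a Riemannian submersion. Both metrics admit a Levi-Civita connection; denote these by $\overline\nabla$ and $\nabla$. (1) For every $\bar\theta=(U,\Sigma)\in\overline{\mathcal M}$, every tangent vector $\bar\xi$ at $\bar\theta$ and every vector field $\bar\eta$ on $\overline{\mathcal M}$ differentiable at $\bar\theta$, $$\overline\nabla_{\bar\xi}\,\bar\eta=P_{\bar\theta}(\mathrm D\bar\eta[\bar\xi])+\Bigl((I_p-UU^H)\,\mathrm{herm}(\eta_U\xi_U^H)\,U,\;-\mathrm{herm}(\eta_\Sigma\Sigma^{-1}\xi_\Sigma)\Bigr),$$ where $\mathrm D\bar\eta[\bar\xi]$ is the directional derivative of $\bar\eta$ viewed as a map into $\mathbb C^{p\times k}\times\mathbb C^{k\times k}$, and $P_{\bar\theta}(Z_U,Z_\Sigma)=(Z_U-U\,\mathrm{herm}(U^HZ_U),\,\mathrm{herm}(Z_\Sigma))$ is the projection onto the tangent space at $\bar\theta$. (2) Let $\mathcal H_{\bar\theta}$ be the horizontal space at $\bar\theta$, that is, the orthogonal complement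 in $T_{\bar\theta}\overline{\mathcal M}$ of the vertical space $\ker\mathrm D\pi(\bar\theta)$, and let $P^{\mathcal H}_{\bar\theta}$ be the orthogonal projection of $T_{\bar\theta}\overline{\mathcal M}$ onto $\mathcal H_{\bar\theta}$. Let $\bar\xi\in\mathcal H_{\bar\theta}$, $\xi=\mathrm D\pi(\bar\theta)[\bar\xi]$, let $\eta$ be a vector field on $\mathcal M$ differentiable at $\pi(\bar\theta)$, and let $\bar\eta$ be its horizontal lift. Then the representative in $\mathcal H_{\bar\theta}$ of $\nabla_\xi\,\eta$ (the horizontal vector that $\mathrm D\pi(\bar\theta)$ maps to $\nabla_\xi\,\eta$) is $$\overline{\nabla_\xi\,\eta}=P^{\mathcal H}_{\bar\theta}(\overline\nabla_{\bar\xi}\,\bar\eta).$$ -/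

import Mathlib

noncomputable section

open scoped Matrix Manifold ContDiff ComplexOrder Matrix.Norms.Elementwise
open Bundle

namespace FixedRank

/-- Complex `m × n` matrices. -/
abbrev Mat (m n : ℕ) := Matrix (Fin m) (Fin n) ℂ

/-- The real vector space of Hermitian `k × k` matrices, with its (unique) normed topology. -/
def Herm (k : ℕ) : Type := selfAdjoint.submodule ℝ (Mat k k)

/-- The real vector space of skew-Hermitian `k × k` matrices, with its (unique) normed topology. -/
def SkewHerm (k : ℕ) : Type := skewAdjoint.submodule ℝ (Mat k k)

/-- The real vector space of complex `m × n` matrices, with its (unique) normed topology. -/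
def MatSpace (m n : ℕ) : Type := Mat m n

instance (k : ℕ) : NormedAddCommGroup (Herm k) :=
  inferInstanceAs (NormedAddCommGroup (selfAdjoint.submodule ℝ (Mat k k)))
instance (k : ℕ) : NormedSpace ℝ (Herm k) :=
  inferInstanceAs (NormedSpace ℝ (selfAdjoint.submodule ℝ (Mat k k)))
instance (k : ℕ) : FiniteDimensional ℝ (Herm k) :=
  inferInstanceAs (FiniteDimensional ℝ (selfAdjoint.submodule ℝ (Mat k k)))
instance (k : ℕ) : CompleteSpace (Herm k) := FiniteDimensional.complete ℝ _
instance (k : ℕ) : NormedAddCommGroup (SkewHerm k) :=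
  inferInstanceAs (NormedAddCommGroup (skewAdjoint.submodule ℝ (Mat k k)))
instance (k : ℕ) : NormedSpace ℝ (SkewHerm k) :=
  inferInstanceAs (NormedSpace ℝ (skewAdjoint.submodule ℝ (Mat k k)))
instance (k : ℕ) : FiniteDimensional ℝ (SkewHerm k) :=
  inferInstanceAs (FiniteDimensional ℝ (skewAdjoint.submodule ℝ (Mat k k)))
instance (k : ℕ) : CompleteSpace (SkewHerm k) := FiniteDimensional.complete ℝ _
instance (m n : ℕ) : NormedAddCommGroup (MatSpace m n) :=
  inferInstanceAs (NormedAddCommGroup (Mat m n))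
instance (m n : ℕ) : NormedSpace ℝ (MatSpace m n) :=
  inferInstanceAs (NormedSpace ℝ (Mat m n))
instance (m n : ℕ) : FiniteDimensional ℝ (MatSpace m n) :=
  inferInstanceAs (FiniteDimensional ℝ (Mat m n))
instance (m n : ℕ) : CompleteSpace (MatSpace m n) := FiniteDimensional.complete ℝ _

/-- The matrix underlying a Hermitian matrix. -/
def Herm.val {k : ℕ} (A : Herm k) : Mat k k := A.1

/-- The matrix underlying a skew-Hermitian matrix. -/
def SkewHerm.val {k : ℕ} (A : SkewHerm k) : Mat k k := A.1

/-- The matrix underlying an element of `MatSpace m n`. -/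
def MatSpace.val {m n : ℕ} (A : MatSpace m n) : Mat m n := A

theorem Herm.conjTranspose_val {k : ℕ} (A : Herm k) : A.valᴴ = A.val := A.2
theorem SkewHerm.conjTranspose_val {k : ℕ} (A : SkewHerm k) : A.valᴴ = -A.val := A.2
theorem Herm.ext {k : ℕ} {A B : Herm k} (h : A.val = B.val) : A = B := Subtype.ext h
theorem SkewHerm.ext {k : ℕ} {A B : SkewHerm k} (h : A.val = B.val) : A = B := Subtype.ext h

/-- The Hermitian part of a square matrix. -/
def herm {n : ℕ} (Z : Mat n n) : Mat n n := (1 / 2 : ℂ) • (Z + Zᴴ)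

/-- The skew-Hermitian part of a square matrix. -/
def skew {n : ℕ} (Z : Mat n n) : Mat n n := (1 / 2 : ℂ) • (Z - Zᴴ)

theorem herm_conjTranspose {n : ℕ} (Z : Mat n n) : (herm Z)ᴴ = herm Z := by
  simp [herm, add_comm]

theorem skew_conjTranspose {n : ℕ} (Z : Mat n n) : (skew Z)ᴴ = -skew Z := by
  simp [skew, ← smul_neg]

/-- The Hermitian part of a square matrix, as an element of `Herm n`. -/
def hermPart {n : ℕ} (Z : Mat n n) : Herm n := ⟨herm Z, herm_conjTranspose Z⟩

/-- The skew-Hermitian part of a square matrix, as an element of `SkewHerm n`. -/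
def skewPart {n : ℕ} (Z : Mat n n) : SkewHerm n := ⟨skew Z, skew_conjTranspose Z⟩

/-! ### Smoothness of matrix operations -/

section smooth

variable {X : Type*} [NormedAddCommGroup X] [NormedSpace ℝ X] {x : X} {r : ℕ∞ω} {l m n : ℕ}

theorem contDiffAt_mat {f : X → Mat m n} :
    ContDiffAt ℝ r f x ↔ ∀ i j, ContDiffAt ℝ r (fun y => f y i j) x := by
  have h1 : ContDiffAt ℝ r f x ↔ ∀ i, ContDiffAt ℝ r (fun y => f y i) x := contDiffAt_pi
  rw [h1]
  exact forall_congr' fun i => contDiffAt_pi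

theorem contDiffAt_mul {f : X → Mat l m} {g : X → Mat m n} (hf : ContDiffAt ℝ r f x)
    (hg : ContDiffAt ℝ r g x) : ContDiffAt ℝ r (fun y => f y * g y) x := by
  rw [contDiffAt_mat] at *
  intro i j
  simp only [Matrix.mul_apply]
  exact ContDiffAt.sum fun a _ => (hf i a).mul (hg a j)

theorem contDiffAt_conjTranspose {f : X → Mat l m} (hf : ContDiffAt ℝ r f x) :
    ContDiffAt ℝ r (fun y => (f y)ᴴ) x := by
  rw [contDiffAt_mat] at *
  intro i j
  exact Complex.conjCLE.contDiff.contDiffAt.comp x (hf j i)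

theorem contDiffAt_det {f : X → Mat n n} (hf : ContDiffAt ℝ r f x) :
    ContDiffAt ℝ r (fun y => (f y).det) x := by
  rw [contDiffAt_mat] at hf
  simp only [Matrix.det_apply]
  exact ContDiffAt.sum fun s _ => (contDiffAt_prod fun i _ => hf _ _).const_smul _

theorem contDiffAt_inv {f : X → Mat n n} (hf : ContDiffAt ℝ r f x) (h : IsUnit (f x)) :
    ContDiffAt ℝ r (fun y => (f y)⁻¹) x := by
  have h0 : (f x).det ≠ 0 := by
    rw [Matrix.isUnit_iff_isUnit_det] at h
    exact h.ne_zero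
  rw [contDiffAt_mat]
  intro i j
  simp only [Matrix.inv_def, Ring.inverse_eq_inv', Matrix.smul_apply, smul_eq_mul,
    Matrix.adjugate_apply]
  refine ((contDiffAt_det hf).inv h0).mul (contDiffAt_det ?_)
  rw [contDiffAt_mat] at *
  intro a b
  by_cases hab : a = j
  · subst hab
    simpa using contDiffAt_const
  · simpa [Matrix.updateRow_ne hab] using hf a b

theorem contDiff_skewPart : ContDiff ℝ r (fun Z : Mat n n => skewPart Z) := by
  let L : Mat n n →ₗ[ℝ] SkewHerm n :=
    { toFun := skewPart
      map_add' := fun a b => by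
        refine SkewHerm.ext ?_
        change (1 / 2 : ℂ) • ((a + b) - (a + b)ᴴ) =
          (1 / 2 : ℂ) • (a - aᴴ) + (1 / 2 : ℂ) • (b - bᴴ)
        rw [Matrix.conjTranspose_add]; module
      map_smul' := fun c b => by
        refine SkewHerm.ext ?_
        change (1 / 2 : ℂ) • ((c • b) - (c • b)ᴴ) = c • ((1 / 2 : ℂ) • (b - bᴴ))
        rw [Matrix.conjTranspose_smul, star_trivial, smul_comm c]
        simp only [smul_sub] }
  exact L.toContinuousLinearMap.contDiff

theorem contDiff_hermPart : ContDiff ℝ r (fun Z : Mat n n => hermPart Z) := by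
  let L : Mat n n →ₗ[ℝ] Herm n :=
    { toFun := hermPart
      map_add' := fun a b => by
        refine Herm.ext ?_
        change (1 / 2 : ℂ) • ((a + b) + (a + b)ᴴ) =
          (1 / 2 : ℂ) • (a + aᴴ) + (1 / 2 : ℂ) • (b + bᴴ)
        rw [Matrix.conjTranspose_add]; module
      map_smul' := fun c b => by
        refine Herm.ext ?_
        change (1 / 2 : ℂ) • ((c • b) + (c • b)ᴴ) = c • ((1 / 2 : ℂ) • (b + bᴴ))
        rw [Matrix.conjTranspose_smul, star_trivial, smul_comm c]
        simp only [smul_add] }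
  exact L.toContinuousLinearMap.contDiff

theorem contDiff_herm_val : ContDiff ℝ r (Herm.val : Herm n → Mat n n) :=
  (selfAdjoint.submodule ℝ (Mat n n)).subtypeL.contDiff

theorem contDiff_skewHerm_val : ContDiff ℝ r (SkewHerm.val : SkewHerm n → Mat n n) :=
  (skewAdjoint.submodule ℝ (Mat n n)).subtypeL.contDiff

theorem contDiff_matSpace_val : ContDiff ℝ r (MatSpace.val : MatSpace m n → Mat m n) :=
  (contDiff_id : ContDiff ℝ r (id : Mat m n → Mat m n))

end smooth

/-! ### Frames -/

/-- A unitary basis of `ℂ^p`, split into its first `k` and its last `p - k` columns. -/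
structure Frame (p k : ℕ) where
  U : Mat p k
  N : Mat p (p - k)
  UU : Uᴴ * U = 1
  NN : Nᴴ * N = 1
  UN : Uᴴ * N = 0
  NU : Nᴴ * U = 0
  total : U * Uᴴ + N * Nᴴ = 1

theorem le_of_orthonormal {p k : ℕ} {U : Mat p k} (hU : Uᴴ * U = 1) : k ≤ p := by
  have h1 : (Uᴴ * U).rank ≤ U.rank := Matrix.rank_mul_le_right _ _
  have h2 : U.rank ≤ p := by simpa using Matrix.rank_le_height U
  rw [hU, Matrix.rank_one] at h1
  simpa using h1.trans h2

/-- Orthonormal columns extend to a unitary basis. -/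
theorem exists_frame {p k : ℕ} {U : Mat p k} (hU : Uᴴ * U = 1) : ∃ F : Frame p k, F.U = U := by
  have hkp := le_of_orthonormal hU
  let v : Fin k ⊕ Fin (p - k) → EuclideanSpace ℂ (Fin p) :=
    Sum.elim (fun j => WithLp.toLp 2 fun i => U i j) 0
  have hv : Orthonormal ℂ ((Set.range (Sum.inl : Fin k → Fin k ⊕ Fin (p - k))).domRestrict v) := by
    rw [orthonormal_iff_ite]
    rintro ⟨_, i, rfl⟩ ⟨_, j, rfl⟩
    have h := congrFun (congrFun hU i) j
    simp only [Matrix.mul_apply, Matrix.conjTranspose_apply, Matrix.one_apply] at h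
    simp only [Set.domRestrict, v, Sum.elim_inl]
    have h2 : inner ℂ (WithLp.toLp 2 fun a => U a i : EuclideanSpace ℂ (Fin p))
        (WithLp.toLp 2 fun a => U a j) = if i = j then 1 else 0 := by
      rw [← h]
      simp [PiLp.inner_apply, mul_comm]
    refine h2.trans ?_
    by_cases hij : i = j
    · subst hij
      rw [if_pos rfl, if_pos rfl]
    · rw [if_neg hij, if_neg]
      intro h3
      exact hij (Sum.inl_injective (congrArg Subtype.val h3))
  obtain ⟨b, hb⟩ := hv.exists_orthonormalBasis_extension_of_card_eq (by simp; omega)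
  let W : Matrix (Fin p) (Fin k ⊕ Fin (p - k)) ℂ := Matrix.of fun i j => b j i
  have hW : Wᴴ * W = 1 := by
    ext i j
    have := orthonormal_iff_ite.1 b.orthonormal i j
    rw [Matrix.one_apply, ← this]
    simp [W, Matrix.mul_apply, PiLp.inner_apply, mul_comm]
  have hW' : W * Wᴴ = 1 := (Matrix.mul_eq_one_comm_of_card_eq _ _ _ (by simp; omega)).1 hW
  have hWU : ∀ i j, W i (Sum.inl j) = U i j := by
    intro i j
    simp [W, hb (Sum.inl j) ⟨j, rfl⟩, v]
  let N : Mat p (p - k) := Matrix.of fun i j => W i (Sum.inr j)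
  have e1 : ∀ a c, (∑ i, star (W i a) * W i c) = (1 : Matrix _ _ ℂ) a c := by
    intro a c
    rw [← hW]; rfl
  refine ⟨⟨U, N, hU, ?_, ?_, ?_, ?_⟩, rfl⟩
  · ext i j
    have := e1 (Sum.inr i) (Sum.inr j)
    simpa [N, Matrix.mul_apply, Matrix.one_apply] using this
  · ext i j
    have := e1 (Sum.inl i) (Sum.inr j)
    simpa [N, Matrix.mul_apply, Matrix.one_apply, hWU] using this
  · ext i j
    have := e1 (Sum.inr i) (Sum.inl j)
    simpa [N, Matrix.mul_apply, Matrix.one_apply, hWU] using this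
  · rw [← hW']
    ext i j
    simp [N, Matrix.mul_apply, hWU]

/-! ### The Stiefel manifold -/

/-- The complex Stiefel manifold: `p × k` matrices with orthonormal columns. -/
def Stiefel (p k : ℕ) : Type := {U : Mat p k // Uᴴ * U = 1}

/-- The matrix underlying a point of the Stiefel manifold. -/
def Stiefel.val {p k : ℕ} (U : Stiefel p k) : Mat p k := U.1

theorem Stiefel.val_mul {p k : ℕ} (U : Stiefel p k) : U.valᴴ * U.val = 1 := U.2

theorem Stiefel.ext {p k : ℕ} {U V : Stiefel p k} (h : U.val = V.val) : U = V := Subtype.ext h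

instance (p k : ℕ) : TopologicalSpace (Stiefel p k) :=
  inferInstanceAs (TopologicalSpace {U : Mat p k // Uᴴ * U = 1})

theorem Stiefel.continuous_val {p k : ℕ} : Continuous (Stiefel.val : Stiefel p k → Mat p k) :=
  continuous_subtype_val

/-- The model vector space of the Stiefel manifold. -/
abbrev StiefelModel (p k : ℕ) := SkewHerm k × MatSpace (p - k) k

theorem isUnit_of_posDef_add {n : ℕ} {C : Mat n n} (h : (C + Cᴴ).PosDef) : IsUnit C := by
  rw [← Matrix.mulVec_injective_iff_isUnit]
  refine (injective_iff_map_eq_zero C.mulVecLin).2 fun v hv => ?_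
  by_contra hne
  have hv' : C *ᵥ v = 0 := hv
  have h1 : star v ⬝ᵥ (C *ᵥ v) = 0 := by rw [hv', dotProduct_zero]
  have h2 : star v ⬝ᵥ (Cᴴ *ᵥ v) = 0 := by
    rw [Matrix.dotProduct_mulVec, ← Matrix.star_mulVec, hv']
    simp
  have h3 := h.dotProduct_mulVec_pos hne
  rw [Matrix.add_mulVec, dotProduct_add, h1, h2] at h3
  simp at h3

namespace Frame

variable {p k : ℕ} (F : Frame p k)

/-- Cayley coordinates with respect to a frame. -/
def cayley (X : Mat p k) : StiefelModel p k :=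
  (skewPart ((2 : ℂ) • (1 + F.Uᴴ * X)⁻¹), -(F.Nᴴ * X * (1 + F.Uᴴ * X)⁻¹ : Mat (p - k) k))

/-- The matrix `1 + A + Bᴴ B` attached to `(A, B)`. -/
def den (z : StiefelModel p k) : Mat k k := 1 + z.1.val + z.2.valᴴ * z.2.val

/-- Inverse of the Cayley coordinates: the first `k` columns of `(1 - Z) (1 + Z)⁻¹`, where `Z` is
the skew-Hermitian matrix with blocks `A, -Bᴴ, B, 0`, written in the given frame. -/
def cayleyInv (z : StiefelModel p k) : Mat p k :=
  F.U * ((2 : ℂ) • (den z)⁻¹ - 1) - F.N * ((2 : ℂ) • (z.2.val * (den z)⁻¹))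

theorem den_add (z : StiefelModel p k) :
    den z + (den z)ᴴ = (2 : ℂ) • (1 + z.2.valᴴ * z.2.val) := by
  simp only [den, Matrix.conjTranspose_add, Matrix.conjTranspose_one, SkewHerm.conjTranspose_val,
    Matrix.conjTranspose_mul, Matrix.conjTranspose_conjTranspose]
  module

theorem isUnit_den (z : StiefelModel p k) : IsUnit (den z) := by
  apply isUnit_of_posDef_add
  rw [den_add, two_smul]
  have h : (1 + z.2.valᴴ * z.2.val).PosDef :=
    Matrix.PosDef.one.add_posSemidef (Matrix.posSemidef_conjTranspose_mul_self _)
  exact h.add h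

theorem proj_cayleyInv (z : StiefelModel p k) :
    F.Uᴴ * F.cayleyInv z = (2 : ℂ) • (den z)⁻¹ - 1 ∧
      F.Nᴴ * F.cayleyInv z = -((2 : ℂ) • (z.2.val * (den z)⁻¹)) := by
  constructor
  · rw [cayleyInv, Matrix.mul_sub, ← Matrix.mul_assoc, ← Matrix.mul_assoc, F.UU, F.UN]
    simp
  · rw [cayleyInv, Matrix.mul_sub, ← Matrix.mul_assoc, ← Matrix.mul_assoc, F.NN, F.NU]
    simp

theorem eq_sum (X : Mat p k) : X = F.U * (F.Uᴴ * X) + F.N * (F.Nᴴ * X) := by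
  rw [← Matrix.mul_assoc, ← Matrix.mul_assoc, ← Matrix.add_mul, F.total, Matrix.one_mul]

theorem gram (X : Mat p k) :
    Xᴴ * X = (F.Uᴴ * X)ᴴ * (F.Uᴴ * X) + (F.Nᴴ * X)ᴴ * (F.Nᴴ * X) := by
  simp only [Matrix.conjTranspose_mul, Matrix.conjTranspose_conjTranspose]
  calc Xᴴ * X = Xᴴ * (F.U * F.Uᴴ + F.N * F.Nᴴ) * X := by rw [F.total, Matrix.mul_one]
    _ = _ := by simp only [Matrix.mul_add, Matrix.add_mul, Matrix.mul_assoc]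

theorem cayleyInv_mem (z : StiefelModel p k) : (F.cayleyInv z)ᴴ * F.cayleyInv z = 1 := by
  have hu := isUnit_den z
  have hdet := (Matrix.isUnit_iff_isUnit_det _).1 hu
  have h1 : den z * (den z)⁻¹ = 1 := Matrix.mul_nonsing_inv _ hdet
  have h2 : ((den z)⁻¹)ᴴ * (den z)ᴴ = 1 := by rw [← Matrix.conjTranspose_mul, h1]; simp
  have h3 := den_add z
  rw [F.gram, (F.proj_cayleyInv z).1, (F.proj_cayleyInv z).2]
  set a := (den z)⁻¹
  set B := z.2.val
  have h4 : aᴴ * (den z + (den z)ᴴ) * a = aᴴ + a := by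
    rw [Matrix.mul_add, Matrix.add_mul, Matrix.mul_assoc, h1, h2]; simp
  rw [h3] at h4
  simp only [Matrix.conjTranspose_sub, Matrix.conjTranspose_smul, Matrix.conjTranspose_one,
    Matrix.conjTranspose_neg, Matrix.conjTranspose_mul, Matrix.sub_mul, Matrix.mul_sub,
    Matrix.smul_mul, Matrix.mul_smul, Matrix.neg_mul, Matrix.mul_neg, Matrix.one_mul,
    Matrix.mul_one, Matrix.mul_add, Matrix.add_mul, Matrix.mul_assoc, smul_add,
    star_ofNat] at h4 ⊢
  have h5 : (2 : ℂ) • (aᴴ * (Bᴴ * (B * a))) = aᴴ + a - (2 : ℂ) • (aᴴ * a) := by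
    rw [← h4]; abel
  rw [h5]
  module

theorem inv_two_smul {n : ℕ} {Y G : Mat n n} (h : Y * G = 1) :
    ((2 : ℂ) • G)⁻¹ = (1 / 2 : ℂ) • Y := by
  apply Matrix.inv_eq_left_inv
  rw [Matrix.smul_mul, Matrix.mul_smul, h, smul_smul]
  norm_num

theorem den_cayley {X : Mat p k} (hX : Xᴴ * X = 1) (hu : IsUnit (1 + F.Uᴴ * X).det) :
    den (F.cayley X) = (2 : ℂ) • (1 + F.Uᴴ * X)⁻¹ := by
  have h1 : (1 + F.Uᴴ * X) * (1 + F.Uᴴ * X)⁻¹ = 1 := Matrix.mul_nonsing_inv _ hu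
  have hg := F.gram X
  rw [hX] at hg
  change 1 + skew ((2 : ℂ) • (1 + F.Uᴴ * X)⁻¹) +
    (-(F.Nᴴ * X * (1 + F.Uᴴ * X)⁻¹))ᴴ * (-(F.Nᴴ * X * (1 + F.Uᴴ * X)⁻¹)) = _
  set Y := 1 + F.Uᴴ * X with hY
  set G := Y⁻¹
  set M := F.Nᴴ * X
  have hU : F.Uᴴ * X = Y - 1 := by rw [hY]; abel
  have h2 : Gᴴ * Yᴴ = 1 := by rw [← Matrix.conjTranspose_mul, h1]; simp
  have hM : Mᴴ * M = Y + Yᴴ - Yᴴ * Y := by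
    rw [hU] at hg
    have : Mᴴ * M = 1 - (Y - 1)ᴴ * (Y - 1) := eq_sub_of_add_eq' hg.symm
    rw [this]
    simp only [Matrix.conjTranspose_sub, Matrix.conjTranspose_one, Matrix.sub_mul, Matrix.mul_sub,
      Matrix.one_mul, Matrix.mul_one]
    abel
  have h3 : Gᴴ * (Mᴴ * M) * G = Gᴴ + G - 1 := by
    rw [hM]
    have e1 : Gᴴ * Y * G = Gᴴ := by rw [Matrix.mul_assoc, h1, Matrix.mul_one]
    have e2 : Gᴴ * Yᴴ * G = G := by rw [h2, Matrix.one_mul]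
    have e3 : Gᴴ * (Yᴴ * Y) * G = 1 := by
      rw [← Matrix.mul_assoc, h2, Matrix.one_mul, h1]
    rw [Matrix.mul_sub, Matrix.mul_add, Matrix.sub_mul, Matrix.add_mul, e1, e2, e3]
  have h4 : (-(M * G))ᴴ * (-(M * G)) = Gᴴ + G - 1 := by
    rw [← h3]
    simp [Matrix.mul_assoc]
  rw [h4, skew, Matrix.conjTranspose_smul, star_ofNat]
  module

theorem cayleyInv_cayley {X : Mat p k} (hX : Xᴴ * X = 1) (hu : IsUnit (1 + F.Uᴴ * X).det) :
    F.cayleyInv (F.cayley X) = X := by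
  have h1 : (1 + F.Uᴴ * X) * (1 + F.Uᴴ * X)⁻¹ = 1 := Matrix.mul_nonsing_inv _ hu
  have h1' : (1 + F.Uᴴ * X)⁻¹ * (1 + F.Uᴴ * X) = 1 := Matrix.nonsing_inv_mul _ hu
  have hB : (F.cayley X).2.val = -(F.Nᴴ * X * (1 + F.Uᴴ * X)⁻¹) := rfl
  have h2 : F.Nᴴ * X * (1 + F.Uᴴ * X)⁻¹ * ((1 / 2 : ℂ) • (1 + F.Uᴴ * X)) =
      (1 / 2 : ℂ) • (F.Nᴴ * X) := by
    rw [Matrix.mul_smul, Matrix.mul_assoc (F.Nᴴ * X), h1', Matrix.mul_one]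
  rw [cayleyInv, F.den_cayley hX hu, inv_two_smul h1, hB, Matrix.neg_mul, h2]
  conv_rhs => rw [F.eq_sum X]
  norm_num [smul_smul]

theorem cayley_cayleyInv (z : StiefelModel p k) : F.cayley (F.cayleyInv z) = z := by
  have hdet := (Matrix.isUnit_iff_isUnit_det _).1 (isUnit_den z)
  have h1 : den z * (den z)⁻¹ = 1 := Matrix.mul_nonsing_inv _ hdet
  have h1' : (den z)⁻¹ * den z = 1 := Matrix.nonsing_inv_mul _ hdet
  have e : (1 + F.Uᴴ * F.cayleyInv z)⁻¹ = (1 / 2 : ℂ) • den z := by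
    rw [(F.proj_cayleyInv z).1, add_sub_cancel, inv_two_smul h1]
  refine Prod.ext (SkewHerm.ext ?_) ?_
  · change skew ((2 : ℂ) • (1 + F.Uᴴ * F.cayleyInv z)⁻¹) = _
    rw [e, smul_smul, skew]
    simp only [den, Matrix.conjTranspose_add, Matrix.conjTranspose_one, Matrix.conjTranspose_smul,
      SkewHerm.conjTranspose_val, Matrix.conjTranspose_mul, Matrix.conjTranspose_conjTranspose]
    norm_num
    module
  · change -(F.Nᴴ * F.cayleyInv z * (1 + F.Uᴴ * F.cayleyInv z)⁻¹) = z.2.val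
    rw [e, (F.proj_cayleyInv z).2, Matrix.neg_mul, Matrix.smul_mul, Matrix.mul_smul,
      Matrix.mul_assoc, h1', Matrix.mul_one, smul_smul, neg_neg]
    norm_num

theorem contDiffAt_cayley {r : ℕ∞ω} {X : Mat p k} (hu : IsUnit (1 + F.Uᴴ * X).det) :
    ContDiffAt ℝ r F.cayley X := by
  have hu' := (Matrix.isUnit_iff_isUnit_det _).2 hu
  have h1 : ContDiffAt ℝ r (fun X : Mat p k => (1 + F.Uᴴ * X)⁻¹) X :=
    contDiffAt_inv (contDiffAt_const.add (contDiffAt_mul contDiffAt_const contDiffAt_id)) hu'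
  refine ContDiffAt.prodMk ?_ ?_
  · exact contDiff_skewPart.contDiffAt.comp X (h1.const_smul (2 : ℂ))
  · have h2 : ContDiffAt ℝ r (fun X : Mat p k => -(F.Nᴴ * X * (1 + F.Uᴴ * X)⁻¹)) X :=
      (contDiffAt_mul (contDiffAt_mul contDiffAt_const contDiffAt_id) h1).neg
    exact h2

theorem contDiff_cayleyInv {r : ℕ∞ω} : ContDiff ℝ r F.cayleyInv := by
  rw [contDiff_iff_contDiffAt]
  intro z
  have hA : ContDiffAt ℝ r (fun z : StiefelModel p k => z.1.val) z :=
    contDiff_skewHerm_val.contDiffAt.comp z contDiffAt_fst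
  have hB : ContDiffAt ℝ r (fun z : StiefelModel p k => z.2.val) z :=
    contDiff_matSpace_val.contDiffAt.comp z contDiffAt_snd
  have hd : ContDiffAt ℝ r (fun z : StiefelModel p k => (den z)⁻¹) z :=
    contDiffAt_inv ((contDiffAt_const.add hA).add
      (contDiffAt_mul (contDiffAt_conjTranspose hB) hB)) (isUnit_den z)
  exact (contDiffAt_mul contDiffAt_const ((hd.const_smul (2 : ℂ)).sub contDiffAt_const)).sub
    (contDiffAt_mul contDiffAt_const ((contDiffAt_mul hB hd).const_smul (2 : ℂ)))

theorem continuous_det_aux : Continuous fun X : Stiefel p k => (1 + F.Uᴴ * X.val).det := by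
  have h : Continuous fun X : Mat p k => (1 + F.Uᴴ * X).det := by fun_prop
  exact h.comp Stiefel.continuous_val

/-- Cayley chart of the Stiefel manifold centred at a frame. -/
def stiefelChart : OpenPartialHomeomorph (Stiefel p k) (StiefelModel p k) where
  toFun X := F.cayley X.val
  invFun z := ⟨F.cayleyInv z, F.cayleyInv_mem z⟩
  source := {X | IsUnit (1 + F.Uᴴ * X.val).det}
  target := Set.univ
  map_source' _ _ := trivial
  map_target' z _ := by
    have h := (F.proj_cayleyInv z).1
    have hu := (isUnit_den z)
    change IsUnit (1 + F.Uᴴ * F.cayleyInv z).det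
    rw [h, ← Matrix.isUnit_iff_isUnit_det, add_sub_cancel]
    have : IsUnit ((den z)⁻¹) := by
      rw [Matrix.isUnit_nonsing_inv_iff]; exact hu
    have h2 : IsUnit (algebraMap ℂ (Mat k k) 2) := (IsUnit.mk0 (2 : ℂ) two_ne_zero).map _
    rw [Algebra.smul_def]
    exact h2.mul this
  left_inv' X hX := by
    have h : IsUnit (1 + F.Uᴴ * X.val).det := hX
    exact Stiefel.ext (F.cayleyInv_cayley X.val_mul h)
  right_inv' z _ := F.cayley_cayleyInv z
  open_source := by
    have : {X : Stiefel p k | IsUnit (1 + F.Uᴴ * X.val).det} =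
        (fun X : Stiefel p k => (1 + F.Uᴴ * X.val).det) ⁻¹' {0}ᶜ := by
      ext X; simp
    rw [this]
    exact isOpen_compl_singleton.preimage F.continuous_det_aux
  open_target := isOpen_univ
  continuousOn_toFun := fun X hX => by
    have h : ContinuousAt F.cayley X.val := (F.contDiffAt_cayley (r := 0) hX).continuousAt
    exact (ContinuousAt.comp (f := Stiefel.val) h
      Stiefel.continuous_val.continuousAt).continuousWithinAt
  continuousOn_invFun := by
    have h : Continuous F.cayleyInv := (F.contDiff_cayleyInv (r := 0)).continuous
    exact (h.subtype_mk _).continuousOn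

theorem isUnit_self : IsUnit (1 + F.Uᴴ * F.U).det := by
  rw [F.UU, ← Matrix.isUnit_iff_isUnit_det]
  have h2 : IsUnit (algebraMap ℂ (Mat k k) 2) := (IsUnit.mk0 (2 : ℂ) two_ne_zero).map _
  convert h2 using 1
  rw [map_ofNat]
  norm_num

end Frame

/-- A frame whose first `k` columns are the given point of the Stiefel manifold. -/
def Stiefel.frame {p k : ℕ} (U : Stiefel p k) : Frame p k := (exists_frame U.val_mul).choose

theorem Stiefel.frame_U {p k : ℕ} (U : Stiefel p k) : U.frame.U = U.val :=
  (exists_frame U.val_mul).choose_spec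

instance (p k : ℕ) : ChartedSpace (StiefelModel p k) (Stiefel p k) where
  atlas := Set.range Frame.stiefelChart
  chartAt U := U.frame.stiefelChart
  mem_chart_source U := by
    have h := U.frame.isUnit_self
    have h2 := U.frame_U
    change IsUnit (1 + U.frame.Uᴴ * U.val).det
    rwa [h2] at h ⊢
  chart_mem_atlas U := ⟨_, rfl⟩

instance (p k : ℕ) : IsManifold 𝓘(ℝ, StiefelModel p k) ∞ (Stiefel p k) := by
  apply isManifold_of_contDiffOn
  rintro _ _ ⟨F, rfl⟩ ⟨G, rfl⟩ z hz
  have hz1 : IsUnit (1 + G.Uᴴ * F.cayleyInv z).det := by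
    exact hz.1.2
  have h := (G.contDiffAt_cayley (r := ∞) hz1).comp z F.contDiff_cayleyInv.contDiffAt
  exact h.contDiffWithinAt

/-! ### Hermitian positive definite matrices -/

theorem isOpen_posDef (k : ℕ) : IsOpen {S : Herm k | S.val.PosDef} := by
  let K := Metric.sphere (0 : EuclideanSpace ℂ (Fin k)) 1
  let f : Herm k × K → ℝ := fun q => (star q.2.1.ofLp ⬝ᵥ (q.1.val *ᵥ q.2.1.ofLp)).re
  have hval : Continuous (Herm.val : Herm k → Mat k k) := (contDiff_herm_val (r := 0)).continuous
  have hf : Continuous f := by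
    have h1 : Continuous fun q : Herm k × K => q.1.val := hval.comp continuous_fst
    have h2 : Continuous fun q : Herm k × K => q.2.1.ofLp := by fun_prop
    exact Complex.continuous_re.comp (h2.star.dotProduct (h1.matrix_mulVec h2))
  have hc : IsClosed (Prod.fst '' {q : Herm k × K | f q ≤ 0}) :=
    isClosedMap_fst_of_compactSpace _ (isClosed_le hf continuous_const)
  convert hc.isOpen_compl using 1
  ext S
  have hS : S.val.IsHermitian := S.conjTranspose_val
  simp only [Set.mem_ofPred_eq, Set.mem_compl_iff, Set.mem_image, not_exists, not_and]
  constructor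
  · rintro h ⟨S', x⟩ hx rfl
    have hx0 : x.1.ofLp ≠ 0 := by
      intro h0
      have h1 : ‖x.1‖ = 1 := by simp
      have h2 : x.1 = 0 := by
        ext i; simpa using congrFun h0 i
      rw [h2] at h1
      simp at h1
    have h3 := (Complex.pos_iff.1 (h.dotProduct_mulVec_pos hx0)).1
    exact absurd hx (not_le.2 h3)
  · intro h
    refine Matrix.PosDef.of_dotProduct_mulVec_pos hS fun v hv => ?_
    let y : EuclideanSpace ℂ (Fin k) := WithLp.toLp 2 v
    have hy : y ≠ 0 := by
      intro h0
      exact hv (by simpa [y] using congrArg WithLp.ofLp h0)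
    have hn : (0 : ℝ) < ‖y‖ := norm_pos_iff.2 hy
    let x : K := ⟨((‖y‖⁻¹ : ℝ) : ℂ) • y, by simp [K, norm_smul, hn.ne']⟩
    have h1 := h (S, x)
    have h2 : 0 < f (S, x) := by
      by_contra h3
      exact h1 (not_lt.1 h3) rfl
    have h4 : f (S, x) = ‖y‖⁻¹ ^ 2 * (star v ⬝ᵥ (S.val *ᵥ v)).re := by
      have hx : x.1.ofLp = ((‖y‖⁻¹ : ℝ) : ℂ) • v := rfl
      simp only [f, hx, Matrix.mulVec_smul, star_smul, smul_dotProduct, dotProduct_smul, smul_eq_mul]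
      rw [← mul_assoc]
      simp only [RCLike.star_def, Complex.conj_ofReal]
      rw [← Complex.ofReal_mul, Complex.re_ofReal_mul, sq]
    rw [h4] at h2
    have h5 : 0 < (star v ⬝ᵥ (S.val *ᵥ v)).re := by
      by_contra h6
      have : ‖y‖⁻¹ ^ 2 * (star v ⬝ᵥ (S.val *ᵥ v)).re ≤ 0 :=
        mul_nonpos_of_nonneg_of_nonpos (by positivity) (not_lt.1 h6)
      linarith
    refine Complex.pos_iff.2 ⟨h5, ?_⟩
    exact (hS.im_star_dotProduct_mulVec_self v).symm

/-- The manifold of Hermitian positive definite `k × k` matrices, an open subset of `Herm k`. -/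
def hpd (k : ℕ) : TopologicalSpace.Opens (Herm k) := ⟨{S | S.val.PosDef}, isOpen_posDef k⟩

/-! ### The product manifold and its quotient -/

/-- The product manifold `St_{p,k} × H^{++}_k`. -/
abbrev MBar (p k : ℕ) := Stiefel p k × hpd k

/-- The model vector space of the product manifold. -/
abbrev MBarModel (p k : ℕ) := StiefelModel p k × Herm k

/-- The model with corners of the product manifold. -/
abbrev IBar (p k : ℕ) :=
  (𝓘(ℝ, StiefelModel p k) : ModelWithCorners ℝ (StiefelModel p k) (StiefelModel p k)).prod
    (𝓘(ℝ, Herm k) : ModelWithCorners ℝ (Herm k) (Herm k))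

/-- The component `U` of a point `(U, Σ)`. -/
def MBar.U {p k : ℕ} (θ : MBar p k) : Mat p k := θ.1.val

/-- The component `Σ` of a point `(U, Σ)`. -/
def MBar.S {p k : ℕ} (θ : MBar p k) : Mat k k := θ.2.1.val

theorem MBar.U_mul {p k : ℕ} (θ : MBar p k) : θ.Uᴴ * θ.U = 1 := θ.1.val_mul
theorem MBar.S_posDef {p k : ℕ} (θ : MBar p k) : θ.S.PosDef := θ.2.2

theorem MBar.ext {p k : ℕ} {θ θ' : MBar p k} (hU : θ.U = θ'.U) (hS : θ.S = θ'.S) : θ = θ' :=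
  Prod.ext (Stiefel.ext hU) (Subtype.ext (Herm.ext hS))

theorem MBar.continuous_U {p k : ℕ} : Continuous (MBar.U : MBar p k → Mat p k) :=
  Stiefel.continuous_val.comp continuous_fst

theorem MBar.continuous_S {p k : ℕ} : Continuous (MBar.S : MBar p k → Mat k k) :=
  (contDiff_herm_val (r := 0)).continuous.comp (continuous_subtype_val.comp continuous_snd)

/-- The equivalence `(U, Σ) ∼ (U O, Oᴴ Σ O)` for unitary `O`. -/
instance orbitSetoid (p k : ℕ) : Setoid (MBar p k) where
  r θ θ' := ∃ O ∈ Matrix.unitaryGroup (Fin k) ℂ, θ'.U = θ.U * O ∧ θ'.S = Oᴴ * θ.S * O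
  iseqv :=
    { refl := fun θ => ⟨1, one_mem _, by simp, by simp⟩
      symm := by
        rintro θ θ' ⟨O, hO, h1, h2⟩
        have h3 : O * Oᴴ = 1 := Matrix.mem_unitaryGroup_iff.1 hO
        refine ⟨Oᴴ, Unitary.star_mem hO, ?_, ?_⟩
        · rw [h1, Matrix.mul_assoc, h3, Matrix.mul_one]
        · rw [h2, Matrix.conjTranspose_conjTranspose, Matrix.mul_assoc, Matrix.mul_assoc, h3,
            Matrix.mul_one, ← Matrix.mul_assoc, h3, Matrix.one_mul]
      trans := by
        rintro θ θ' θ'' ⟨O, hO, h1, h2⟩ ⟨O', hO', h1', h2'⟩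
        refine ⟨O * O', mul_mem hO hO', ?_, ?_⟩
        · rw [h1', h1, Matrix.mul_assoc]
        · rw [h2', h2, Matrix.conjTranspose_mul]
          simp only [Matrix.mul_assoc] }

/-- The quotient of the product manifold by the action of the unitary group, with the quotient
topology. -/
def MQuot (p k : ℕ) : Type := Quotient (orbitSetoid p k)

instance (p k : ℕ) : TopologicalSpace (MQuot p k) :=
  inferInstanceAs (TopologicalSpace (Quotient (orbitSetoid p k)))

/-- The canonical projection onto the quotient. -/
def proj (p k : ℕ) : MBar p k → MQuot p k := Quotient.mk (orbitSetoid p k)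

/-- The model vector space of the quotient manifold. -/
abbrev MQuotModel (p k : ℕ) := Herm k × MatSpace (p - k) k

/-- The model with corners of the quotient manifold. -/
abbrev IQuot (p k : ℕ) : ModelWithCorners ℝ (MQuotModel p k) (MQuotModel p k) :=
  𝓘(ℝ, MQuotModel p k)

/-- The point `(U, Σ)` of the product manifold. -/
def MBar.mk {p k : ℕ} (U : Mat p k) (S : Mat k k) (hU : Uᴴ * U = 1) (hS : S.PosDef) : MBar p k :=
  ⟨⟨U, hU⟩, ⟨⟨S, hS.1⟩, hS⟩⟩

/-- The map `(U, Σ) ↦ U Σ Uᴴ`. -/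
def MBar.toMat {p k : ℕ} (θ : MBar p k) : Mat p p := θ.U * θ.S * θ.Uᴴ

theorem MBar.continuous_toMat {p k : ℕ} : Continuous (MBar.toMat : MBar p k → Mat p p) :=
  (continuous_U.matrix_mul continuous_S).matrix_mul continuous_U.matrix_conjTranspose

theorem MBar.S_inv {p k : ℕ} (θ : MBar p k) : θ.S * θ.S⁻¹ = 1 :=
  Matrix.mul_nonsing_inv _ ((Matrix.isUnit_iff_isUnit_det _).1 θ.S_posDef.isUnit)

/-- The fibres of `(U, Σ) ↦ U Σ Uᴴ` are the equivalence classes. -/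
theorem toMat_eq_iff {p k : ℕ} {θ θ' : MBar p k} : θ.toMat = θ'.toMat ↔ θ ≈ θ' := by
  constructor
  · intro h
    have hU := θ.U_mul
    have hU' := θ'.U_mul
    have e1 : θ.U * θ.Uᴴ * θ'.toMat = θ'.toMat := by
      rw [← h, MBar.toMat]
      simp only [Matrix.mul_assoc]
      rw [← Matrix.mul_assoc θ.Uᴴ, hU, Matrix.one_mul]
    have e2 : θ'.toMat * θ'.U * θ'.S⁻¹ = θ'.U := by
      simp only [MBar.toMat, Matrix.mul_assoc]
      rw [← Matrix.mul_assoc θ'.Uᴴ, hU', Matrix.one_mul, θ'.S_inv, Matrix.mul_one]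
    have e3 : θ.U * (θ.Uᴴ * θ'.U) = θ'.U := by
      conv_rhs => rw [← e2, ← e1]
      conv_lhs => rw [← e2]
      simp only [Matrix.mul_assoc]
    refine ⟨θ.Uᴴ * θ'.U, ?_, e3.symm, ?_⟩
    · rw [Matrix.mem_unitaryGroup_iff', Matrix.star_eq_conjTranspose, Matrix.conjTranspose_mul,
        Matrix.conjTranspose_conjTranspose, Matrix.mul_assoc, e3, hU']
    · have e4 : θ'.Uᴴ * θ'.toMat * θ'.U = θ'.S := by
        simp only [MBar.toMat, Matrix.mul_assoc]
        rw [hU', Matrix.mul_one, ← Matrix.mul_assoc, hU', Matrix.one_mul]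
      rw [← e4, ← h, MBar.toMat, Matrix.conjTranspose_mul, Matrix.conjTranspose_conjTranspose]
      simp only [Matrix.mul_assoc]
  · rintro ⟨O, hO, h1, h2⟩
    have h3 : O * Oᴴ = 1 := Matrix.mem_unitaryGroup_iff.1 hO
    rw [MBar.toMat, MBar.toMat, h1, h2, Matrix.conjTranspose_mul]
    simp only [Matrix.mul_assoc]
    rw [← Matrix.mul_assoc O Oᴴ (θ.Uᴴ), h3, Matrix.one_mul, ← Matrix.mul_assoc O, h3,
      Matrix.one_mul]

open scoped Matrix.Norms.L2Operator MatrixOrder in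
theorem continuousOn_sqrt_mat (k : ℕ) :
    ContinuousOn (CFC.sqrt : Mat k k → Mat k k) {A | A.PosSemidef} := by
  have h : ContinuousOn (CFC.sqrt : Mat k k → Mat k k) {A | 0 ≤ A} := CFC.continuousOn_sqrt
  simpa only [Matrix.nonneg_iff_posSemidef] using h

open scoped MatrixOrder in
/-- The square root of a positive definite matrix. -/
theorem sqrt_mat {k : ℕ} {G : Mat k k} (h : G.PosDef) :
    (CFC.sqrt G).PosDef ∧ CFC.sqrt G * CFC.sqrt G = G := by
  have h1 : CFC.sqrt G * CFC.sqrt G = G := CFC.sqrt_mul_sqrt_self G h.posSemidef.nonneg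
  have h2 : (CFC.sqrt G).PosSemidef := Matrix.nonneg_iff_posSemidef.1 (CFC.sqrt_nonneg G)
  refine ⟨h2.posDef_iff_isUnit.2 ?_, h1⟩
  have h3 := h.isUnit
  rw [← h1] at h3
  exact isUnit_of_mul_isUnit_left h3

namespace Frame

variable {p k : ℕ} (F : Frame p k)

/-- Coordinates of a Hermitian matrix of rank `k` with respect to a frame. -/
def coord (H : Mat p p) : MQuotModel p k :=
  (hermPart (F.Uᴴ * H * F.U), (F.Nᴴ * H * F.U : Mat (p - k) k))

/-- The product of the matrix with coordinates `(A, C)` with the first `k` frame columns. -/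
def cols (z : MQuotModel p k) : Mat p k := F.U * z.1.val + F.N * z.2.val

/-- The matrix with coordinates `(A, C)`. -/
def ofCoord (z : MQuotModel p k) : Mat p p := F.cols z * z.1.val⁻¹ * (F.cols z)ᴴ

theorem proj_cols (z : MQuotModel p k) :
    F.Uᴴ * F.cols z = z.1.val ∧ F.Nᴴ * F.cols z = z.2.val := by
  constructor
  · rw [cols, Matrix.mul_add, ← Matrix.mul_assoc, ← Matrix.mul_assoc, F.UU, F.UN]; simp
  · rw [cols, Matrix.mul_add, ← Matrix.mul_assoc, ← Matrix.mul_assoc, F.NN, F.NU]; simp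

theorem inv_mul_of_posDef {A : Mat k k} (hA : A.PosDef) : A⁻¹ * A = 1 ∧ A * A⁻¹ = 1 :=
  have h := (Matrix.isUnit_iff_isUnit_det _).1 hA.isUnit
  ⟨Matrix.nonsing_inv_mul _ h, Matrix.mul_nonsing_inv _ h⟩

theorem coord_ofCoord {z : MQuotModel p k} (hz : z.1.val.PosDef) : F.coord (F.ofCoord z) = z := by
  have h1 : (F.cols z)ᴴ * F.U = z.1.val := by
    have h := congrArg Matrix.conjTranspose (F.proj_cols z).1
    rwa [Matrix.conjTranspose_mul, Matrix.conjTranspose_conjTranspose, z.1.conjTranspose_val] at h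
  have h2 : F.ofCoord z * F.U = F.cols z := by
    rw [ofCoord, Matrix.mul_assoc, h1, Matrix.mul_assoc, (inv_mul_of_posDef hz).1, Matrix.mul_one]
  refine Prod.ext (Herm.ext ?_) ?_
  · change herm (F.Uᴴ * F.ofCoord z * F.U) = _
    rw [Matrix.mul_assoc, h2, (F.proj_cols z).1, herm, z.1.conjTranspose_val]
    module
  · change F.Nᴴ * F.ofCoord z * F.U = z.2.val
    rw [Matrix.mul_assoc, h2, (F.proj_cols z).2]

theorem herm_coord (θ : MBar p k) :
    (F.coord θ.toMat).1.val = (F.Uᴴ * θ.U) * θ.S * (F.Uᴴ * θ.U)ᴴ := by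
  change herm (F.Uᴴ * θ.toMat * F.U) = _
  have h : F.Uᴴ * θ.toMat * F.U = (F.Uᴴ * θ.U) * θ.S * (F.Uᴴ * θ.U)ᴴ := by
    rw [MBar.toMat, Matrix.conjTranspose_mul, Matrix.conjTranspose_conjTranspose]
    simp only [Matrix.mul_assoc]
  rw [h, herm]
  have h2 : ((F.Uᴴ * θ.U) * θ.S * (F.Uᴴ * θ.U)ᴴ)ᴴ = (F.Uᴴ * θ.U) * θ.S * (F.Uᴴ * θ.U)ᴴ := by
    simp only [Matrix.conjTranspose_mul, Matrix.conjTranspose_conjTranspose, Matrix.mul_assoc,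
      θ.S_posDef.1.eq]
  rw [h2]
  module

theorem ofCoord_coord {θ : MBar p k} (hθ : (F.coord θ.toMat).1.val.PosDef) :
    F.ofCoord (F.coord θ.toMat) = θ.toMat := by
  have hA := F.herm_coord θ
  have hcols : F.cols (F.coord θ.toMat) = θ.U * θ.S * (F.Uᴴ * θ.U)ᴴ := by
    have h : F.Uᴴ * (θ.toMat * F.U) = (F.coord θ.toMat).1.val := by
      rw [hA, MBar.toMat, Matrix.conjTranspose_mul, Matrix.conjTranspose_conjTranspose]
      simp only [Matrix.mul_assoc]
    have h' : F.Nᴴ * (θ.toMat * F.U) = (F.coord θ.toMat).2.val := (Matrix.mul_assoc _ _ _).symm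
    rw [cols, ← h, ← h', ← F.eq_sum, MBar.toMat, Matrix.conjTranspose_mul,
      Matrix.conjTranspose_conjTranspose]
    simp only [Matrix.mul_assoc]
  set X := F.Uᴴ * θ.U with hX
  have hXu : IsUnit X := by
    have h := hθ.isUnit
    rw [hA, Matrix.mul_assoc] at h
    exact isUnit_of_mul_isUnit_left h
  have hXd := (Matrix.isUnit_iff_isUnit_det _).1 hXu
  have hX1 : X⁻¹ * X = 1 := Matrix.nonsing_inv_mul _ hXd
  have hX2 : X * X⁻¹ = 1 := Matrix.mul_nonsing_inv _ hXd
  have hX3 : Xᴴ * (X⁻¹)ᴴ = 1 := by rw [← Matrix.conjTranspose_mul, hX1]; simp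
  have hinv : (F.coord θ.toMat).1.val⁻¹ = (X⁻¹)ᴴ * θ.S⁻¹ * X⁻¹ := by
    apply Matrix.inv_eq_right_inv
    rw [hA]
    simp only [Matrix.mul_assoc]
    rw [← Matrix.mul_assoc Xᴴ, hX3, Matrix.one_mul, ← Matrix.mul_assoc θ.S, θ.S_inv,
      Matrix.one_mul, hX2]
  rw [ofCoord, hcols, hinv, MBar.toMat]
  simp only [Matrix.conjTranspose_mul, Matrix.conjTranspose_conjTranspose, Matrix.mul_assoc,
    θ.S_posDef.1.eq]
  rw [← Matrix.mul_assoc Xᴴ, hX3, Matrix.one_mul, ← Matrix.mul_assoc X⁻¹, hX1, Matrix.one_mul,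
    ← Matrix.mul_assoc θ.S, θ.S_inv, Matrix.one_mul]

theorem gram_cols_posDef {z : MQuotModel p k} (hz : z.1.val.PosDef) :
    ((F.cols z)ᴴ * F.cols z).PosDef := by
  apply Matrix.PosDef.conjTranspose_mul_self
  intro v w hvw
  have h := congrArg (fun x => F.Uᴴ *ᵥ x) hvw
  simp only [Matrix.mulVec_mulVec, (F.proj_cols z).1] at h
  exact Matrix.mulVec_injective_iff_isUnit.2 hz.isUnit h

open scoped MatrixOrder in
/-- The square root of the Gram matrix of `cols`. -/
def root (z : MQuotModel p k) : Mat k k := CFC.sqrt ((F.cols z)ᴴ * F.cols z)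

theorem root_posDef {z : MQuotModel p k} (hz : z.1.val.PosDef) : (F.root z).PosDef :=
  (sqrt_mat (F.gram_cols_posDef hz)).1

theorem root_mul_root {z : MQuotModel p k} (hz : z.1.val.PosDef) :
    F.root z * F.root z = (F.cols z)ᴴ * F.cols z :=
  (sqrt_mat (F.gram_cols_posDef hz)).2

theorem repr_aux_U {z : MQuotModel p k} (hz : z.1.val.PosDef) :
    (F.cols z * (F.root z)⁻¹)ᴴ * (F.cols z * (F.root z)⁻¹) = 1 := by
  have hR := F.root_posDef hz
  have hR' := inv_mul_of_posDef hR
  rw [Matrix.conjTranspose_mul, hR.inv.1.eq, Matrix.mul_assoc, ← Matrix.mul_assoc (F.cols z)ᴴ,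
    ← F.root_mul_root hz, Matrix.mul_assoc (F.root z), hR'.2, Matrix.mul_one, hR'.1]

theorem repr_aux_S {z : MQuotModel p k} (hz : z.1.val.PosDef) :
    (F.root z * z.1.val⁻¹ * F.root z).PosDef := by
  have hR := F.root_posDef hz
  have h := hz.inv.conjTranspose_mul_mul_same (Matrix.mulVec_injective_iff_isUnit.2 hR.isUnit)
  rwa [hR.1.eq] at h

open scoped Classical in
/-- A continuous choice of a representative of the class with coordinates `(A, C)`. -/
def repr (z : MQuotModel p k) : MBar p k :=
  if hz : z.1.val.PosDef then
    MBar.mk (F.cols z * (F.root z)⁻¹) (F.root z * z.1.val⁻¹ * F.root z)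
      (F.repr_aux_U hz) (F.repr_aux_S hz)
  else MBar.mk F.U 1 F.UU Matrix.PosDef.one

theorem toMat_repr {z : MQuotModel p k} (hz : z.1.val.PosDef) :
    (F.repr z).toMat = F.ofCoord z := by
  have hR := F.root_posDef hz
  have hR' := inv_mul_of_posDef hR
  rw [repr, dif_pos hz]
  change (F.cols z * (F.root z)⁻¹) * (F.root z * z.1.val⁻¹ * F.root z) *
    (F.cols z * (F.root z)⁻¹)ᴴ = _
  rw [Matrix.conjTranspose_mul, hR.inv.1.eq, ofCoord]
  simp only [Matrix.mul_assoc]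
  rw [← Matrix.mul_assoc (F.root z)⁻¹ (F.root z), hR'.1, Matrix.one_mul,
    ← Matrix.mul_assoc (F.root z) (F.root z)⁻¹, hR'.2, Matrix.one_mul]

theorem contDiff_cols {r : ℕ∞ω} : ContDiff ℝ r F.cols := by
  rw [contDiff_iff_contDiffAt]
  intro z
  exact (contDiffAt_mul contDiffAt_const (contDiff_herm_val.contDiffAt.comp z contDiffAt_fst)).add
    (contDiffAt_mul contDiffAt_const (contDiff_matSpace_val.contDiffAt.comp z contDiffAt_snd))

theorem contDiffAt_inv_fst {r : ℕ∞ω} {z : MQuotModel p k} (hz : z.1.val.PosDef) :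
    ContDiffAt ℝ r (fun z : MQuotModel p k => z.1.val⁻¹) z :=
  contDiffAt_inv (contDiff_herm_val.contDiffAt.comp z contDiffAt_fst) hz.isUnit

theorem contDiffAt_ofCoord {r : ℕ∞ω} {z : MQuotModel p k} (hz : z.1.val.PosDef) :
    ContDiffAt ℝ r F.ofCoord z :=
  contDiffAt_mul (contDiffAt_mul F.contDiff_cols.contDiffAt (contDiffAt_inv_fst hz))
    (contDiffAt_conjTranspose F.contDiff_cols.contDiffAt)

theorem contDiff_coord {r : ℕ∞ω} : ContDiff ℝ r F.coord := by
  rw [contDiff_iff_contDiffAt]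
  intro H
  have h : ∀ {m n : ℕ} (P : Mat m p) (Q : Mat p n),
      ContDiffAt ℝ r (fun H : Mat p p => P * H * Q) H := fun P Q =>
    contDiffAt_mul (contDiffAt_mul contDiffAt_const contDiffAt_id) contDiffAt_const
  exact (contDiff_hermPart.contDiffAt.comp H (h F.Uᴴ F.U)).prodMk (h F.Nᴴ F.U)

theorem continuous_coord_toMat : Continuous fun θ : MBar p k => F.coord θ.toMat :=
  (F.contDiff_coord (r := 0)).continuous.comp MBar.continuous_toMat

/-- The coordinates of a point of the quotient. -/
def quotCoord : MQuot p k → MQuotModel p k :=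
  Quotient.lift (fun θ => F.coord θ.toMat) fun _ _ h => congrArg F.coord (toMat_eq_iff.2 h)

theorem continuous_quotCoord : Continuous (F.quotCoord : MQuot p k → MQuotModel p k) :=
  F.continuous_coord_toMat.quotient_lift _

theorem isOpen_target : IsOpen {z : MQuotModel p k | z.1.val.PosDef} :=
  (isOpen_posDef k).preimage continuous_fst

theorem continuousOn_repr : ContinuousOn F.repr {z : MQuotModel p k | z.1.val.PosDef} := by
  set T := {z : MQuotModel p k | z.1.val.PosDef}
  have hcols : Continuous F.cols := (F.contDiff_cols (r := 0)).continuous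
  have hroot : ContinuousOn F.root T := by
    refine (continuousOn_sqrt_mat k).comp
      (hcols.matrix_conjTranspose.matrix_mul hcols).continuousOn ?_
    intro z hz
    exact (F.gram_cols_posDef hz).posSemidef
  have hinv : ContinuousOn (fun z => (F.root z)⁻¹) T := by
    intro z hz
    have h1 : ContinuousAt (fun A : Mat k k => A⁻¹) (F.root z) :=
      (contDiffAt_inv (r := 0) contDiffAt_id (F.root_posDef hz).isUnit).continuousAt
    exact ContinuousAt.comp_continuousWithinAt h1 (hroot z hz)
  have hA : ContinuousOn (fun z : MQuotModel p k => z.1.val⁻¹) T := fun z hz =>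
    (contDiffAt_inv_fst (r := 0) hz).continuousAt.continuousWithinAt
  have hcols' : Continuous fun z : T => F.cols z.1 := hcols.comp continuous_subtype_val
  have hroot' : Continuous fun z : T => F.root z.1 :=
    continuousOn_iff_continuous_domRestrict.1 hroot
  have hinv' : Continuous fun z : T => (F.root z.1)⁻¹ :=
    continuousOn_iff_continuous_domRestrict.1 hinv
  have hA' : Continuous fun z : T => z.1.1.val⁻¹ := continuousOn_iff_continuous_domRestrict.1 hA
  have hU : Continuous fun z : T => F.cols z.1 * (F.root z.1)⁻¹ := hcols'.matrix_mul hinv'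
  have hS : Continuous fun z : T => F.root z.1 * z.1.1.val⁻¹ * F.root z.1 :=
    (hroot'.matrix_mul hA').matrix_mul hroot'
  rw [continuousOn_iff_continuous_domRestrict]
  have h : T.domRestrict F.repr = fun z : T =>
      MBar.mk (F.cols z.1 * (F.root z.1)⁻¹) (F.root z.1 * z.1.1.val⁻¹ * F.root z.1)
      (F.repr_aux_U z.2) (F.repr_aux_S z.2) := by
    ext1 z
    exact dif_pos z.2
  rw [h]
  exact (hU.subtype_mk _).prodMk ((hS.subtype_mk _).subtype_mk _)

/-- The chart of the quotient attached to a frame: the class of `(U, Σ)` is sent to the blocks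
`(U₀ᴴ H U₀, N₀ᴴ H U₀)` of `H = U Σ Uᴴ`. -/
def quotChart : OpenPartialHomeomorph (MQuot p k) (MQuotModel p k) where
  toFun := F.quotCoord
  invFun z := proj p k (F.repr z)
  source := {q | (F.quotCoord q).1.val.PosDef}
  target := {z | z.1.val.PosDef}
  map_source' _ h := h
  map_target' z hz := by
    change (F.coord (F.repr z).toMat).1.val.PosDef
    rw [F.toMat_repr hz, F.coord_ofCoord hz]
    exact hz
  left_inv' q hq := by
    obtain ⟨θ, rfl⟩ := Quotient.exists_rep q
    have hq' : (F.coord θ.toMat).1.val.PosDef := hq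
    exact Quotient.sound (toMat_eq_iff.1 ((F.toMat_repr hq').trans (F.ofCoord_coord hq')))
  right_inv' z hz := by
    have hz' : z.1.val.PosDef := hz
    change F.coord (F.repr z).toMat = z
    rw [F.toMat_repr hz', F.coord_ofCoord hz']
  open_source := isOpen_target.preimage F.continuous_quotCoord
  open_target := isOpen_target
  continuousOn_toFun := F.continuous_quotCoord.continuousOn
  continuousOn_invFun := continuous_quotient_mk'.comp_continuousOn F.continuousOn_repr

end Frame

/-- A frame adapted to a representative of a point of the quotient. -/
def MQuot.frame {p k : ℕ} (q : MQuot p k) : Frame p k := (Quotient.out q).1.frame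

instance (p k : ℕ) : ChartedSpace (MQuotModel p k) (MQuot p k) where
  atlas := Set.range Frame.quotChart
  chartAt q := q.frame.quotChart
  mem_chart_source q := by
    set θ := Quotient.out q with hθ
    have hq : q = proj p k θ := (Quotient.out_eq q).symm
    have hU : q.frame.U = θ.U := θ.1.frame_U
    change (q.frame.quotCoord q).1.val.PosDef
    have h : q.frame.quotCoord q = q.frame.coord θ.toMat := by
      conv_lhs => arg 2; rw [hq]
      rfl
    rw [h, Frame.herm_coord, hU, θ.U_mul]
    simpa using θ.S_posDef
  chart_mem_atlas q := ⟨_, rfl⟩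

instance (p k : ℕ) : IsManifold (IQuot p k) ∞ (MQuot p k) := by
  apply isManifold_of_contDiffOn
  rintro _ _ ⟨F, rfl⟩ ⟨G, rfl⟩
  have hsub : ∀ z ∈ (IQuot p k).symm ⁻¹' (F.quotChart.symm ≫ₕ G.quotChart).source ∩
      Set.range (IQuot p k), z.1.val.PosDef := fun z hz => hz.1.1
  intro z hz
  have h := (G.contDiff_coord (r := ∞)).contDiffAt.comp z (F.contDiffAt_ofCoord (hsub z hz))
  refine h.contDiffWithinAt.congr (fun y hy => ?_) ?_
  · exact congrArg G.coord (F.toMat_repr (hsub y hy))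
  · exact congrArg G.coord (F.toMat_repr (hsub z hz))

/-! ### Riemannian geometry of smooth maps -/

section Riemannian

variable {E : Type*} [NormedAddCommGroup E] [NormedSpace ℝ E]
  {H : Type*} [TopologicalSpace H] (I : ModelWithCorners ℝ E H)
  (M : Type*) [TopologicalSpace M] [ChartedSpace H M] [IsManifold I ∞ M]

/-- Smooth Riemannian metrics on `M`. -/
abbrev RiemMetric := ContMDiffRiemannianMetric I ∞ E (TangentSpace I : M → Type _)

/-- Affine connections on `M`; `D η x v` is the covariant derivative of `η` at `x` along `v`. -/
abbrev AffineConnection := CovariantDerivative I E (TangentSpace I : M → Type _)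

/-- Vector fields on `M`, without regularity condition. -/
abbrev VField := ∀ x : M, TangentSpace I x

variable {I M}

/-- Differentiability of a vector field at a point. -/
def VFieldDiffAt (η : VField I M) (x : M) : Prop :=
  MDifferentiableAt I I.tangent (fun y => (⟨y, η y⟩ : TangentBundle I M)) x

/-- A connection is a Levi-Civita connection if it is torsion free and compatible with the
metric: `v⟨σ, τ⟩ = ⟨∇_v σ, τ⟩ + ⟨σ, ∇_v τ⟩`. -/
def IsLeviCivita [FiniteDimensional ℝ E] [CompleteSpace E] (g : RiemMetric I M)
    (D : AffineConnection I M) : Prop :=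
  D.torsion = 0 ∧
    ∀ (x : M) (v : TangentSpace I x) (σ τ : VField I M), VFieldDiffAt σ x → VFieldDiffAt τ x →
      mfderiv I 𝓘(ℝ, ℝ) (fun y => g.inner y (σ y) (τ y)) x v =
        g.inner x (D σ x v) (τ x) + g.inner x (σ x) (D τ x v)

variable {E' : Type*} [NormedAddCommGroup E'] [NormedSpace ℝ E']
  {H' : Type*} [TopologicalSpace H'] (J : ModelWithCorners ℝ E' H')
  {N : Type*} [TopologicalSpace N] [ChartedSpace H' N]

/-- The vertical space of `f` at `x`: the tangent space of the fibre, that is the kernel of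
`Df(x)`. -/
def vertical (f : M → N) (x : M) : Submodule ℝ (TangentSpace I x) :=
  LinearMap.ker (mfderiv I J f x).toLinearMap

/-- The horizontal space of `f` at `x`: the orthogonal complement of the vertical space. -/
def horizontal (g : RiemMetric I M) (f : M → N) (x : M) : Submodule ℝ (TangentSpace I x) where
  carrier := {ξ | ∀ ν ∈ vertical J f x, g.inner x ξ ν = 0}
  add_mem' := fun ha hb ν hν => by simp [ha ν hν, hb ν hν]
  zero_mem' := fun ν _ => by simp
  smul_mem' := fun c a ha ν hν => by simp [ha ν hν]

theorem isCompl_horizontal [FiniteDimensional ℝ E] (g : RiemMetric I M) (f : M → N) (x : M) :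
    IsCompl (horizontal J g f x) (vertical J f x) := by
  have : FiniteDimensional ℝ (TangentSpace I x) := inferInstanceAs (FiniteDimensional ℝ E)
  let B : LinearMap.BilinForm ℝ (TangentSpace I x) :=
    LinearMap.mk₂ ℝ (fun v w => g.inner x v w) (by simp) (by simp) (by simp) (by simp)
  have hB : B.IsRefl := fun v w h => by
    have h' : g.inner x v w = 0 := h
    change g.inner x w v = 0
    rw [g.symm, h']
  have hH : B.orthogonal (vertical J f x) = horizontal J g f x := by
    ext v
    refine forall₂_congr fun w _ => ?_
    change g.inner x w v = 0 ↔ g.inner x v w = 0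
    rw [g.symm]
  have hd : Disjoint (vertical J f x) (B.orthogonal (vertical J f x)) := by
    rw [Submodule.disjoint_def]
    intro v hv hv'
    by_contra hne
    exact absurd (hv' v hv) (g.pos x v hne).ne'
  have h := (LinearMap.BilinForm.isCompl_orthogonal_iff_disjoint hB).2 hd
  rw [hH] at h
  exact h.symm

/-- The orthogonal projection of the tangent space onto the horizontal space. -/
def horizontalProj [FiniteDimensional ℝ E] (g : RiemMetric I M) (f : M → N) (x : M)
    (ξ : TangentSpace I x) : TangentSpace I x :=
  (Submodule.projectionOnto _ _ (isCompl_horizontal J g f x) ξ : horizontal J g f x)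

/-- `w` is the horizontal representative at `x` of the tangent vector `ζ` at `f x`. -/
def IsHorizontalRep (g : RiemMetric I M) (f : M → N) (x : M) (ζ : TangentSpace J (f x))
    (w : TangentSpace I x) : Prop :=
  w ∈ horizontal J g f x ∧ mfderiv I J f x w = ζ

/-- `f` is a Riemannian submersion. -/
structure IsRiemannianSubmersion [IsManifold J ∞ N] (g : RiemMetric I M) (h : RiemMetric J N)
    (f : M → N) : Prop where
  contMDiff : ContMDiff I J ∞ f
  surjective_mfderiv : ∀ x, Function.Surjective (mfderiv I J f x)
  isometry : ∀ x, ∀ ξ ∈ horizontal J g f x, ∀ η ∈ horizontal J g f x,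
    h.inner (f x) (mfderiv I J f x ξ) (mfderiv I J f x η) = g.inner x ξ η

end Riemannian

/-! ### Geometry of the product manifold in matrix coordinates -/

section Product

variable {p k : ℕ}

/-- Entrywise derivative of a matrix valued function on the product manifold. -/
def matDeriv {m n : ℕ} (f : MBar p k → Mat m n) (θ : MBar p k)
    (ξ : TangentSpace (IBar p k) θ) : Mat m n :=
  Matrix.of fun i j => mfderiv (IBar p k) 𝓘(ℝ, ℂ) (fun x => f x i j) θ ξ

/-- The pair of matrices `(ξ_U, ξ_Σ)` representing a tangent vector: its image under the
differential of the inclusion of the product manifold into `ℂ^{p×k} × ℂ^{k×k}`. -/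
def ambient (θ : MBar p k) (ξ : TangentSpace (IBar p k) θ) : Mat p k × Mat k k :=
  (matDeriv MBar.U θ ξ, matDeriv MBar.S θ ξ)

/-- The directional derivative `D η [ξ]` of a vector field, viewed as a map into
`ℂ^{p×k} × ℂ^{k×k}`. -/
def dirDeriv (η : VField (IBar p k) (MBar p k)) (θ : MBar p k)
    (ξ : TangentSpace (IBar p k) θ) : Mat p k × Mat k k :=
  (matDeriv (fun x => (ambient x (η x)).1) θ ξ, matDeriv (fun x => (ambient x (η x)).2) θ ξ)

/-- The bilinear form
`Re tr(ξ_Uᴴ (I - U Uᴴ / 2) η_U) + α tr(Σ⁻¹ ξ_Σ Σ⁻¹ η_Σ) + β tr(Σ⁻¹ ξ_Σ) tr(Σ⁻¹ η_Σ)`;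
the last two terms are real for Hermitian `ξ_Σ, η_Σ`. -/
def metricForm (α β : ℝ) (θ : MBar p k) (ξ η : Mat p k × Mat k k) : ℝ :=
  (ξ.1ᴴ * (1 - (1 / 2 : ℂ) • (θ.U * θ.Uᴴ)) * η.1).trace.re +
    α * (θ.S⁻¹ * ξ.2 * θ.S⁻¹ * η.2).trace.re +
    β * ((θ.S⁻¹ * ξ.2).trace * (θ.S⁻¹ * η.2).trace).re

/-- The projection `P_θ` of `ℂ^{p×k} × ℂ^{k×k}` onto the tangent space at `θ`. -/
def tangentProj (θ : MBar p k) (Z : Mat p k × Mat k k) : Mat p k × Mat k k :=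
  (Z.1 - θ.U * herm (θ.Uᴴ * Z.1), herm Z.2)

/-- The correction term of the Levi-Civita connection. -/
def correction (θ : MBar p k) (ξ η : Mat p k × Mat k k) : Mat p k × Mat k k :=
  ((1 - θ.U * θ.Uᴴ) * herm (η.1 * ξ.1ᴴ) * θ.U, -herm (η.2 * θ.S⁻¹ * ξ.2))

end Product

end FixedRank

end

open FixedRank

/-!
The pair of matrices `(U, Σ)` embeds the total space into `ℂ^{p×k} × ℂ^{k×k}`, so tangent vectors,
their brackets and the derivatives of functions can be computed in matrix coordinates. The proof has
two halves: general facts about Riemannian submersions, and a computation with matrices.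

*Riemannian submersions.* A Levi-Civita connection is unique because the difference of two of them
is a tensor which is symmetric by the absence of torsion and skew by compatibility
(`IsLeviCivita.unique`). Let `f` be a surjective submersion. In charts the horizontal lift is given by
`G⁻¹ Aᵀ (A G⁻¹ Aᵀ)⁻¹`, where `G` is the metric and `A` the differential of `f`, so lifts of
differentiable or smooth fields are differentiable or smooth (`exists_smooth_lift`). If any two points
of a fibre are related by a linear isometry of their tangent spaces commuting with the differential
of `f`, then the inner products of horizontal lifts define a metric on the base, which is smooth
because smoothness can be tested after composition with `f` (`exists_isRiemannianSubmersion`).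
Finally, differentiating horizontal lifts at one chosen point of each fibre and projecting defines a
connection on the base; it is torsion free because lifts of fields are `f`-related to them and hence
so are their brackets, and compatible with the metric by the isometry property
(`exists_isLeviCivita_descent`). Since the chosen point is arbitrary, uniqueness gives the formula for
the connection of the base at every point (`IsLeviCivita.isHorizontalRep`).

*Matrix computation.* The differential `amb` of the embedding identifies the tangent space with the
pairs for which `Uᴴ ξ_U` is skew-Hermitian and `ξ_Σ` is Hermitian (`amb_mem`, `exists_amb_eq`). The
form `metricForm` is positive there: on the second factor, with `Y = Σ^{-1/2} ξ_Σ Σ^{-1/2}`, it is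
`α ‖Y‖² + β (tr Y)²`, and `(tr Y)² ≤ k ‖Y‖²` (`metricForm_pos`). The claimed formula for the
connection takes tangent values and is a covariant derivative; it is torsion free because the
correction term is symmetric, and its compatibility with the metric is an identity between real
parts of traces (`stiefel_compat`, `hpd_compat`), where the constraints obtained by differentiating
the tangency conditions replace the normal part of the derivative of a field
(`exists_isLeviCivita_metricBar`). The unitary group acts along the fibres by isometries
(`exists_fibre_isometry`), and the differential of the projection is computed in the charts of the
quotient as that of `(U, Σ) ↦ U Σ Uᴴ` (`mfderiv_proj`), which gives its surjectivity. Thus the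
general results apply to the projection.
-/

noncomputable section

open scoped Matrix Manifold ContDiff ComplexOrder Matrix.Norms.Elementwise Topology
open Bundle

namespace FixedRank

/-! ### Derivatives and Lie brackets in charts -/

section TangentCoordinates

variable {E : Type*} [NormedAddCommGroup E] [NormedSpace ℝ E]
  {H : Type*} [TopologicalSpace H] {I : ModelWithCorners ℝ E H}
  {M : Type*} [TopologicalSpace M] [ChartedSpace H M] [IsManifold I ∞ M]
  {V : Type*} [NormedAddCommGroup V] [NormedSpace ℝ V]

/-- The trivialization of the tangent bundle at `x` is the differential of the chart at `x`. -/
theorem trivializationAt_snd (x : M) {y : M} (hy : y ∈ (chartAt H x).source)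
    (v : TangentSpace I y) :
    (trivializationAt E (TangentSpace I) x ⟨y, v⟩).2 = mvfderiv I (extChartAt I x) y v := by
  have h := TangentBundle.continuousLinearMapAt_trivializationAt (I := I) (x₀ := x) hy
  have h2 : (trivializationAt E (TangentSpace I) x).continuousLinearMapAt ℝ y v =
      mvfderiv I (extChartAt I x) y v := by rw [h]; rfl
  rw [← h2, Trivialization.continuousLinearMapAt_apply, Trivialization.linearMapAt_apply, if_pos]
  simpa using hy

/-- A vector field is differentiable at `x` iff its expression in the chart at `x` is. -/
theorem vfieldDiffAt_iff {η : VField I M} {x : M} :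
    VFieldDiffAt η x ↔
      MDifferentiableAt I 𝓘(ℝ, E) (fun y => mvfderiv I (extChartAt I x) y (η y)) x := by
  rw [VFieldDiffAt, mdifferentiableAt_section]
  refine Filter.EventuallyEq.mdifferentiableAt_iff ?_
  filter_upwards [chart_source_mem_nhds H x] with y hy
  exact trivializationAt_snd x hy _

theorem contMDiffAt_vfield_iff {η : VField I M} {x : M} {n : ℕ∞ω} :
    ContMDiffAt I I.tangent n (fun y => (⟨y, η y⟩ : TangentBundle I M)) x ↔
      ContMDiffAt I 𝓘(ℝ, E) n (fun y => mvfderiv I (extChartAt I x) y (η y)) x := by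
  rw [contMDiffAt_section]
  refine Filter.EventuallyEq.contMDiffAt_iff ?_
  filter_upwards [chart_source_mem_nhds H x] with y hy
  exact trivializationAt_snd x hy _

theorem mvfderiv_extChartAt_self (x : M) (v : TangentSpace I x) :
    mvfderiv I (extChartAt I x) x v = v := by
  change mfderiv I 𝓘(ℝ, E) (extChartAt I x) x v = v
  rw [mfderiv_extChartAt_self]; rfl

omit [IsManifold I ∞ M] in
/-- Chain rule for a function on a manifold followed by a map of normed spaces. -/
theorem mvfderiv_fun_comp {W : Type*} [NormedAddCommGroup W] [NormedSpace ℝ W] {g : V → W}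
    {f : M → V} {x : M} (hg : DifferentiableAt ℝ g (f x)) (hf : MDifferentiableAt I 𝓘(ℝ, V) f x)
    (v : TangentSpace I x) :
    mvfderiv I (fun y => g (f y)) x v = fderiv ℝ g (f x) (mvfderiv I f x v) := by
  have h := mfderiv_comp_apply (I := I) (I' := 𝓘(ℝ, V)) (I'' := 𝓘(ℝ, W)) (g := g) x
    hg.mdifferentiableAt hf v
  rw [mfderiv_eq_fderiv] at h
  exact h

omit [IsManifold I ∞ M] in
theorem mvfderiv_clm_comp {W : Type*} [NormedAddCommGroup W] [NormedSpace ℝ W] (L : V →L[ℝ] W)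
    {f : M → V} {x : M} (hf : MDifferentiableAt I 𝓘(ℝ, V) f x) (v : TangentSpace I x) :
    mvfderiv I (fun y => L (f y)) x v = L (mvfderiv I f x v) := by
  rw [mvfderiv_fun_comp (g := L) L.differentiableAt hf, L.fderiv]

omit [IsManifold I ∞ M] in
theorem mvfderiv_congr {f g : M → V} {x : M} (h : f =ᶠ[𝓝 x] g) (v : TangentSpace I x) :
    mvfderiv I f x v = mvfderiv I g x v := by
  change mfderiv I 𝓘(ℝ, V) f x v = mfderiv I 𝓘(ℝ, V) g x v
  rw [h.mfderiv_eq]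
  rfl

omit [IsManifold I ∞ M] in
/-- Leibniz rule for the evaluation of a family of continuous linear maps. -/
theorem mvfderiv_clm_apply {V' : Type*} [NormedAddCommGroup V'] [NormedSpace ℝ V']
    {c : M → V →L[ℝ] V'} {u : M → V} {x : M} (hc : MDifferentiableAt I 𝓘(ℝ, V →L[ℝ] V') c x)
    (hu : MDifferentiableAt I 𝓘(ℝ, V) u x) (v : TangentSpace I x) :
    mvfderiv I (fun y => c y (u y)) x v =
      mvfderiv I c x v (u x) + c x (mvfderiv I u x v) := by
  have hp : MDifferentiableAt I 𝓘(ℝ, (V →L[ℝ] V') × V) (fun y => (c y, u y)) x :=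
    hc.prodMk_space hu
  have hB := (isBoundedBilinearMap_apply (𝕜 := ℝ) (E := V) (F := V')).hasFDerivAt (c x, u x)
  have h := mvfderiv_fun_comp (g := fun q : (V →L[ℝ] V') × V => q.1 q.2)
    (f := fun y => (c y, u y)) hB.differentiableAt hp v
  refine h.trans ?_
  have h1 := mvfderiv_clm_comp (ContinuousLinearMap.fst ℝ (V →L[ℝ] V') V) hp v
  have h2 := mvfderiv_clm_comp (ContinuousLinearMap.snd ℝ (V →L[ℝ] V') V) hp v
  rw [hB.fderiv]
  simp only [IsBoundedBilinearMap.deriv, ContinuousLinearMap.coe_fst',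
    ContinuousLinearMap.coe_snd'] at h1 h2 ⊢
  rw [h1, h2]
  exact add_comm _ _

omit [IsManifold I ∞ M] in
/-- Leibniz rule for a continuous bilinear map. -/
theorem mvfderiv_bilin {V' W : Type*} [NormedAddCommGroup V'] [NormedSpace ℝ V']
    [NormedAddCommGroup W] [NormedSpace ℝ W] (B : V →L[ℝ] V' →L[ℝ] W)
    {u : M → V} {w : M → V'} {x : M} (hu : MDifferentiableAt I 𝓘(ℝ, V) u x)
    (hw : MDifferentiableAt I 𝓘(ℝ, V') w x) (v : TangentSpace I x) :
    mvfderiv I (fun y => B (u y) (w y)) x v =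
      B (mvfderiv I u x v) (w x) + B (u x) (mvfderiv I w x v) := by
  have hB : MDifferentiableAt I 𝓘(ℝ, V' →L[ℝ] W) (fun y => B (u y)) x :=
    B.differentiableAt.mdifferentiableAt.comp x hu
  rw [mvfderiv_clm_apply hB hw, mvfderiv_clm_comp B hu]

variable [I.Boundaryless]

omit [IsManifold I ∞ M] in
theorem contDiffAt_comp_extChartAt_symm {f : M → V} {x : M} {n : ℕ∞ω}
    (hf : ContMDiffAt I 𝓘(ℝ, V) n f x) :
    ContDiffAt ℝ n (f ∘ (extChartAt I x).symm) (extChartAt I x x) := by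
  have h := (contMDiffAt_iff.1 hf).2
  rwa [I.range_eq_univ, contDiffWithinAt_univ] at h

/-- The chain rule for a function factored through the chart at `x`. -/
theorem mvfderiv_eventually_eq_fderiv {f : M → V} {x : M} (hf : ContMDiffAt I 𝓘(ℝ, V) ∞ f x) :
    ∀ᶠ y in 𝓝 x, ∀ v : TangentSpace I y, mvfderiv I f y v =
      fderiv ℝ (f ∘ (extChartAt I x).symm) (extChartAt I x y)
        (mvfderiv I (extChartAt I x) y v) := by
  have h1 : ContDiffAt ℝ 1 (f ∘ (extChartAt I x).symm) (extChartAt I x x) :=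
    (contDiffAt_comp_extChartAt_symm hf).of_le (by simp)
  have h2 : ∀ᶠ y in 𝓝 x, DifferentiableAt ℝ (f ∘ (extChartAt I x).symm) (extChartAt I x y) := by
    refine (continuousAt_extChartAt x).eventually ?_
    filter_upwards [h1.eventually (by simp)] with z hz
    exact hz.differentiableAt (by simp)
  filter_upwards [h2, (chart_source_mem_nhds H x), eventually_eventually_nhds.2
    (extChartAt_source_mem_nhds (I := I) x)] with y hy hy' hy'' v
  have hφ : MDifferentiableAt I 𝓘(ℝ, E) (extChartAt I x) y := mdifferentiableAt_extChartAt hy'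
  have h3 : f =ᶠ[𝓝 y] fun z => (f ∘ (extChartAt I x).symm) (extChartAt I x z) := by
    filter_upwards [hy''] with z hz
    exact congrArg f ((extChartAt I x).left_inv hz).symm
  rw [mvfderiv_congr h3, mvfderiv_fun_comp hy hφ]

omit [IsManifold I ∞ M] in
theorem contDiffAt_fderiv_comp_extChartAt_symm {f : M → V} {x : M}
    (hf : ContMDiffAt I 𝓘(ℝ, V) ∞ f x) :
    ContDiffAt ℝ ∞ (fderiv ℝ (f ∘ (extChartAt I x).symm)) (extChartAt I x x) :=
  (contDiffAt_comp_extChartAt_symm hf).fderiv_right (by simp)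

/-- The derivative of a smooth function along a differentiable vector field is differentiable. -/
theorem VFieldDiffAt.mdifferentiableAt_mvfderiv {f : M → V} {x : M} {η : VField I M}
    (hη : VFieldDiffAt η x) (hf : ContMDiffAt I 𝓘(ℝ, V) ∞ f x) :
    MDifferentiableAt I 𝓘(ℝ, V) (fun y => mvfderiv I f y (η y)) x := by
  have h1 := (contDiffAt_fderiv_comp_extChartAt_symm hf).differentiableAt (by simp)
  have h2 : MDifferentiableAt I 𝓘(ℝ, E →L[ℝ] V)
      (fun y => fderiv ℝ (f ∘ (extChartAt I x).symm) (extChartAt I x y)) x :=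
    h1.mdifferentiableAt.comp x (mdifferentiableAt_extChartAt (mem_chart_source H x))
  refine (h2.clm_apply (vfieldDiffAt_iff.1 hη)).congr_of_eventuallyEq ?_
  filter_upwards [mvfderiv_eventually_eq_fderiv hf] with y hy
  exact hy _

theorem contMDiffAt_mvfderiv {f : M → V} {x : M} {η : VField I M}
    (hη : ContMDiffAt I I.tangent ∞ (fun y => (⟨y, η y⟩ : TangentBundle I M)) x)
    (hf : ContMDiffAt I 𝓘(ℝ, V) ∞ f x) :
    ContMDiffAt I 𝓘(ℝ, V) ∞ (fun y => mvfderiv I f y (η y)) x := by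
  have h2 : ContMDiffAt I 𝓘(ℝ, E →L[ℝ] V) ∞
      (fun y => fderiv ℝ (f ∘ (extChartAt I x).symm) (extChartAt I x y)) x :=
    (contDiffAt_fderiv_comp_extChartAt_symm hf).contMDiffAt.comp x contMDiffAt_extChartAt
  refine (h2.clm_apply (contMDiffAt_vfield_iff.1 hη)).congr_of_eventuallyEq ?_
  filter_upwards [mvfderiv_eventually_eq_fderiv hf] with y hy
  exact hy _

/-- The Lie bracket in the chart at `x`. -/
theorem mlieBracket_eq_mvfderiv [CompleteSpace E] {X Y : VField I M} {x : M}
    (hX : VFieldDiffAt X x) (hY : VFieldDiffAt Y x) :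
    (VectorField.mlieBracket I X Y x : E) =
      mvfderiv I (fun y => mvfderiv I (extChartAt I x) y (Y y)) x (X x) -
        mvfderiv I (fun y => mvfderiv I (extChartAt I x) y (X y)) x (Y x) := by
  set φ := extChartAt I x with hφ
  let W : VField I M → E → E := fun Z z => mvfderiv I φ (φ.symm z) (Z (φ.symm z))
  have hW : ∀ Z : VField I M, (fun z => (VectorField.mpullbackWithin 𝓘(ℝ, E) I φ.symm Z
      (Set.range I) z : E)) =ᶠ[𝓝 (φ x)] W Z := by
    intro Z
    filter_upwards [extChartAt_target_mem_nhds (I := I) x] with z hz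
    have h1 := mfderivWithin_extChartAt_symm_comp_mfderiv_extChartAt hz
    have h2 := mfderiv_extChartAt_comp_mfderivWithin_extChartAt_symm hz
    have h3 := ContinuousLinearMap.inverse_eq h1 h2
    change (mfderivWithin 𝓘(ℝ, E) I φ.symm (Set.range I) z).inverse (Z (φ.symm z)) = _
    rw [h3]
    rfl
  -- The pullback takes values in tangent spaces of `E`; `P` is the same field with values in `E`.
  obtain ⟨P, hP⟩ : ∃ P : VField I M → E → E, P = fun Z z =>
      VectorField.mpullbackWithin 𝓘(ℝ, E) I φ.symm Z (Set.range I) z := ⟨_, rfl⟩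
  have hPW : ∀ Z : VField I M, P Z =ᶠ[𝓝 (φ x)] W Z := by
    intro Z
    rw [hP]
    exact hW Z
  have e1 : (VectorField.mlieBracket I X Y x : E) =
      VectorField.lieBracketWithin ℝ (P X) (P Y) Set.univ (φ x) := by
    obtain ⟨L, hL⟩ : ∃ L : E →L[ℝ] E, L = mfderiv I 𝓘(ℝ, E) φ x := ⟨_, rfl⟩
    have h : (VectorField.mlieBracket I X Y x : E) =
        L.inverse (VectorField.lieBracketWithin ℝ (P X) (P Y)
            (φ.symm ⁻¹' Set.univ ∩ Set.range I) (φ x)) := by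
      rw [hP, hL]
      exact VectorField.mlieBracketWithin_apply
    have h2 : L = ContinuousLinearMap.id ℝ E := hL.trans mfderiv_extChartAt_self
    rw [h, h2, ContinuousLinearMap.inverse_id, I.range_eq_univ, Set.preimage_univ, Set.univ_inter]
    rfl
  have key : ∀ Z : VField I M, VFieldDiffAt Z x → ∀ v : TangentSpace I x,
      fderiv ℝ (W Z) (φ x) v = mvfderiv I (fun y => mvfderiv I φ y (Z y)) x v := by
    intro Z hZ v
    have hd := vfieldDiffAt_iff.1 hZ
    have hd2 : DifferentiableAt ℝ (W Z) (φ x) := by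
      have h := hd.differentiableWithinAt_writtenInExtChartAt
      rw [I.range_eq_univ, differentiableWithinAt_univ] at h
      exact h
    have h3 : (fun y => mvfderiv I φ y (Z y)) =ᶠ[𝓝 x] fun y => W Z (φ y) := by
      filter_upwards [extChartAt_source_mem_nhds (I := I) x] with y hy
      simp only [W]
      rw [φ.left_inv hy]
    rw [mvfderiv_congr h3, mvfderiv_fun_comp hd2
      (mdifferentiableAt_extChartAt (mem_chart_source H x)), mvfderiv_extChartAt_self]
  have e2 : ∀ Z : VField I M, W Z (φ x) = Z x := by
    intro Z
    simp only [W]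
    rw [φ.left_inv (mem_extChartAt_source x), mvfderiv_extChartAt_self]
  rw [e1, VectorField.lieBracketWithin_univ, (hPW X).lieBracket_vectorField_eq (hPW Y),
    VectorField.lieBracket_eq]
  simp only [e2]
  rw [key Y hY, key X hX]

/-- `[X, Y] f = X (Y f) - Y (X f)`, for vector valued functions. -/
theorem mvfderiv_mlieBracket [CompleteSpace E] {X Y : VField I M} {x : M}
    (hX : VFieldDiffAt X x) (hY : VFieldDiffAt Y x) {f : M → V}
    (hf : ContMDiffAt I 𝓘(ℝ, V) ∞ f x) :
    mvfderiv I f x (VectorField.mlieBracket I X Y x) =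
      mvfderiv I (fun y => mvfderiv I f y (Y y)) x (X x) -
        mvfderiv I (fun y => mvfderiv I f y (X y)) x (Y x) := by
  set F := f ∘ (extChartAt I x).symm with hF
  have hF2 := contDiffAt_fderiv_comp_extChartAt_symm hf
  have hF1 := contDiffAt_comp_extChartAt_symm hf
  have hd := hF2.differentiableAt (by simp)
  have hφ := mdifferentiableAt_extChartAt (I := I) (mem_chart_source H x)
  have key : ∀ Z : VField I M, VFieldDiffAt Z x → ∀ v : TangentSpace I x,
      mvfderiv I (fun y => mvfderiv I f y (Z y)) x v =
        fderiv ℝ (fderiv ℝ F) (extChartAt I x x) v (Z x) + fderiv ℝ F (extChartAt I x x)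
          (mvfderiv I (fun y => mvfderiv I (extChartAt I x) y (Z y)) x v) := by
    intro Z hZ v
    have h1 : (fun y => mvfderiv I f y (Z y)) =ᶠ[𝓝 x] fun y =>
        fderiv ℝ F (extChartAt I x y) (mvfderiv I (extChartAt I x) y (Z y)) := by
      filter_upwards [mvfderiv_eventually_eq_fderiv hf] with y hy
      exact hy _
    rw [mvfderiv_congr h1]
    have hZ' := vfieldDiffAt_iff.1 hZ
    have h2 : MDifferentiableAt I 𝓘(ℝ, E →L[ℝ] V)
        (fun y => fderiv ℝ F (extChartAt I x y)) x := hd.mdifferentiableAt.comp x hφ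
    rw [mvfderiv_clm_apply h2 hZ', mvfderiv_fun_comp hd hφ, mvfderiv_extChartAt_self,
      mvfderiv_extChartAt_self]
  -- The second derivative cancels in the commutator because it is symmetric.
  have hs : ∀ v w : E, fderiv ℝ (fderiv ℝ F) (extChartAt I x x) v w =
      fderiv ℝ (fderiv ℝ F) (extChartAt I x x) w v := fun v w =>
    (hF1.isSymmSndFDerivAt (by
      rw [minSmoothness_of_isRCLikeNormedField]
      exact WithTop.coe_le_coe.2 (le_top : (2 : ℕ∞) ≤ ⊤))).eq v w
  have h0 := (mvfderiv_eventually_eq_fderiv hf).self_of_nhds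
  rw [h0, mvfderiv_extChartAt_self, key Y hY, key X hX, mlieBracket_eq_mvfderiv hX hY, map_sub]
  have aux : ∀ a b c d : V, a = b → c - d = (a + c) - (b + d) := by
    rintro a b c d rfl
    abel
  exact aux _ _ _ _ (hs (X x) (Y x))

/-- Fields related by a smooth map have related brackets. -/
theorem mfderiv_mlieBracket_of_related [CompleteSpace E]
    {E' : Type*} [NormedAddCommGroup E'] [NormedSpace ℝ E'] [CompleteSpace E']
    {H' : Type*} [TopologicalSpace H'] {J : ModelWithCorners ℝ E' H'} [J.Boundaryless]
    {N : Type*} [TopologicalSpace N] [ChartedSpace H' N] [IsManifold J ∞ N]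
    {f : M → N} (hf : ContMDiff I J ∞ f) {X Y : VField I M} {X' Y' : VField J N} {x : M}
    (hX : VFieldDiffAt X x) (hY : VFieldDiffAt Y x) (hX' : VFieldDiffAt X' (f x))
    (hY' : VFieldDiffAt Y' (f x)) (hXX' : ∀ y, mfderiv I J f y (X y) = X' (f y))
    (hYY' : ∀ y, mfderiv I J f y (Y y) = Y' (f y)) :
    mfderiv I J f x (VectorField.mlieBracket I X Y x) = VectorField.mlieBracket J X' Y' (f x) := by
  set φ := extChartAt J (f x) with hφ
  have hφs : ContMDiffAt J 𝓘(ℝ, E') ∞ φ (f x) := contMDiffAt_extChartAt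
  have hφf : ContMDiffAt I 𝓘(ℝ, E') ∞ (φ ∘ f) x := hφs.comp x hf.contMDiffAt
  have hfd : ∀ y, MDifferentiableAt I J f y := fun y => hf.contMDiffAt.mdifferentiableAt (by simp)
  have hnear : ∀ᶠ y in 𝓝 x, MDifferentiableAt J 𝓘(ℝ, E') φ (f y) := by
    filter_upwards [hf.continuous.continuousAt.eventually
      (chart_source_mem_nhds H' (f x))] with y hy
    exact mdifferentiableAt_extChartAt hy
  have hchain : ∀ y, MDifferentiableAt J 𝓘(ℝ, E') φ (f y) → ∀ v : TangentSpace I y,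
      mvfderiv I (φ ∘ f) y v = mvfderiv J φ (f y) (mfderiv I J f y v) := fun y hy v =>
    mfderiv_comp_apply y hy (hfd y) v
  have key : ∀ (Z : VField I M) (Z' : VField J N), VFieldDiffAt Z' (f x) →
      (∀ y, mfderiv I J f y (Z y) = Z' (f y)) → ∀ v : TangentSpace I x,
      mvfderiv I (fun y => mvfderiv I (φ ∘ f) y (Z y)) x v =
        mvfderiv J (fun z => mvfderiv J φ z (Z' z)) (f x) (mfderiv I J f x v) := by
    intro Z Z' hZ' hZZ' v
    have h1 : (fun y => mvfderiv I (φ ∘ f) y (Z y)) =ᶠ[𝓝 x]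
        (fun z => mvfderiv J φ z (Z' z)) ∘ f := by
      filter_upwards [hnear] with y hy
      rw [hchain y hy, hZZ']
      rfl
    rw [mvfderiv_congr h1]
    exact mfderiv_comp_apply x (vfieldDiffAt_iff.1 hZ') (hfd x) v
  have h1 := mvfderiv_mlieBracket hX hY hφf
  rw [hchain x hnear.self_of_nhds, key Y Y' hY' hYY', key X X' hX' hXX', hXX', hYY',
    ← mlieBracket_eq_mvfderiv hX' hY', mvfderiv_extChartAt_self] at h1
  exact h1

end TangentCoordinates

/-! ### Uniqueness of Levi-Civita connections -/

section LeviCivita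

variable {E : Type*} [NormedAddCommGroup E] [NormedSpace ℝ E]
  {H : Type*} [TopologicalSpace H] {I : ModelWithCorners ℝ E H}
  {M : Type*} [TopologicalSpace M] [ChartedSpace H M] [IsManifold I ∞ M]

theorem VFieldDiffAt.mdifferentiableAt_inner {g : RiemMetric I M} {x : M} {σ τ : VField I M}
    (hσ : VFieldDiffAt σ x) (hτ : VFieldDiffAt τ x) :
    MDifferentiableAt I 𝓘(ℝ, ℝ) (fun y => g.inner y (σ y) (τ y)) x := by
  have h := MDifferentiableAt.clm_bundle_apply₂ (F₁ := E) (F₂ := E) (F₃ := ℝ) (b := fun y : M => y)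
    (E₃ := Bundle.Trivial M ℝ) (ψ := g.inner)
    ((g.contMDiff.contMDiffAt (x := x)).mdifferentiableAt (by simp)) hσ hτ
  simp only [mdifferentiableAt_totalSpace] at h
  exact h.2

theorem contMDiffAt_inner {g : RiemMetric I M} {x : M} {σ τ : VField I M}
    (hσ : ContMDiffAt I I.tangent ∞ (fun y => (⟨y, σ y⟩ : TangentBundle I M)) x)
    (hτ : ContMDiffAt I I.tangent ∞ (fun y => (⟨y, τ y⟩ : TangentBundle I M)) x) :
    ContMDiffAt I 𝓘(ℝ, ℝ) ∞ (fun y => g.inner y (σ y) (τ y)) x := by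
  have h := ContMDiffAt.clm_bundle_apply₂ (F₁ := E) (F₂ := E) (F₃ := ℝ) (b := fun y : M => y)
    (E₃ := Bundle.Trivial M ℝ) (ψ := g.inner)
    (g.contMDiff.contMDiffAt (x := x)) hσ hτ
  simp only [contMDiffAt_totalSpace] at h
  exact h.2

/-- A tangent vector is determined by its inner products. -/
theorem eq_of_inner_eq (g : RiemMetric I M) {x : M} {v w : TangentSpace I x}
    (h : ∀ z, g.inner x v z = g.inner x w z) : v = w := by
  by_contra hne
  have h1 := g.pos x (v - w) (sub_ne_zero.2 hne)
  rw [map_sub (g.inner x) v w, sub_apply, h, sub_self] at h1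
  exact lt_irrefl _ h1

/-- A trilinear form symmetric in its first two and skew in its last two arguments vanishes. -/
theorem eq_zero_of_symm_of_skew {T : Type*} {c : T → T → T → ℝ} (h1 : ∀ u v w, c u v w = c v u w)
    (h2 : ∀ u v w, c u v w = -c u w v) (u v w : T) : c u v w = 0 := by
  have e1 := h2 u v w
  have e2 := h1 u w v
  have e3 := h2 w u v
  have e4 := h1 w v u
  have e5 := h2 v w u
  have e6 := h1 v u w
  linarith

variable [FiniteDimensional ℝ E] [CompleteSpace E]

/-- Two Levi-Civita connections of the same metric agree on differentiable fields: their difference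
is a tensor which is symmetric by the absence of torsion and skew by compatibility. -/
theorem IsLeviCivita.unique {g : RiemMetric I M} {D D' : AffineConnection I M}
    (hD : IsLeviCivita g D) (hD' : IsLeviCivita g D') {σ : VField I M} {x : M}
    (hσ : VFieldDiffAt σ x) (v : TangentSpace I x) : D σ x v = D' σ x v := by
  have ext : ∀ w : TangentSpace I x, ∃ τ : VField I M, VFieldDiffAt τ x ∧ τ x = w := fun w =>
    ⟨FiberBundle.extend E w, FiberBundle.mdifferentiableAt_extend .., by simp⟩
  -- `A` is the difference tensor; lowering an index makes it symmetric and skew.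
  set A := IsCovariantDerivativeOn.difference D.isCovariantDerivativeOnUniv
    D'.isCovariantDerivativeOnUniv x with hAdef
  have hA : ∀ τ : VField I M, VFieldDiffAt τ x → ∀ v, A (τ x) v = D τ x v - D' τ x v := by
    intro τ hτ v
    rw [hAdef, IsCovariantDerivativeOn.difference_apply (hσ := hτ)]
    rfl
  have hsymm : ∀ u v, A u v = A v u := by
    intro u v
    obtain ⟨X, hX, rfl⟩ := ext u
    obtain ⟨Y, hY, rfl⟩ := ext v
    rw [hA X hX, hA Y hY]
    have e1 := (D.torsion_eq_zero_iff.1 hD.1) hX hY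
    have e2 := (D'.torsion_eq_zero_iff.1 hD'.1) hX hY
    have e3 := e1.trans e2.symm
    rw [sub_eq_sub_iff_add_eq_add] at e3 ⊢
    rw [add_comm, add_comm (D Y x (X x)), e3.symm, add_comm]
  have hskew : ∀ u v w, g.inner x (A u v) w = -g.inner x (A w v) u := by
    intro u v w
    obtain ⟨X, hX, rfl⟩ := ext u
    obtain ⟨Y, hY, rfl⟩ := ext w
    rw [hA X hX, hA Y hY]
    have e1 := hD.2 x v X Y hX hY
    have e2 := hD'.2 x v X Y hX hY
    have e3 := e1.symm.trans e2
    simp only [map_sub, sub_apply]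
    rw [g.symm x (D Y x v), g.symm x (D' Y x v)]
    have aux : ∀ a b c d : ℝ, a + c = b + d → a - b = -(c - d) := by
      intro a b c d h
      linarith
    exact aux _ _ _ _ e3
  have hzero : A (σ x) v = 0 := by
    apply eq_of_inner_eq g
    intro z
    rw [map_zero, zero_apply]
    refine eq_zero_of_symm_of_skew (c := fun u v w => g.inner x (A u v) w) ?_ ?_ (σ x) v z
    · intro u v w
      simp only [hsymm u v]
    · intro u v w
      simp only [hsymm u v, hsymm u w, hskew v u w]
  rw [hA σ hσ] at hzero
  exact sub_eq_zero.1 hzero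

end LeviCivita

/-! ### Construction of Riemannian metrics -/

section MetricConstruction

variable {E : Type*} [NormedAddCommGroup E] [NormedSpace ℝ E]
  {H : Type*} [TopologicalSpace H] {I : ModelWithCorners ℝ E H}
  {M : Type*} [TopologicalSpace M] [ChartedSpace H M]

/-- Smoothness of a family of linear maps on a finite-dimensional space can be tested pointwise. -/
theorem contMDiffAt_clm_of_apply {V W : Type*} [NormedAddCommGroup V] [NormedSpace ℝ V]
    [FiniteDimensional ℝ V] [NormedAddCommGroup W] [NormedSpace ℝ W] {F : M → V →L[ℝ] W} {x : M}
    {n : ℕ∞ω} (h : ∀ v, ContMDiffAt I 𝓘(ℝ, W) n (fun y => F y v) x) :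
    ContMDiffAt I 𝓘(ℝ, V →L[ℝ] W) n F x := by
  let b := Module.finBasis ℝ V
  let c : Fin (Module.finrank ℝ V) → V →L[ℝ] ℝ := fun i => (b.coord i).toContinuousLinearMap
  have hF : F = fun y => ∑ i, ContinuousLinearMap.smulRightL ℝ V W (c i) (F y (b i)) := by
    funext y
    ext v
    conv_lhs => rw [← b.sum_repr v]
    simp only [map_sum, map_smul, c]
    simp
  rw [hF]
  exact contMDiffAt_finsetSum fun i _ =>
    ((ContinuousLinearMap.smulRightL ℝ V W (c i)).contDiff.contMDiff.contMDiffAt).comp x (h (b i))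

/-- The unit ball of a definite form on a finite-dimensional space is bounded. -/
theorem isVonNBounded_of_pos [FiniteDimensional ℝ E] {B : E →L[ℝ] E →L[ℝ] ℝ}
    (hB : ∀ v, v ≠ 0 → 0 < B v v) : Bornology.IsVonNBounded ℝ {v : E | B v v < 1} := by
  have : ProperSpace E := FiniteDimensional.proper ℝ E
  rw [NormedSpace.isVonNBounded_iff]
  have hcont : Continuous fun v : E => B v v := by fun_prop
  rcases subsingleton_or_nontrivial E with hE | hE
  · exact (Set.toFinite _).isBounded
  obtain ⟨u, hu, hmin⟩ := (isCompact_sphere (0 : E) 1).exists_isMinOn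
    (NormedSpace.sphere_nonempty.2 zero_le_one) hcont.continuousOn
  have hu0 : u ≠ 0 := by
    rintro rfl
    simp at hu
  have hc := hB u hu0
  refine (Metric.isBounded_iff_subset_closedBall 0).2 ⟨√(B u u)⁻¹, fun v hv => ?_⟩
  rw [mem_closedBall_zero_iff]
  apply Real.le_sqrt_of_sq_le
  by_cases hv0 : v = 0
  · subst hv0
    simpa using hc.le
  have hn : 0 < ‖v‖ := norm_pos_iff.2 hv0
  have h1 : B u u ≤ B (‖v‖⁻¹ • v) (‖v‖⁻¹ • v) := hmin (by simp [norm_smul, hn.ne'])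
  have h2 : B (‖v‖⁻¹ • v) (‖v‖⁻¹ • v) = ‖v‖⁻¹ ^ 2 * B v v := by
    simp only [map_smul, smul_apply, smul_eq_mul]
    ring
  have hv1 : B v v < 1 := hv
  rw [h2, inv_pow, inv_mul_eq_div, le_div_iff₀ (by positivity)] at h1
  rw [← one_div, le_div_iff₀ hc]
  linarith

variable [IsManifold I ∞ M]

/-- The vector field which is constant in the chart at `x`. -/
def chartField (x : M) (v : E) : VField I M := fun y =>
  (trivializationAt E (TangentSpace I) x).symmL ℝ y v

theorem chartField_eq_symm {x y : M} (hy : y ∈ (chartAt H x).source) (v : E) :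
    chartField (I := I) x v y = (trivializationAt E (TangentSpace I) x).symm y v :=
  Trivialization.symmL_apply _ (by simpa using hy) v

theorem mvfderiv_chartField {x y : M} (hy : y ∈ (chartAt H x).source) (v : E) :
    mvfderiv I (extChartAt I x) y (chartField x v y) = v := by
  rw [← trivializationAt_snd x hy, chartField_eq_symm hy]
  exact congrArg Prod.snd
    ((trivializationAt E (TangentSpace I) x).apply_mk_symm (by simpa using hy) v)

theorem chartField_mvfderiv {x y : M} (hy : y ∈ (chartAt H x).source) (w : TangentSpace I y) :
    chartField x (mvfderiv I (extChartAt I x) y w) y = w := by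
  rw [← trivializationAt_snd x hy, chartField_eq_symm hy]
  exact (trivializationAt E (TangentSpace I) x).symm_proj_apply ⟨y, w⟩ (by simpa using hy)

theorem contMDiffAt_chartField (x : M) (v : E) :
    ContMDiffAt I I.tangent ∞ (fun y => (⟨y, chartField x v y⟩ : TangentBundle I M)) x := by
  rw [contMDiffAt_vfield_iff]
  refine (contMDiffAt_const (c := v)).congr_of_eventuallyEq ?_
  filter_upwards [chart_source_mem_nhds H x] with y hy
  exact mvfderiv_chartField hy v

variable [FiniteDimensional ℝ E]

omit [IsManifold I ∞ M] in
/-- A bilinear form on a tangent space as a continuous bilinear map. -/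
def tangentBilin {x : M} (B : TangentSpace I x →ₗ[ℝ] TangentSpace I x →ₗ[ℝ] ℝ) :
    TangentSpace I x →L[ℝ] TangentSpace I x →L[ℝ] ℝ :=
  let B' : E →ₗ[ℝ] E →ₗ[ℝ] ℝ := B
  (B'.toContinuousBilinearMap : E →L[ℝ] E →L[ℝ] ℝ)

/-- The Riemannian metric given by a family of inner products which is smooth on vector fields. -/
def RiemMetric.ofBilin (B : ∀ x : M, TangentSpace I x →ₗ[ℝ] TangentSpace I x →ₗ[ℝ] ℝ)
    (symm : ∀ x v w, B x v w = B x w v) (pos : ∀ x v, v ≠ 0 → 0 < B x v v)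
    (smooth : ∀ (x : M) (X Y : VField I M),
      ContMDiffAt I I.tangent ∞ (fun y => (⟨y, X y⟩ : TangentBundle I M)) x →
      ContMDiffAt I I.tangent ∞ (fun y => (⟨y, Y y⟩ : TangentBundle I M)) x →
      ContMDiffAt I 𝓘(ℝ, ℝ) ∞ (fun y => B y (X y) (Y y)) x) : RiemMetric I M where
  inner x := tangentBilin (B x)
  symm := symm
  pos := pos
  isVonNBounded x := isVonNBounded_of_pos (E := E) (pos x)
  contMDiff x := by
    rw [contMDiffAt_hom_bundle]
    refine ⟨contMDiffAt_id, ?_⟩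
    refine contMDiffAt_clm_of_apply fun v => contMDiffAt_clm_of_apply fun w => ?_
    refine (smooth x (chartField x v) (chartField x w) (contMDiffAt_chartField x v)
      (contMDiffAt_chartField x w)).congr_of_eventuallyEq ?_
    filter_upwards [chart_source_mem_nhds H x] with y hy
    have hy' : y ∈ (trivializationAt E (TangentSpace I) x).baseSet := by simpa using hy
    rw [inCoordinates_apply_eq₂ hy' hy' (by simp)]
    rw [chartField_eq_symm hy, chartField_eq_symm hy]
    simp
    rfl

end MetricConstruction

/-! ### Local sections of submersions -/

section LocalSection

variable {E : Type*} [NormedAddCommGroup E] [NormedSpace ℝ E]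
  {H : Type*} [TopologicalSpace H] {I : ModelWithCorners ℝ E H} [I.Boundaryless]
  {M : Type*} [TopologicalSpace M] [ChartedSpace H M] [IsManifold I ∞ M]
  {E' : Type*} [NormedAddCommGroup E'] [NormedSpace ℝ E'] [FiniteDimensional ℝ E']
  {H' : Type*} [TopologicalSpace H'] {J : ModelWithCorners ℝ E' H'}
  {N : Type*} [TopologicalSpace N] [ChartedSpace H' N] [IsManifold J ∞ N]

/-- A smooth map with surjective differential at `x` has a smooth local section through `x`. -/
theorem exists_local_section {f : M → N} (hf : ContMDiff I J ∞ f) {x : M}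
    (hs : Function.Surjective (mfderiv I J f x)) :
    ∃ s : N → M, ContMDiffAt J I ∞ s (f x) ∧ s (f x) = x ∧ ∀ᶠ q in 𝓝 (f x), f (s q) = q := by
  have : CompleteSpace E' := FiniteDimensional.complete ℝ E'
  set φ := extChartAt I x with hφ
  set ψ := extChartAt J (f x) with hψ
  set a := φ x with ha
  set b := ψ (f x) with hb
  have hψs : ContMDiffAt J 𝓘(ℝ, E') ∞ ψ (f x) := contMDiffAt_extChartAt
  have hψf : ContMDiffAt I 𝓘(ℝ, E') ∞ (ψ ∘ f) x := hψs.comp x hf.contMDiffAt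
  set F : E → E' := (ψ ∘ f) ∘ φ.symm with hF
  have hFs : ContDiffAt ℝ ∞ F a := contDiffAt_comp_extChartAt_symm hψf
  have hFd : ∀ v : TangentSpace I x, fderiv ℝ F a v = mfderiv I J f x v := by
    intro v
    have h := (mvfderiv_eventually_eq_fderiv hψf).self_of_nhds v
    rw [mvfderiv_extChartAt_self] at h
    have h2 : mvfderiv I (ψ ∘ f) x v = mvfderiv J ψ (f x) (mfderiv I J f x v) :=
      mfderiv_comp_apply x (hψs.mdifferentiableAt (by simp))
        (hf.contMDiffAt.mdifferentiableAt (by simp)) v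
    rw [mvfderiv_extChartAt_self] at h2
    exact h.symm.trans h2
  have hsurj : LinearMap.range (fderiv ℝ F a).toLinearMap = ⊤ := by
    rw [LinearMap.range_eq_top]
    intro w
    obtain ⟨v, hv⟩ := hs w
    exact ⟨v, (hFd v).trans hv⟩
  obtain ⟨R₀, hR₀⟩ := LinearMap.exists_rightInverse_of_surjective _ hsurj
  -- On the affine subspace `a + R E'` of the chart domain `F` restricts to a local diffeomorphism,
  -- whose inverse gives the section.
  let R : E' →L[ℝ] E := R₀.toContinuousLinearMap
  have hR : ∀ w, fderiv ℝ F a (R w) = w := fun w => LinearMap.congr_fun hR₀ w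
  let A : E' → E := fun z => a + R (z - b)
  have hA : ContDiff ℝ ∞ A := by fun_prop
  have hAb : A b = a := by simp [A]
  let G : E' → E' := F ∘ A
  have hG : ContDiffAt ℝ ∞ G b := ContDiffAt.comp b (by rwa [hAb]) hA.contDiffAt
  have hGd : HasFDerivAt G (ContinuousLinearEquiv.refl ℝ E' : E' →L[ℝ] E') b := by
    have h1 : HasFDerivAt A R b := by
      have h : A = fun z => (a - R b) + R z := by
        funext z
        simp only [A, map_sub]
        abel
      rw [h]
      exact R.hasFDerivAt.const_add _
    have h2 : HasFDerivAt F (fderiv ℝ F a) (A b) := by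
      rw [hAb]
      exact (hFs.differentiableAt (by simp)).hasFDerivAt
    convert h2.comp b h1 using 1
    ext w
    exact (hR w).symm
  have hst := hG.hasStrictFDerivAt' hGd (by simp)
  have hinv : ContDiffAt ℝ ∞ (hG.localInverse hGd (by simp)) (G b) :=
    hG.to_localInverse hGd (by simp)
  set L := hG.localInverse hGd (by simp) with hL
  have hGb : G b = b := by
    change ψ (f (φ.symm (A b))) = b
    rw [hAb, φ.left_inv (mem_extChartAt_source x)]
  have hLb : L b = b := by
    have h := hG.localInverse_apply_image hGd (by simp)
    rwa [hGb] at h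
  rw [hGb] at hinv
  have hright : ∀ᶠ z in 𝓝 b, G (L z) = z := by
    have h := hst.eventually_right_inverse
    rw [hGb] at h
    exact h
  have hs1 : ContMDiffAt J I ∞ (fun q => φ.symm (A (L (ψ q)))) (f x) := by
    have h1 : ContMDiffAt 𝓘(ℝ, E) I ∞ φ.symm (A (L (ψ (f x)))) := by
      rw [← hb, hLb, hAb]
      exact (contMDiffOn_extChartAt_symm x).contMDiffAt (extChartAt_target_mem_nhds x)
    have h2 : ContMDiffAt 𝓘(ℝ, E') 𝓘(ℝ, E) ∞ (A ∘ L) (ψ (f x)) :=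
      (ContDiffAt.comp (f := L) b hA.contDiffAt hinv).contMDiffAt
    exact h1.comp (f x) (h2.comp (f x) hψs)
  have hs2 : φ.symm (A (L (ψ (f x)))) = x := by
    rw [← hb, hLb, hAb, φ.left_inv (mem_extChartAt_source x)]
  refine ⟨fun q => φ.symm (A (L (ψ q))), hs1, hs2, ?_⟩
  have h1 : ∀ᶠ q in 𝓝 (f x), f (φ.symm (A (L (ψ q)))) ∈ ψ.source := by
    have hc : ContinuousAt (fun q => f (φ.symm (A (L (ψ q))))) (f x) :=
      hf.continuous.continuousAt.comp hs1.continuousAt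
    refine hc.eventually ?_
    change ∀ᶠ y in 𝓝 (f (φ.symm (A (L (ψ (f x)))))), y ∈ ψ.source
    rw [hs2]
    exact extChartAt_source_mem_nhds (f x)
  filter_upwards [h1, (continuousAt_extChartAt (f x)).eventually hright,
    extChartAt_source_mem_nhds (I := J) (f x)] with q hq1 hq2 hq3
  exact ψ.injOn hq1 hq3 hq2

/-- Smoothness descends along a submersion, by composition with a local section. -/
theorem contMDiffAt_of_comp {W : Type*} [NormedAddCommGroup W] [NormedSpace ℝ W] {f : M → N}
    (hf : ContMDiff I J ∞ f) {x : M} (hs : Function.Surjective (mfderiv I J f x)) {h : N → W}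
    (hh : ContMDiffAt I 𝓘(ℝ, W) ∞ (fun y => h (f y)) x) : ContMDiffAt J 𝓘(ℝ, W) ∞ h (f x) := by
  obtain ⟨s, hs1, hs2, hs3⟩ := exists_local_section hf hs
  have hh' : ContMDiffAt I 𝓘(ℝ, W) ∞ (fun y => h (f y)) (s (f x)) := by rwa [hs2]
  refine (hh'.comp (f x) hs1).congr_of_eventuallyEq ?_
  filter_upwards [hs3] with q hq
  exact congrArg h hq.symm

end LocalSection

/-! ### Horizontal lifts in linear algebra -/

section LiftOperator

variable {E : Type*} [NormedAddCommGroup E] [NormedSpace ℝ E] [FiniteDimensional ℝ E]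
  {F : Type*} [NormedAddCommGroup F] [NormedSpace ℝ F] [FiniteDimensional ℝ F]

/-- The linear map `A G⁻¹ Aᵀ` from the dual of `F` to `F`. -/
def coGram (G : E →L[ℝ] E →L[ℝ] ℝ) (A : E →L[ℝ] F) : (F →L[ℝ] ℝ) →L[ℝ] F :=
  A ∘L G.inverse ∘L (ContinuousLinearMap.compL ℝ E F ℝ).flip A

/-- The right inverse `G⁻¹ Aᵀ (A G⁻¹ Aᵀ)⁻¹` of `A` with values in the `G`-orthogonal complement of
the kernel of `A`. -/
def liftOp (G : E →L[ℝ] E →L[ℝ] ℝ) (A : E →L[ℝ] F) : F →L[ℝ] E :=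
  G.inverse ∘L (ContinuousLinearMap.compL ℝ E F ℝ).flip A ∘L (coGram G A).inverse

theorem isInvertible_of_injective {V W : Type*} [NormedAddCommGroup V] [NormedSpace ℝ V]
    [FiniteDimensional ℝ V] [NormedAddCommGroup W] [NormedSpace ℝ W] [FiniteDimensional ℝ W]
    (L : V →L[ℝ] W) (hL : Function.Injective L)
    (hd : Module.finrank ℝ V = Module.finrank ℝ W) : L.IsInvertible := by
  have h2 : Function.Surjective L.toLinearMap :=
    (LinearMap.injective_iff_surjective_of_finrank_eq_finrank hd).1 hL
  refine ⟨(LinearEquiv.ofBijective L.toLinearMap ⟨hL, h2⟩).toContinuousLinearEquiv, ?_⟩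
  ext v
  rfl

omit [FiniteDimensional ℝ E] in
theorem finrank_dual_clm [FiniteDimensional ℝ E] :
    Module.finrank ℝ (E →L[ℝ] ℝ) = Module.finrank ℝ E := by
  rw [← LinearEquiv.finrank_eq (LinearMap.toContinuousLinearMap : (E →ₗ[ℝ] ℝ) ≃ₗ[ℝ] E →L[ℝ] ℝ)]
  exact Subspace.dual_finrank_eq

theorem isInvertible_of_posDef {G : E →L[ℝ] E →L[ℝ] ℝ} (hG : ∀ v, v ≠ 0 → 0 < G v v) :
    G.IsInvertible := by
  refine isInvertible_of_injective G ?_ finrank_dual_clm.symm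
  rw [injective_iff_map_eq_zero]
  intro v hv
  by_contra hne
  have h := hG v hne
  rw [hv] at h
  exact lt_irrefl _ h

/-- If `A G⁻¹ Aᵀ l = 0` then `G⁻¹ Aᵀ l` is `G`-isotropic, so `Aᵀ l = 0` and `l = 0`. -/
theorem isInvertible_coGram {G : E →L[ℝ] E →L[ℝ] ℝ} (hG : ∀ v, v ≠ 0 → 0 < G v v)
    {A : E →L[ℝ] F} (hA : Function.Surjective A) : (coGram G A).IsInvertible := by
  refine isInvertible_of_injective _ ?_ finrank_dual_clm
  rw [injective_iff_map_eq_zero]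
  intro l hl
  obtain ⟨e, he⟩ := isInvertible_of_posDef hG
  have h1 : G (G.inverse (l ∘L A)) = l ∘L A := by
    rw [← he, ContinuousLinearMap.inverse_equiv]
    exact e.apply_symm_apply _
  have h2 : G.inverse (l ∘L A) = 0 := by
    by_contra hne
    have h := hG _ hne
    rw [h1] at h
    have h3 : A (G.inverse (l ∘L A)) = 0 := hl
    rw [ContinuousLinearMap.comp_apply, h3, map_zero] at h
    exact lt_irrefl _ h
  rw [h2, map_zero] at h1
  ext w
  obtain ⟨v, rfl⟩ := hA w
  exact (DFunLike.congr_fun h1 v).symm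

/-- `liftOp G A` recovers the vectors which are `G`-orthogonal to the kernel of `A`. -/
theorem liftOp_eq {G : E →L[ℝ] E →L[ℝ] ℝ} (hG : ∀ v, v ≠ 0 → 0 < G v v)
    {A : E →L[ℝ] F} (hA : Function.Surjective A) {u : E} (hu : ∀ v, A v = 0 → G u v = 0) :
    liftOp G A (A u) = u := by
  obtain ⟨R, hR⟩ := LinearMap.exists_rightInverse_of_surjective A.toLinearMap
    (LinearMap.range_eq_top.2 hA)
  have hR' : ∀ w, A (R w) = w := fun w => LinearMap.congr_fun hR w
  let l : F →L[ℝ] ℝ := G u ∘L R.toContinuousLinearMap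
  have hl : l ∘L A = G u := by
    ext v
    have h := hu (R (A v) - v) (by rw [map_sub, hR', sub_self])
    rw [map_sub, sub_eq_zero] at h
    exact h
  obtain ⟨e, he⟩ := isInvertible_of_posDef hG
  obtain ⟨e', he'⟩ := isInvertible_coGram hG hA
  have h1 : G.inverse (G u) = u := by
    rw [← he, ContinuousLinearMap.inverse_equiv]
    exact e.symm_apply_apply _
  have h2 : coGram G A l = A u := by
    change A (G.inverse (l ∘L A)) = A u
    rw [hl, h1]
  have h3 : (coGram G A).inverse (A u) = l := by
    rw [← h2, ← he', ContinuousLinearMap.inverse_equiv]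
    exact e'.symm_apply_apply _
  change G.inverse ((coGram G A).inverse (A u) ∘L A) = u
  rw [h3, hl, h1]

set_option synthInstance.maxHeartbeats 400000 in
theorem contDiffAt_liftOp {X : Type*} [NormedAddCommGroup X] [NormedSpace ℝ X]
    {G : X → E →L[ℝ] E →L[ℝ] ℝ} {A : X → E →L[ℝ] F} {x : X} {n : ℕ∞ω}
    (hGs : ContDiffAt ℝ n G x) (hAs : ContDiffAt ℝ n A x) (hG : ∀ v, v ≠ 0 → 0 < G x v v)
    (hA : Function.Surjective (A x)) : ContDiffAt ℝ n (fun y => liftOp (G y) (A y)) x := by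
  have : CompleteSpace E := FiniteDimensional.complete ℝ E
  have : CompleteSpace F := FiniteDimensional.complete ℝ F
  have h1 : ContDiffAt ℝ n (fun y => (G y).inverse) x :=
    ((isInvertible_of_posDef hG).contDiffAt_map_inverse).comp x hGs
  let T : (E →L[ℝ] F) →L[ℝ] (F →L[ℝ] ℝ) →L[ℝ] E →L[ℝ] ℝ :=
    (ContinuousLinearMap.compL ℝ E F ℝ).flip
  have h2 : ContDiffAt ℝ n (fun y => T (A y)) x := 
    (contMDiffAt_clm_of_apply fun l =>
      ((contDiffAt_const (c := l)).clm_comp hAs).contMDiffAt).contDiffAt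
  have h3 : ContDiffAt ℝ n (fun y => coGram (G y) (A y)) x := hAs.clm_comp (h1.clm_comp h2)
  have hi : ContDiffAt ℝ n ContinuousLinearMap.inverse (coGram (G x) (A x)) :=
    (isInvertible_coGram hG hA).contDiffAt_map_inverse
  have h4 : ContDiffAt ℝ n (fun y => (coGram (G y) (A y)).inverse) x :=
    ContDiffAt.comp (f := fun y => coGram (G y) (A y)) x hi h3
  exact h1.clm_comp (h2.clm_comp h4)

end LiftOperator

/-! ### Regularity of horizontal lifts -/

section HorizontalLift

variable {E : Type*} [NormedAddCommGroup E] [NormedSpace ℝ E] [FiniteDimensional ℝ E]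
  {H : Type*} [TopologicalSpace H] {I : ModelWithCorners ℝ E H} [I.Boundaryless]
  {M : Type*} [TopologicalSpace M] [ChartedSpace H M] [IsManifold I ∞ M]
  {E' : Type*} [NormedAddCommGroup E'] [NormedSpace ℝ E'] [FiniteDimensional ℝ E']
  {H' : Type*} [TopologicalSpace H'] {J : ModelWithCorners ℝ E' H'}
  {N : Type*} [TopologicalSpace N] [ChartedSpace H' N] [IsManifold J ∞ N]

omit [FiniteDimensional ℝ E] [I.Boundaryless] in
theorem chartField_eq_symmL (x y : M) (v : E) :
    chartField (I := I) x v y = (trivializationAt E (TangentSpace I) x).symmL ℝ y v := rfl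

/-- In the charts at `x` and `f x`, horizontal lifts are computed by a smooth family of linear
maps. -/
theorem exists_smooth_lift (g : RiemMetric I M) {f : M → N} (hf : ContMDiff I J ∞ f)
    (hs : ∀ y, Function.Surjective (mfderiv I J f y)) (x : M) :
    ∃ L : M → E' →L[ℝ] E, ContMDiffAt I 𝓘(ℝ, E' →L[ℝ] E) ∞ L x ∧
      ∀ᶠ y in 𝓝 x, ∀ (ζ : TangentSpace J (f y)) (w : TangentSpace I y),
        IsHorizontalRep J g f y ζ w →
          mvfderiv I (extChartAt I x) y w = L y (mvfderiv J (extChartAt J (f x)) (f y) ζ) := by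
  set φ := extChartAt I x with hφ
  set ψ := extChartAt J (f x) with hψ
  have hψs : ContMDiffAt J 𝓘(ℝ, E') ∞ ψ (f x) := contMDiffAt_extChartAt
  have hψf : ContMDiffAt I 𝓘(ℝ, E') ∞ (ψ ∘ f) x := hψs.comp x hf.contMDiffAt
  -- The metric and the differential of `f` in the charts, as functions of the base point.
  let G : M → E →L[ℝ] E →L[ℝ] ℝ := fun y => LinearMap.toContinuousBilinearMap
    (LinearMap.mk₂ ℝ (fun u v : E => g.inner y (chartField x u y) (chartField x v y))
      (by intros; simp [chartField_eq_symmL]) (by intros; simp [chartField_eq_symmL])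
      (by intros; simp [chartField_eq_symmL]) (by intros; simp [chartField_eq_symmL]))
  let A : M → E →L[ℝ] E' := fun y => LinearMap.toContinuousLinearMap
    { toFun := fun u : E => mvfderiv I (ψ ∘ f) y (chartField x u y)
      map_add' := by intros; simp [chartField_eq_symmL]
      map_smul' := by intros; simp [chartField_eq_symmL] }
  have hGs : ContMDiffAt I 𝓘(ℝ, E →L[ℝ] E →L[ℝ] ℝ) ∞ G x :=
    contMDiffAt_clm_of_apply fun u => contMDiffAt_clm_of_apply fun v =>
      contMDiffAt_inner (contMDiffAt_chartField x u) (contMDiffAt_chartField x v)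
  have hAs : ContMDiffAt I 𝓘(ℝ, E →L[ℝ] E') ∞ A x :=
    contMDiffAt_clm_of_apply fun u => contMDiffAt_mvfderiv (contMDiffAt_chartField x u) hψf
  have hGpos : ∀ y ∈ (chartAt H x).source, ∀ v, v ≠ 0 → 0 < G y v v := by
    intro y hy v hv
    refine g.pos y _ fun h0 => hv ?_
    have h := mvfderiv_chartField (I := I) hy v
    rw [h0, map_zero] at h
    exact h.symm
  have hAw : ∀ y ∈ (chartAt H x).source, f y ∈ (chartAt H' (f x)).source →
      ∀ w : TangentSpace I y, A y (mvfderiv I φ y w) = mvfderiv J ψ (f y) (mfderiv I J f y w) := by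
    intro y hy hfy w
    have h1 : A y (mvfderiv I φ y w) = mvfderiv I (ψ ∘ f) y w := by
      change mvfderiv I (ψ ∘ f) y (chartField x (mvfderiv I φ y w) y) = _
      rw [chartField_mvfderiv hy]
    rw [h1]
    exact mfderiv_comp_apply y (mdifferentiableAt_extChartAt hfy)
      (hf.contMDiffAt.mdifferentiableAt (by simp)) w
  have hAsurj : ∀ y ∈ (chartAt H x).source, f y ∈ (chartAt H' (f x)).source →
      Function.Surjective (A y) := by
    intro y hy hfy z
    obtain ⟨w, hw⟩ := hs y (chartField (f x) z (f y))
    refine ⟨mvfderiv I φ y w, ?_⟩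
    rw [hAw y hy hfy, hw]
    exact mvfderiv_chartField hfy z
  refine ⟨fun y => liftOp (G y) (A y), ?_, ?_⟩
  · have h := contDiffAt_liftOp (n := ∞) (x := (G x, A x)) contDiffAt_fst contDiffAt_snd
      (hGpos x (mem_chart_source H x))
      (hAsurj x (mem_chart_source H x) (mem_chart_source H' (f x)))
    exact ContMDiffAt.comp (f := fun y => (G y, A y)) x h.contMDiffAt (hGs.prodMk_space hAs)
  · filter_upwards [chart_source_mem_nhds H x, hf.continuous.continuousAt.eventually
      (chart_source_mem_nhds H' (f x))] with y hy hfy ζ w hw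
    have h1 := hAw y hy hfy w
    rw [hw.2] at h1
    have h2 : ∀ v, A y v = 0 → G y (mvfderiv I φ y w) v = 0 := by
      intro v hv
      have h3 := hAw y hy hfy (chartField x v y)
      rw [mvfderiv_chartField hy v, hv] at h3
      have h4 : mfderiv I J f y (chartField x v y) = 0 := by
        have h5 := chartField_mvfderiv hfy (mfderiv I J f y (chartField x v y))
        have h6 : chartField (I := J) (f x) (0 : E') (f y) = 0 := by
          rw [chartField_eq_symmL, map_zero]
        rw [← hψ, ← h3, h6] at h5
        exact h5.symm
      change g.inner y (chartField x (mvfderiv I φ y w) y) (chartField x v y) = 0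
      rw [chartField_mvfderiv hy]
      exact hw.1 _ h4
    have h7 := liftOp_eq (hGpos y hy) (hAsurj y hy hfy) h2
    rw [h1] at h7
    exact h7.symm

/-- The horizontal lift of a differentiable vector field is differentiable. -/
theorem VFieldDiffAt.of_isHorizontalRep {g : RiemMetric I M} {f : M → N} (hf : ContMDiff I J ∞ f)
    (hs : ∀ y, Function.Surjective (mfderiv I J f y)) {η : VField J N} {ηbar : VField I M} {x : M}
    (hη : VFieldDiffAt η (f x)) (h : ∀ y, IsHorizontalRep J g f y (η (f y)) (ηbar y)) :
    VFieldDiffAt ηbar x := by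
  obtain ⟨L, hL, hLe⟩ := exists_smooth_lift g hf hs x
  rw [vfieldDiffAt_iff] at hη ⊢
  have h1 : MDifferentiableAt I 𝓘(ℝ, E')
      (fun y => mvfderiv J (extChartAt J (f x)) (f y) (η (f y))) x :=
    MDifferentiableAt.comp (f := f) x hη (hf.contMDiffAt.mdifferentiableAt (by simp))
  refine ((hL.mdifferentiableAt (by simp)).clm_apply h1).congr_of_eventuallyEq ?_
  filter_upwards [hLe] with y hy
  exact hy _ _ (h y)

/-- The horizontal lift of a smooth vector field is smooth. -/
theorem contMDiffAt_of_isHorizontalRep {g : RiemMetric I M} {f : M → N} (hf : ContMDiff I J ∞ f)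
    (hs : ∀ y, Function.Surjective (mfderiv I J f y)) {η : VField J N} {ηbar : VField I M} {x : M}
    (hη : ContMDiffAt J J.tangent ∞ (fun y => (⟨y, η y⟩ : TangentBundle J N)) (f x))
    (h : ∀ y, IsHorizontalRep J g f y (η (f y)) (ηbar y)) :
    ContMDiffAt I I.tangent ∞ (fun y => (⟨y, ηbar y⟩ : TangentBundle I M)) x := by
  obtain ⟨L, hL, hLe⟩ := exists_smooth_lift g hf hs x
  rw [contMDiffAt_vfield_iff] at hη ⊢
  have h1 : ContMDiffAt I 𝓘(ℝ, E') ∞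
      (fun y => mvfderiv J (extChartAt J (f x)) (f y) (η (f y))) x :=
    ContMDiffAt.comp (f := f) x hη hf.contMDiffAt
  refine (hL.clm_apply h1).congr_of_eventuallyEq ?_
  filter_upwards [hLe] with y hy
  exact hy _ _ (h y)

end HorizontalLift

/-! ### Horizontal representatives -/

section HorizontalRep

variable {E : Type*} [NormedAddCommGroup E] [NormedSpace ℝ E] [FiniteDimensional ℝ E]
  {H : Type*} [TopologicalSpace H] {I : ModelWithCorners ℝ E H}
  {M : Type*} [TopologicalSpace M] [ChartedSpace H M] [IsManifold I ∞ M]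
  {E' : Type*} [NormedAddCommGroup E'] [NormedSpace ℝ E']
  {H' : Type*} [TopologicalSpace H'] {J : ModelWithCorners ℝ E' H'}
  {N : Type*} [TopologicalSpace N] [ChartedSpace H' N]

theorem horizontalProj_mem (g : RiemMetric I M) (f : M → N) (x : M) (ξ : TangentSpace I x) :
    horizontalProj J g f x ξ ∈ horizontal J g f x :=
  Subtype.property _

theorem sub_horizontalProj_mem (g : RiemMetric I M) (f : M → N) (x : M) (ξ : TangentSpace I x) :
    ξ - horizontalProj J g f x ξ ∈ vertical J f x := by
  rw [← Submodule.ker_projectionOnto (p := horizontal J g f x) (q := vertical J f x)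
    (isCompl_horizontal J g f x), LinearMap.mem_ker, map_sub, sub_eq_zero]
  exact (Submodule.projectionOnto_apply_left (isCompl_horizontal J g f x) _).symm

theorem mfderiv_horizontalProj (g : RiemMetric I M) (f : M → N) (x : M) (ξ : TangentSpace I x) :
    mfderiv I J f x (horizontalProj J g f x ξ) = mfderiv I J f x ξ := by
  have h : mfderiv I J f x (ξ - horizontalProj J g f x ξ) = 0 := sub_horizontalProj_mem g f x ξ
  rw [map_sub, sub_eq_zero] at h
  exact h.symm

theorem IsHorizontalRep.unique {g : RiemMetric I M} {f : M → N} {x : M} {ζ : TangentSpace J (f x)}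
    {w w' : TangentSpace I x} (h : IsHorizontalRep J g f x ζ w)
    (h' : IsHorizontalRep J g f x ζ w') : w = w' := by
  have h1 : w - w' ∈ vertical J f x := by
    change mfderiv I J f x (w - w') = 0
    rw [map_sub, h.2, h'.2, sub_self]
  have h2 := (isCompl_horizontal J g f x).disjoint
  rw [Submodule.disjoint_def] at h2
  exact sub_eq_zero.1 (h2 _ (sub_mem h.1 h'.1) h1)

/-- Horizontal representatives depend linearly on the tangent vector of the base. -/
theorem exists_horizontalLift [FiniteDimensional ℝ E'] (g : RiemMetric I M) {f : M → N} {x : M}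
    (hs : Function.Surjective (mfderiv I J f x)) :
    ∃ L : E' →L[ℝ] E, ∀ ζ : TangentSpace J (f x), IsHorizontalRep J g f x ζ (L ζ) := by
  obtain ⟨R, hR⟩ := LinearMap.exists_rightInverse_of_surjective (mfderiv I J f x).toLinearMap
    (LinearMap.range_eq_top.2 hs)
  let L : TangentSpace J (f x) →ₗ[ℝ] TangentSpace I x :=
    (horizontal J g f x).subtype ∘ₗ
      Submodule.projectionOnto _ _ (isCompl_horizontal J g f x) ∘ₗ R
  let L' : E' →ₗ[ℝ] E := L
  refine ⟨L'.toContinuousLinearMap, fun ζ => ⟨horizontalProj_mem g f x (R ζ), ?_⟩⟩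
  exact (mfderiv_horizontalProj g f x (R ζ)).trans (LinearMap.congr_fun hR ζ)

end HorizontalRep

/-! ### Descent of metrics -/

section Descent

variable {E : Type*} [NormedAddCommGroup E] [NormedSpace ℝ E] [FiniteDimensional ℝ E]
  {H : Type*} [TopologicalSpace H] {I : ModelWithCorners ℝ E H} [I.Boundaryless]
  {M : Type*} [TopologicalSpace M] [ChartedSpace H M] [IsManifold I ∞ M]
  {E' : Type*} [NormedAddCommGroup E'] [NormedSpace ℝ E'] [FiniteDimensional ℝ E']
  {H' : Type*} [TopologicalSpace H'] {J : ModelWithCorners ℝ E' H'}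
  {N : Type*} [TopologicalSpace N] [ChartedSpace H' N] [IsManifold J ∞ N]

omit [I.Boundaryless] [IsManifold J ∞ N] in
/-- Tangent spaces at points of one fibre induce the same inner product on the base. -/
theorem exists_bilin_descent (g : RiemMetric I M) {f : M → N}
    (hs : ∀ y, Function.Surjective (mfderiv I J f y)) (hsurj : Function.Surjective f)
    (hiso : ∀ x x', f x = f x' → ∃ a : TangentSpace I x →ₗ[ℝ] TangentSpace I x',
      (∀ ξ η, g.inner x' (a ξ) (a η) = g.inner x ξ η) ∧
      ∀ ξ, (mfderiv I J f x' (a ξ) : E') = mfderiv I J f x ξ) (q : N) :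
    ∃ B : E' →ₗ[ℝ] E' →ₗ[ℝ] ℝ, ∀ x, f x = q → ∀ ξ ∈ horizontal J g f x,
      ∀ η ∈ horizontal J g f x, B (mfderiv I J f x ξ) (mfderiv I J f x η) = g.inner x ξ η := by
  obtain ⟨x₀, rfl⟩ := hsurj q
  obtain ⟨L, hL⟩ := exists_horizontalLift (J := J) g (hs x₀)
  refine ⟨LinearMap.mk₂ ℝ (fun v w : E' => g.inner x₀ (L v) (L w)) ?_ ?_ ?_ ?_, ?_⟩
  · intro a b c
    rw [map_add]
    exact congrArg (fun l : E →L[ℝ] ℝ => l (L c)) (map_add (g.inner x₀) (L a) (L b))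
  · intro r a c
    rw [map_smul]
    exact congrArg (fun l : E →L[ℝ] ℝ => l (L c)) (map_smul (g.inner x₀) r (L a))
  · intro a b c
    rw [map_add]
    exact map_add (g.inner x₀ (L a)) (L b) (L c)
  · intro r a c
    rw [map_smul]
    exact map_smul (g.inner x₀ (L a)) r (L c)
  · intro x hx ξ hξ η hη
    obtain ⟨a, ha, had⟩ := hiso x x₀ hx
    have hinj : Function.Injective a := by
      rw [injective_iff_map_eq_zero]
      intro v hv
      by_contra hne
      have h := g.pos x v hne
      rw [← ha, hv, map_zero] at h
      exact lt_irrefl _ h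
    have hasurj : Function.Surjective a := by
      have hx1 : FiniteDimensional ℝ (TangentSpace I x) :=
        inferInstanceAs (FiniteDimensional ℝ E)
      have hx2 : FiniteDimensional ℝ (TangentSpace I x₀) :=
        inferInstanceAs (FiniteDimensional ℝ E)
      exact (LinearMap.injective_iff_surjective_of_finrank_eq_finrank rfl).1 hinj
    -- The isometry `a` carries vertical to vertical vectors, hence horizontal to horizontal ones.
    have key : ∀ ζ ∈ horizontal J g f x, L (mfderiv I J f x ζ) = a ζ := by
      intro ζ hζ
      have h1 : IsHorizontalRep J g f x₀ (mfderiv I J f x₀ (a ζ)) (a ζ) := by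
        refine ⟨fun ν hν => ?_, rfl⟩
        obtain ⟨ν, rfl⟩ := hasurj ν
        rw [ha]
        exact hζ ν ((had ν).symm.trans hν)
      have h2 := (hL (mfderiv I J f x₀ (a ζ))).unique h1
      have h3 := had ζ
      exact (congrArg L h3.symm).trans h2
    change g.inner x₀ (L (mfderiv I J f x ξ)) (L (mfderiv I J f x η)) = _
    rw [key ξ hξ, key η hη, ha]

/-- A metric descends along a surjective submersion if points of one fibre are related by linear
isometries which commute with the differential of the submersion. -/
theorem exists_isRiemannianSubmersion (g : RiemMetric I M) {f : M → N} (hf : ContMDiff I J ∞ f)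
    (hs : ∀ y, Function.Surjective (mfderiv I J f y)) (hsurj : Function.Surjective f)
    (hiso : ∀ x x', f x = f x' → ∃ a : TangentSpace I x →ₗ[ℝ] TangentSpace I x',
      (∀ ξ η, g.inner x' (a ξ) (a η) = g.inner x ξ η) ∧
      ∀ ξ, (mfderiv I J f x' (a ξ) : E') = mfderiv I J f x ξ) :
    ∃ h : RiemMetric J N, IsRiemannianSubmersion J g h f := by
  choose B hB using exists_bilin_descent g hs hsurj hiso
  have hrep : ∀ x (ζ : TangentSpace J (f x)), ∃ w, IsHorizontalRep J g f x ζ w := fun x ζ =>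
    let ⟨L, hL⟩ := exists_horizontalLift (J := J) g (hs x)
    ⟨L ζ, hL ζ⟩
  have hB' : ∀ x ξ η w z, IsHorizontalRep J g f x ξ w → IsHorizontalRep J g f x η z →
      B (f x) ξ η = g.inner x w z := by
    intro x ξ η w z hw hz
    have h := hB (f x) x rfl w hw.1 z hz.1
    rw [hw.2, hz.2] at h
    exact h
  refine ⟨RiemMetric.ofBilin (fun q => B q) ?_ ?_ ?_, hf, hs, ?_⟩
  · intro q v w
    obtain ⟨x, rfl⟩ := hsurj q
    obtain ⟨v', hv⟩ := hrep x v
    obtain ⟨w', hw⟩ := hrep x w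
    exact (hB' x v w v' w' hv hw).trans ((g.symm x v' w').trans (hB' x w v w' v' hw hv).symm)
  · intro q v hv0
    obtain ⟨x, rfl⟩ := hsurj q
    obtain ⟨v', hv⟩ := hrep x v
    refine lt_of_lt_of_eq (g.pos x v' ?_) (hB' x v v v' v' hv hv).symm
    rintro rfl
    exact hv0 (hv.2.symm.trans (map_zero _))
  · intro q X Y hX hY
    obtain ⟨x, rfl⟩ := hsurj q
    choose X' hX' using fun y => hrep y (X (f y))
    choose Y' hY' using fun y => hrep y (Y (f y))
    refine contMDiffAt_of_comp hf (hs x) ?_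
    refine (contMDiffAt_inner (g := g) (contMDiffAt_of_isHorizontalRep hf hs hX hX')
      (contMDiffAt_of_isHorizontalRep hf hs hY hY')).congr_of_eventuallyEq ?_
    exact Filter.Eventually.of_forall fun y => hB' y _ _ _ _ (hX' y) (hY' y)
  · intro x ξ hξ η hη
    exact hB (f x) x rfl ξ hξ η hη

end Descent

/-! ### Descent of Levi-Civita connections -/

section QuotientConnection

variable {E : Type*} [NormedAddCommGroup E] [NormedSpace ℝ E] [FiniteDimensional ℝ E]
  [CompleteSpace E]
  {H : Type*} [TopologicalSpace H] {I : ModelWithCorners ℝ E H} [I.Boundaryless]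
  {M : Type*} [TopologicalSpace M] [ChartedSpace H M] [IsManifold I ∞ M]
  {E' : Type*} [NormedAddCommGroup E'] [NormedSpace ℝ E'] [FiniteDimensional ℝ E']
  [CompleteSpace E']
  {H' : Type*} [TopologicalSpace H'] {J : ModelWithCorners ℝ E' H'} [J.Boundaryless]
  {N : Type*} [TopologicalSpace N] [ChartedSpace H' N] [IsManifold J ∞ N]

omit [CompleteSpace E] [I.Boundaryless] [FiniteDimensional ℝ E'] [CompleteSpace E']
  [J.Boundaryless] in
/-- The isometry property needs only one of the two vectors to be horizontal. -/
theorem IsRiemannianSubmersion.inner_eq {g : RiemMetric I M} {h : RiemMetric J N} {f : M → N}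
    (hR : IsRiemannianSubmersion J g h f) {x : M} (a : TangentSpace I x) {b : TangentSpace I x}
    (hb : b ∈ horizontal J g f x) :
    h.inner (f x) (mfderiv I J f x a) (mfderiv I J f x b) = g.inner x a b := by
  rw [← mfderiv_horizontalProj g f x a,
    hR.isometry x _ (horizontalProj_mem g f x a) b hb]
  have h1 := hb _ (sub_horizontalProj_mem g f x a)
  rw [map_sub, g.symm x b a, g.symm x b, sub_eq_zero] at h1
  exact h1.symm

/-- A Levi-Civita connection descends along a surjective Riemannian submersion `f`: the derivative
of a field at `f x` is the image of the derivative of its horizontal lift at `x`, where `x` is any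
chosen point of the fibre, here `θ` for the fibre of `θ`. -/
theorem exists_isLeviCivita_descent {g : RiemMetric I M} {h : RiemMetric J N} {f : M → N}
    (hR : IsRiemannianSubmersion J g h f) (hsurj : Function.Surjective f)
    {Dbar : AffineConnection I M} (hD : IsLeviCivita g Dbar) (θ : M) :
    ∃ D : AffineConnection J N, IsLeviCivita h D ∧
      ∀ (η : VField J N) (ηbar : VField I M),
        (∀ x, IsHorizontalRep J g f x (η (f x)) (ηbar x)) →
        ∀ ξ ∈ horizontal J g f θ,
          D η (f θ) (mfderiv I J f θ ξ) = mfderiv I J f θ (Dbar ηbar θ ξ) := by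
  have hf := hR.contMDiff
  have hs := hR.surjective_mfderiv
  have hfd : ∀ x, MDifferentiableAt I J f x := fun x =>
    hf.contMDiffAt.mdifferentiableAt (by simp)
  have hrep : ∀ x (ζ : TangentSpace J (f x)), ∃ w, IsHorizontalRep J g f x ζ w := fun x ζ =>
    let ⟨L, hL⟩ := exists_horizontalLift (J := J) g (hs x)
    ⟨L ζ, hL ζ⟩
  choose l hl using fun (η : VField J N) x => hrep x (η (f x))
  have hlu : ∀ (η : VField J N) (ηbar : VField I M),
      (∀ x, IsHorizontalRep J g f x (η (f x)) (ηbar x)) → l η = ηbar := fun η ηbar hη =>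
    funext fun x => (hl η x).unique (hη x)
  have hld : ∀ {η : VField J N} {x : M}, VFieldDiffAt η (f x) → VFieldDiffAt (l η) x :=
    fun {η x} hη => hη.of_isHorizontalRep hf hs (hl η)
  -- `K q η v` is the image of the derivative of the lift of `η` along the lift of `v`, at the point
  -- chosen over `q`. The values are taken in the model space `E'`, to which all tangent spaces of
  -- the base are definitionally equal, so that `q` need not be of the form `f x`.
  have hK : ∀ q, ∃ K : VField J N → E' →L[ℝ] E', ∃ x, f x = q ∧ (q = f θ → x = θ) ∧
      ∀ η, ∀ ξ ∈ horizontal J g f x,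
        K η (mfderiv I J f x ξ) = mfderiv I J f x (Dbar (l η) x ξ) := by
    intro q
    have hx : ∃ x, f x = q ∧ (q = f θ → x = θ) := by
      by_cases hq : q = f θ
      · exact ⟨θ, hq.symm, fun _ => rfl⟩
      · obtain ⟨x, hx⟩ := hsurj q
        exact ⟨x, hx, fun h => absurd h hq⟩
    obtain ⟨x, rfl, hx⟩ := hx
    obtain ⟨L, hL⟩ := exists_horizontalLift (J := J) g (hs x)
    let K : VField J N → E' →L[ℝ] E' := fun η =>
      (mfderiv I J f x : E →L[ℝ] E') ∘L (Dbar (l η) x : E →L[ℝ] E) ∘L L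
    refine ⟨K, x, rfl, hx, fun η ξ hξ => ?_⟩
    have h1 : L (mfderiv I J f x ξ) = ξ := (hL (mfderiv I J f x ξ)).unique ⟨hξ, rfl⟩
    change mfderiv I J f x (Dbar (l η) x (L (mfderiv I J f x ξ))) = _
    rw [h1]
  choose K s hs1 hs2 hKs using hK
  let D₀ : VField J N → ∀ q, TangentSpace J q →L[ℝ] TangentSpace J q := fun η q => K q η
  have hpt : ∀ q, ∃ x, f x = q ∧ ∀ η, ∀ ξ ∈ horizontal J g f x,
      (D₀ η (f x) (mfderiv I J f x ξ)) = mfderiv I J f x (Dbar (l η) x ξ) := by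
    intro q
    have e := hKs q
    have e1 := hs1 q
    generalize s q = x at e e1
    subst e1
    exact ⟨x, rfl, e⟩
  have hcov : IsCovariantDerivativeOn E' D₀ Set.univ := by
    constructor
    · intro σ σ' q hσ hσ' _
      obtain ⟨x, rfl, hx⟩ := hpt q
      have h1 : l (σ + σ') = l σ + l σ' := by
        apply hlu
        intro y
        refine ⟨add_mem (hl σ y).1 (hl σ' y).1, ?_⟩
        exact (map_add _ _ _).trans (congrArg₂ (· + ·) (hl σ y).2 (hl σ' y).2)
      ext v
      obtain ⟨ξ, hξ⟩ := hrep x v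
      rw [← hξ.2, hx _ _ hξ.1, h1, Dbar.isCovariantDerivativeOnUniv.add (hld hσ) (hld hσ')]
      refine Eq.trans ?_ (congrArg₂ (· + ·) (hx σ ξ hξ.1).symm (hx σ' ξ hξ.1).symm)
      exact map_add _ _ _
    · intro σ r q hσ hr _
      obtain ⟨x, rfl, hx⟩ := hpt q
      have h1 : l (r • σ) = (r ∘ f) • l σ := by
        apply hlu
        intro y
        refine ⟨Submodule.smul_mem _ _ (hl σ y).1, ?_⟩
        exact (map_smul _ _ _).trans (congrArg (r (f y) • ·) (hl σ y).2)
      ext v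
      obtain ⟨ξ, hξ⟩ := hrep x v
      have hrf : MDifferentiableAt I 𝓘(ℝ, ℝ) (r ∘ f) x := MDifferentiableAt.comp x hr (hfd x)
      rw [← hξ.2, hx _ _ hξ.1, h1, Dbar.isCovariantDerivativeOnUniv.leibniz (hld hσ) hrf]
      have h2 : mvfderiv I (r ∘ f) x ξ = mvfderiv J r (f x) (mfderiv I J f x ξ) :=
        mfderiv_comp_apply x hr (hfd x) ξ
      change mfderiv I J f x (r (f x) • Dbar (l σ) x ξ + mvfderiv I (r ∘ f) x ξ • l σ x) =
        r (f x) • D₀ σ (f x) (mfderiv I J f x ξ) +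
          mvfderiv J r (f x) (mfderiv I J f x ξ) • σ (f x)
      rw [h2, hx _ _ hξ.1, map_add, map_smul, map_smul, (hl σ x).2]
  refine ⟨⟨D₀, hcov⟩, ⟨?_, ?_⟩, ?_⟩
  · rw [CovariantDerivative.torsion_eq_zero_iff]
    intro X Y q hX hY
    obtain ⟨x, rfl, hx⟩ := hpt q
    change D₀ Y (f x) (X (f x)) - D₀ X (f x) (Y (f x)) = _
    have e1 := hx Y _ (hl X x).1
    have e2 := hx X _ (hl Y x).1
    rw [(hl X x).2] at e1
    rw [(hl Y x).2] at e2
    have e3 := (Dbar.torsion_eq_zero_iff.1 hD.1) (hld hX) (hld hY)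
    rw [e1, e2, ← map_sub, e3]
    exact mfderiv_mlieBracket_of_related hf (hld hX) (hld hY) hX hY (fun y => (hl X y).2)
      (fun y => (hl Y y).2)
  · intro q v σ τ hσ hτ
    obtain ⟨x, rfl, hx⟩ := hpt q
    obtain ⟨ξ, hξ⟩ := hrep x v
    have h1 : (fun y => h.inner (f y) (σ (f y)) (τ (f y))) =
        fun y => g.inner y (l σ y) (l τ y) := by
      funext y
      have h2 := hR.isometry y _ (hl σ y).1 _ (hl τ y).1
      rwa [(hl σ y).2, (hl τ y).2] at h2
    have h3 := mfderiv_comp_apply (I' := J) (I'' := 𝓘(ℝ, ℝ))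
      (g := fun q => h.inner q (σ q) (τ q)) x (hσ.mdifferentiableAt_inner hτ) (hfd x) ξ
    have h4 := hD.2 x ξ (l σ) (l τ) (hld hσ) (hld hτ)
    have h5 := hR.inner_eq (Dbar (l σ) x ξ) (hl τ x).1
    have h6 := hR.inner_eq (Dbar (l τ) x ξ) (hl σ x).1
    rw [(hl τ x).2, ← hx _ _ hξ.1, hξ.2] at h5
    rw [(hl σ x).2, ← hx _ _ hξ.1, hξ.2] at h6
    rw [hξ.2] at h3
    have h7 := (g.symm x (l σ x) (Dbar (l τ) x ξ)).trans
      (h6.symm.trans (h.symm (f x) (D₀ τ (f x) v) (σ (f x))))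
    have h8 := mvfderiv_congr (Filter.EventuallyEq.of_eq (l := 𝓝 x) h1) ξ
    exact h3.symm.trans (h8.trans (h4.trans (congrArg₂ (· + ·) h5.symm h7)))
  · intro η ηbar hη ξ hξ
    have e := hKs (f θ)
    rw [hs2 (f θ) rfl] at e
    rw [← hlu η ηbar hη]
    exact e η ξ hξ

/-- The Levi-Civita connection of the base of a Riemannian submersion, on horizontal lifts: by
uniqueness it is the connection descended through the point `θ`. -/
theorem IsLeviCivita.isHorizontalRep {g : RiemMetric I M} {h : RiemMetric J N} {f : M → N}
    (hR : IsRiemannianSubmersion J g h f) (hsurj : Function.Surjective f)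
    {Dbar : AffineConnection I M} (hDbar : IsLeviCivita g Dbar)
    {D : AffineConnection J N} (hD : IsLeviCivita h D) {θ : M} {η : VField J N}
    {ηbar : VField I M} (hη : VFieldDiffAt η (f θ))
    (hηbar : ∀ x, IsHorizontalRep J g f x (η (f x)) (ηbar x)) {ξ : TangentSpace I θ}
    (hξ : ξ ∈ horizontal J g f θ) :
    IsHorizontalRep J g f θ (D η (f θ) (mfderiv I J f θ ξ))
      (horizontalProj J g f θ (Dbar ηbar θ ξ)) := by
  obtain ⟨D', hD', h'⟩ := exists_isLeviCivita_descent hR hsurj hDbar θ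
  refine ⟨horizontalProj_mem _ _ _ _, ?_⟩
  rw [mfderiv_horizontalProj, hD.unique hD' hη, h' η ηbar hηbar ξ hξ]

end QuotientConnection

/-- The topology of the elementwise norm. It is the product topology, but instance unification does
not see this, and differentiation on normed spaces of matrices needs the norm topology. -/
local instance (priority := 2000) matTopology (m n : ℕ) : TopologicalSpace (Mat m n) :=
  let h : NormedAddCommGroup (Mat m n) := Matrix.normedAddCommGroup
  h.toMetricSpace.toPseudoMetricSpace.toUniformSpace.toTopologicalSpace

/-! ### Calculus of matrix valued functions -/

section MatrixCalculus

variable {E : Type*} [NormedAddCommGroup E] [NormedSpace ℝ E]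
  {H : Type*} [TopologicalSpace H] {I : ModelWithCorners ℝ E H}
  {M : Type*} [TopologicalSpace M] [ChartedSpace H M] {x : M} {l m n : ℕ}

/-- Matrix multiplication as a continuous bilinear map. -/
def matMulCLM (l m n : ℕ) : Mat l m →L[ℝ] Mat m n →L[ℝ] Mat l n :=
  LinearMap.toContinuousBilinearMap (LinearMap.mk₂ ℝ (fun A B => A * B)
    Matrix.add_mul (fun c A B => Matrix.smul_mul c A B) Matrix.mul_add
    (fun c A B => Matrix.mul_smul A c B))

/-- Conjugate transposition as a continuous real linear map. -/
def conjTransposeCLM (m n : ℕ) : Mat m n →L[ℝ] Mat n m :=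
  LinearMap.toContinuousLinearMap
    { toFun := fun A => Aᴴ
      map_add' := Matrix.conjTranspose_add
      map_smul' := fun c A => by rw [Matrix.conjTranspose_smul, star_trivial]; rfl }

theorem mvfderiv_matMul {f : M → Mat l m} {g : M → Mat m n}
    (hf : MDifferentiableAt I 𝓘(ℝ, Mat l m) f x) (hg : MDifferentiableAt I 𝓘(ℝ, Mat m n) g x)
    (v : TangentSpace I x) :
    mvfderiv I (fun y => f y * g y) x v = mvfderiv I f x v * g x + f x * mvfderiv I g x v :=
  mvfderiv_bilin (matMulCLM l m n) hf hg v

theorem mdifferentiableAt_matMul {f : M → Mat l m} {g : M → Mat m n}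
    (hf : MDifferentiableAt I 𝓘(ℝ, Mat l m) f x) (hg : MDifferentiableAt I 𝓘(ℝ, Mat m n) g x) :
    MDifferentiableAt I 𝓘(ℝ, Mat l n) (fun y => f y * g y) x := by
  have h : MDifferentiableAt I 𝓘(ℝ, Mat m n →L[ℝ] Mat l n) (fun y => matMulCLM l m n (f y)) x :=
    (matMulCLM l m n).differentiableAt.mdifferentiableAt.comp x hf
  exact h.clm_apply hg

theorem mvfderiv_conjTranspose {f : M → Mat m n}
    (hf : MDifferentiableAt I 𝓘(ℝ, Mat m n) f x) (v : TangentSpace I x) :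
    mvfderiv I (fun y => (f y)ᴴ) x v = (mvfderiv I f x v)ᴴ :=
  mvfderiv_clm_comp (conjTransposeCLM m n) hf v

theorem mdifferentiableAt_conjTranspose {f : M → Mat m n}
    (hf : MDifferentiableAt I 𝓘(ℝ, Mat m n) f x) :
    MDifferentiableAt I 𝓘(ℝ, Mat n m) (fun y => (f y)ᴴ) x :=
  (conjTransposeCLM m n).differentiableAt.mdifferentiableAt.comp x hf

theorem mdifferentiableAt_matInv {f : M → Mat n n} (hf : MDifferentiableAt I 𝓘(ℝ, Mat n n) f x)
    (hu : IsUnit (f x)) : MDifferentiableAt I 𝓘(ℝ, Mat n n) (fun y => (f y)⁻¹) x := by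
  have h : DifferentiableAt ℝ (fun A : Mat n n => A⁻¹) (f x) :=
    (contDiffAt_inv (r := 1) contDiffAt_id hu).differentiableAt (by simp)
  exact h.mdifferentiableAt.comp x hf

theorem mvfderiv_const_val {V : Type*} [NormedAddCommGroup V] [NormedSpace ℝ V] (c : V)
    (v : TangentSpace I x) : mvfderiv I (fun _ : M => c) x v = 0 := by
  change mfderiv I 𝓘(ℝ, V) (fun _ : M => c) x v = 0
  rw [mfderiv_const]
  rfl

theorem mvfderiv_matInv {f : M → Mat n n} (hf : MDifferentiableAt I 𝓘(ℝ, Mat n n) f x)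
    (hu : ∀ y, IsUnit (f y)) (v : TangentSpace I x) :
    mvfderiv I (fun y => (f y)⁻¹) x v = -((f x)⁻¹ * mvfderiv I f x v * (f x)⁻¹) := by
  have hd := fun y => (Matrix.isUnit_iff_isUnit_det _).1 (hu y)
  have h := mvfderiv_matMul hf (mdifferentiableAt_matInv hf (hu x)) v
  have h1 : (fun y => f y * (f y)⁻¹) = fun _ => 1 := funext fun y =>
    Matrix.mul_nonsing_inv _ (hd y)
  rw [mvfderiv_congr (Filter.EventuallyEq.of_eq h1), mvfderiv_const_val] at h
  have h2 := congrArg ((f x)⁻¹ * ·) h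
  simp only [Matrix.mul_zero, Matrix.mul_add] at h2
  rw [← Matrix.mul_assoc (f x)⁻¹ (f x), Matrix.nonsing_inv_mul _ (hd x), Matrix.one_mul,
    ← Matrix.mul_assoc] at h2
  exact eq_neg_of_add_eq_zero_right h2.symm

theorem mvfderiv_entry {f : M → Mat m n} (hf : MDifferentiableAt I 𝓘(ℝ, Mat m n) f x)
    (v : TangentSpace I x) (i : Fin m) (j : Fin n) :
    mvfderiv I (fun y => f y i j) x v = mvfderiv I f x v i j := by
  let e : Mat m n →L[ℝ] ℂ := (Matrix.entryLinearMap ℝ ℂ i j).toContinuousLinearMap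
  exact mvfderiv_clm_comp e hf v

end MatrixCalculus

/-! ### Matrix coordinates on the product manifold -/

section Embedding

variable {p k : ℕ}

theorem contMDiff_stiefel_val :
    ContMDiff 𝓘(ℝ, StiefelModel p k) 𝓘(ℝ, Mat p k) ∞ (Stiefel.val : Stiefel p k → Mat p k) := by
  intro U
  rw [contMDiffAt_iff]
  refine ⟨Stiefel.continuous_val.continuousAt, ?_⟩
  exact (U.frame.contDiff_cayleyInv (r := ∞)).contDiffAt.contDiffWithinAt

/-- The inclusion of the product manifold into `ℂ^{p×k} × ℂ^{k×k}`. -/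
def incl (θ : MBar p k) : Mat p k × Mat k k := (θ.U, θ.S)

theorem contMDiff_incl :
    ContMDiff (IBar p k) 𝓘(ℝ, Mat p k × Mat k k) ∞ (incl (p := p) (k := k)) := by
  have h1 : ContMDiff (IBar p k) 𝓘(ℝ, Mat p k) ∞ (MBar.U : MBar p k → Mat p k) :=
    contMDiff_stiefel_val.comp contMDiff_fst
  have h2 : ContMDiff (IBar p k) 𝓘(ℝ, Mat k k) ∞ (MBar.S : MBar p k → Mat k k) :=
    (contDiff_herm_val.contMDiff.comp contMDiff_subtype_val).comp contMDiff_snd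
  exact h1.prodMk_space h2

/-- The differential of the inclusion: the matrix coordinates `ambient` as a linear map. -/
def amb (θ : MBar p k) : TangentSpace (IBar p k) θ →L[ℝ] Mat p k × Mat k k :=
  mvfderiv (IBar p k) incl θ

theorem mdifferentiableAt_incl (θ : MBar p k) :
    MDifferentiableAt (IBar p k) 𝓘(ℝ, Mat p k × Mat k k) incl θ :=
  contMDiff_incl.contMDiffAt.mdifferentiableAt (by simp)

theorem mdifferentiableAt_U (θ : MBar p k) :
    MDifferentiableAt (IBar p k) 𝓘(ℝ, Mat p k) MBar.U θ :=
  (ContinuousLinearMap.fst ℝ (Mat p k) (Mat k k)).differentiableAt.mdifferentiableAt.comp θ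
    (mdifferentiableAt_incl θ)

theorem mdifferentiableAt_S (θ : MBar p k) :
    MDifferentiableAt (IBar p k) 𝓘(ℝ, Mat k k) MBar.S θ :=
  (ContinuousLinearMap.snd ℝ (Mat p k) (Mat k k)).differentiableAt.mdifferentiableAt.comp θ
    (mdifferentiableAt_incl θ)

theorem mvfderiv_U (θ : MBar p k) (ξ : TangentSpace (IBar p k) θ) :
    mvfderiv (IBar p k) MBar.U θ ξ = (amb θ ξ).1 :=
  mvfderiv_clm_comp (ContinuousLinearMap.fst ℝ (Mat p k) (Mat k k)) (mdifferentiableAt_incl θ) ξ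

theorem mvfderiv_S (θ : MBar p k) (ξ : TangentSpace (IBar p k) θ) :
    mvfderiv (IBar p k) MBar.S θ ξ = (amb θ ξ).2 :=
  mvfderiv_clm_comp (ContinuousLinearMap.snd ℝ (Mat p k) (Mat k k)) (mdifferentiableAt_incl θ) ξ

theorem matDeriv_eq {m n : ℕ} {f : MBar p k → Mat m n} {θ : MBar p k}
    (hf : MDifferentiableAt (IBar p k) 𝓘(ℝ, Mat m n) f θ) (ξ : TangentSpace (IBar p k) θ) :
    matDeriv f θ ξ = mvfderiv (IBar p k) f θ ξ := by
  ext i j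
  exact mvfderiv_entry hf ξ i j

theorem ambient_eq (θ : MBar p k) (ξ : TangentSpace (IBar p k) θ) : ambient θ ξ = amb θ ξ :=
  Prod.ext ((matDeriv_eq (mdifferentiableAt_U θ) ξ).trans (mvfderiv_U θ ξ))
    ((matDeriv_eq (mdifferentiableAt_S θ) ξ).trans (mvfderiv_S θ ξ))

theorem mdifferentiableAt_amb {η : VField (IBar p k) (MBar p k)} {θ : MBar p k}
    (hη : VFieldDiffAt η θ) :
    MDifferentiableAt (IBar p k) 𝓘(ℝ, Mat p k × Mat k k) (fun y => amb y (η y)) θ :=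
  hη.mdifferentiableAt_mvfderiv contMDiff_incl.contMDiffAt

theorem dirDeriv_eq {η : VField (IBar p k) (MBar p k)} {θ : MBar p k}
    (hη : VFieldDiffAt η θ) (ξ : TangentSpace (IBar p k) θ) :
    dirDeriv η θ ξ = mvfderiv (IBar p k) (fun y => amb y (η y)) θ ξ := by
  have h := mdifferentiableAt_amb hη
  simp only [dirDeriv, ambient_eq]
  let L₁ := ContinuousLinearMap.fst ℝ (Mat p k) (Mat k k)
  let L₂ := ContinuousLinearMap.snd ℝ (Mat p k) (Mat k k)
  have h1 : MDifferentiableAt (IBar p k) 𝓘(ℝ, Mat p k) (fun y => (amb y (η y)).1) θ :=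
    L₁.differentiableAt.mdifferentiableAt.comp θ h
  have h2 : MDifferentiableAt (IBar p k) 𝓘(ℝ, Mat k k) (fun y => (amb y (η y)).2) θ :=
    L₂.differentiableAt.mdifferentiableAt.comp θ h
  exact Prod.ext ((matDeriv_eq h1 ξ).trans (mvfderiv_clm_comp L₁ h ξ))
    ((matDeriv_eq h2 ξ).trans (mvfderiv_clm_comp L₂ h ξ))

/-- The tangent space at `(U, Σ)` in matrix coordinates. -/
def tangentSet (θ : MBar p k) : Submodule ℝ (Mat p k × Mat k k) where
  carrier := {Z | (θ.Uᴴ * Z.1)ᴴ = -(θ.Uᴴ * Z.1) ∧ Z.2ᴴ = Z.2}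
  add_mem' := by
    rintro a b ⟨h1, h2⟩ ⟨h3, h4⟩
    refine ⟨?_, ?_⟩
    · change (θ.Uᴴ * (a.1 + b.1))ᴴ = -(θ.Uᴴ * (a.1 + b.1))
      rw [Matrix.mul_add, Matrix.conjTranspose_add, h1, h3]
      abel
    · change (a.2 + b.2)ᴴ = a.2 + b.2
      rw [Matrix.conjTranspose_add, h2, h4]
  zero_mem' := by simp
  smul_mem' := by
    rintro c a ⟨h1, h2⟩
    refine ⟨?_, ?_⟩
    · change (θ.Uᴴ * (c • a.1))ᴴ = -(θ.Uᴴ * (c • a.1))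
      rw [Matrix.mul_smul, Matrix.conjTranspose_smul, h1, star_trivial, smul_neg]
    · change (c • a.2)ᴴ = c • a.2
      rw [Matrix.conjTranspose_smul, h2, star_trivial]

/-- The tangency conditions, obtained by differentiating `Uᴴ U = 1` and `Σᴴ = Σ`. -/
theorem amb_mem (θ : MBar p k) (ξ : TangentSpace (IBar p k) θ) : amb θ ξ ∈ tangentSet θ := by
  have hU := mdifferentiableAt_U θ
  constructor
  · have h := mvfderiv_matMul (mdifferentiableAt_conjTranspose hU) hU ξ
    rw [mvfderiv_congr (g := fun _ => 1) (Filter.EventuallyEq.of_eq (funext MBar.U_mul)),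
      mvfderiv_const_val, mvfderiv_conjTranspose hU, mvfderiv_U] at h
    rw [Matrix.conjTranspose_mul, Matrix.conjTranspose_conjTranspose]
    exact eq_neg_of_add_eq_zero_left h.symm
  · have h := mvfderiv_conjTranspose (mdifferentiableAt_S θ) ξ
    rw [mvfderiv_congr (g := MBar.S) (Filter.EventuallyEq.of_eq
      (funext fun θ => θ.S_posDef.1)), mvfderiv_S] at h
    exact h.symm

/-- The charts of the product manifold factor through the inclusion, so its differential is
injective. -/
theorem amb_injective (θ : MBar p k) : Function.Injective (amb θ) := by
  rw [injective_iff_map_eq_zero]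
  intro ξ hξ
  let Ψ : Mat p k × Mat k k → MBarModel p k := fun Z => (θ.1.frame.cayley Z.1, hermPart Z.2)
  have hΨ : DifferentiableAt ℝ Ψ (incl θ) := by
    have hu : IsUnit (1 + θ.1.frame.Uᴴ * (incl θ).1).det := mem_chart_source (StiefelModel p k) θ.1
    have h1 : ContDiffAt ℝ 1 (fun Z : Mat p k × Mat k k => θ.1.frame.cayley Z.1) (incl θ) :=
      ContDiffAt.comp (incl θ) (θ.1.frame.contDiffAt_cayley hu) contDiffAt_fst
    have h2 : ContDiffAt ℝ 1 (fun Z : Mat p k × Mat k k => hermPart Z.2) (incl θ) :=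
      ContDiffAt.comp (incl θ) contDiff_hermPart.contDiffAt contDiffAt_snd
    exact (h1.prodMk h2).differentiableAt (by simp)
  have h1 := mvfderiv_fun_comp hΨ (mdifferentiableAt_incl θ) ξ
  have h2 : (fun y => Ψ (incl y)) = extChartAt (IBar p k) θ := by
    funext y
    refine Prod.ext rfl (Herm.ext ?_)
    change herm y.S = y.S
    rw [herm, y.S_posDef.1.eq]
    module
  have h3 : mvfderiv (IBar p k) incl θ ξ = 0 := hξ
  rw [h2, h3, map_zero, mvfderiv_extChartAt_self] at h1
  exact h1

theorem skewPart_val {n : ℕ} {A : Mat n n} (hA : Aᴴ = -A) : (skewPart A).val = A := by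
  change (1 / 2 : ℂ) • (A - Aᴴ) = A
  rw [hA]
  module

theorem hermPart_val {n : ℕ} {A : Mat n n} (hA : Aᴴ = A) : (hermPart A).val = A := by
  change (1 / 2 : ℂ) • (A + Aᴴ) = A
  rw [hA]
  module

/-- Coordinates on the tangent space at `θ` given by a frame adapted to `θ`. -/
def tangentCoord (θ : MBar p k) : Mat p k × Mat k k →ₗ[ℝ] MBarModel p k where
  toFun Z := ((skewPart (θ.Uᴴ * Z.1), (θ.1.frame.Nᴴ * Z.1 : Mat (p - k) k)), hermPart Z.2)
  map_add' a b := by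
    refine Prod.ext (Prod.ext (SkewHerm.ext ?_) ?_) (Herm.ext ?_)
    · change skew (θ.Uᴴ * (a.1 + b.1)) = skew (θ.Uᴴ * a.1) + skew (θ.Uᴴ * b.1)
      simp only [skew, Matrix.mul_add, Matrix.conjTranspose_add]
      module
    · exact Matrix.mul_add _ _ _
    · change herm (a.2 + b.2) = herm a.2 + herm b.2
      simp only [herm, Matrix.conjTranspose_add]
      module
  map_smul' c a := by
    refine Prod.ext (Prod.ext (SkewHerm.ext ?_) ?_) (Herm.ext ?_)
    · change skew (θ.Uᴴ * (c • a.1)) = c • skew (θ.Uᴴ * a.1)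
      simp only [skew, Matrix.mul_smul, Matrix.conjTranspose_smul, star_trivial, ← smul_sub]
      rw [smul_comm]
    · exact Matrix.mul_smul _ _ _
    · change herm (c • a.2) = c • herm a.2
      simp only [herm, Matrix.conjTranspose_smul, star_trivial, ← smul_add]
      rw [smul_comm]

theorem eq_zero_of_tangentCoord {θ : MBar p k} {Z : Mat p k × Mat k k} (hZ : Z ∈ tangentSet θ)
    (h : tangentCoord θ Z = 0) : Z = 0 := by
  have h1 : skewPart (θ.Uᴴ * Z.1) = 0 := congrArg (fun z => z.1.1) h
  have h2 : θ.1.frame.Nᴴ * Z.1 = 0 := congrArg (fun z => z.1.2) h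
  have h3 : hermPart Z.2 = 0 := congrArg (fun z => z.2) h
  have h4 : θ.Uᴴ * Z.1 = 0 := (skewPart_val hZ.1).symm.trans (congrArg SkewHerm.val h1)
  have h5 : Z.2 = 0 := (hermPart_val hZ.2).symm.trans (congrArg Herm.val h3)
  refine Prod.ext ?_ h5
  have hU : θ.1.frame.U = θ.U := θ.1.frame_U
  rw [θ.1.frame.eq_sum Z.1, hU, h4, h2]
  simp

/-- Every pair of matrices satisfying the tangency conditions is the coordinate pair of a tangent
vector, by injectivity and equality of dimensions. -/
theorem exists_amb_eq {θ : MBar p k} {Z : Mat p k × Mat k k} (hZ : Z ∈ tangentSet θ) :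
    ∃ ξ, amb θ ξ = Z := by
  let T : MBarModel p k →ₗ[ℝ] MBarModel p k := tangentCoord θ ∘ₗ (amb θ).toLinearMap
  have hT : Function.Injective T := by
    rw [injective_iff_map_eq_zero]
    intro ξ hξ
    apply amb_injective θ
    rw [eq_zero_of_tangentCoord (amb_mem θ ξ) hξ]
    exact (map_zero (amb θ)).symm
  obtain ⟨ξ, hξ⟩ := LinearMap.injective_iff_surjective.1 hT (tangentCoord θ Z)
  refine ⟨ξ, ?_⟩
  rw [← sub_eq_zero]
  refine eq_zero_of_tangentCoord (sub_mem (amb_mem θ ξ) hZ) ?_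
  rw [map_sub, sub_eq_zero]
  exact hξ

/-- A linear map which inverts the matrix coordinates on tangent vectors. -/
theorem exists_amb_inverse (θ : MBar p k) :
    ∃ L : Mat p k × Mat k k →L[ℝ] TangentSpace (IBar p k) θ, (∀ ξ, L (amb θ ξ) = ξ) ∧
      ∀ Z ∈ tangentSet θ, amb θ (L Z) = Z := by
  let A : MBarModel p k →ₗ[ℝ] Mat p k × Mat k k := (amb θ).toLinearMap
  obtain ⟨L, hL⟩ := LinearMap.exists_leftInverse_of_injective A
    (LinearMap.ker_eq_bot.2 (amb_injective θ))
  have hL' : ∀ ξ, L (A ξ) = ξ := fun ξ => LinearMap.congr_fun hL ξ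
  refine ⟨(L.toContinuousLinearMap : Mat p k × Mat k k →L[ℝ] MBarModel p k), hL', ?_⟩
  intro Z hZ
  obtain ⟨ξ, rfl⟩ := exists_amb_eq hZ
  exact congrArg (amb θ) (hL' ξ)

end Embedding

/-! ### The metric of the product manifold -/

section MetricForm

variable {p k : ℕ}

/-- The pairing `Re tr (A B)`. -/
def reTrMul (m n : ℕ) : Mat m n →L[ℝ] Mat n m →L[ℝ] ℝ :=
  LinearMap.toContinuousBilinearMap (LinearMap.mk₂ ℝ (fun A B => (A * B).trace.re)
    (by intros; simp [Matrix.add_mul]) (by intros; simp [Matrix.smul_mul])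
    (by intros; simp [Matrix.mul_add]) (by intros; simp [Matrix.mul_smul]))

/-- The pairing `Re (tr A tr B)`. -/
def reTrTr (n : ℕ) : Mat n n →L[ℝ] Mat n n →L[ℝ] ℝ :=
  LinearMap.toContinuousBilinearMap (LinearMap.mk₂ ℝ (fun A B => (A.trace * B.trace).re)
    (by intros; simp [add_mul]) (by intros; simp; ring)
    (by intros; simp [mul_add]) (by intros; simp; ring))

theorem reTrMul_apply {m n : ℕ} (A : Mat m n) (B : Mat n m) :
    reTrMul m n A B = (A * B).trace.re := rfl

theorem reTrTr_apply {n : ℕ} (A B : Mat n n) : reTrTr n A B = (A.trace * B.trace).re := rfl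

theorem reTrMul_comm {m n : ℕ} (A : Mat m n) (B : Mat n m) :
    reTrMul m n A B = reTrMul n m B A := by
  rw [reTrMul_apply, reTrMul_apply, Matrix.trace_mul_comm]

theorem re_trace_conjTranspose {n : ℕ} (A : Mat n n) : Aᴴ.trace.re = A.trace.re := by
  rw [Matrix.trace_conjTranspose]
  simp

theorem reTrMul_conjTranspose {m n : ℕ} (A : Mat m n) (B : Mat n m) :
    reTrMul n m Aᴴ Bᴴ = reTrMul m n A B := by
  rw [reTrMul_comm, reTrMul_apply, reTrMul_apply, ← Matrix.conjTranspose_mul,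
    re_trace_conjTranspose]

/-- The metric in terms of pairings which are easy to differentiate. -/
theorem metricForm_eq (α β : ℝ) (θ : MBar p k) (ξ η : Mat p k × Mat k k) :
    metricForm α β θ ξ η = reTrMul k p ξ.1ᴴ η.1 -
      1 / 2 * reTrMul k k (θ.Uᴴ * ξ.1)ᴴ (θ.Uᴴ * η.1) +
      α * reTrMul k k (θ.S⁻¹ * ξ.2) (θ.S⁻¹ * η.2) +
      β * reTrTr k (θ.S⁻¹ * ξ.2) (θ.S⁻¹ * η.2) := by
  have h : ξ.1ᴴ * (1 - (1 / 2 : ℂ) • (θ.U * θ.Uᴴ)) * η.1 =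
      ξ.1ᴴ * η.1 - (1 / 2 : ℝ) • ((θ.Uᴴ * ξ.1)ᴴ * (θ.Uᴴ * η.1)) := by
    have h2 : (1 / 2 : ℂ) • (θ.U * θ.Uᴴ) = (1 / 2 : ℝ) • (θ.U * θ.Uᴴ) := by
      ext i j
      simp
    rw [h2]
    simp only [Matrix.mul_sub, Matrix.sub_mul, Matrix.mul_one, Matrix.mul_smul, Matrix.smul_mul,
      Matrix.conjTranspose_mul, Matrix.conjTranspose_conjTranspose, Matrix.mul_assoc]
  simp only [metricForm, reTrMul_apply, reTrTr_apply, h, Matrix.mul_assoc]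
  simp

/-- The form `metricForm` as a bilinear map. -/
def metricBilin (α β : ℝ) (θ : MBar p k) :
    Mat p k × Mat k k →ₗ[ℝ] Mat p k × Mat k k →ₗ[ℝ] ℝ :=
  LinearMap.mk₂ ℝ (metricForm α β θ)
    (by
      intro a b c
      simp only [metricForm_eq, Prod.fst_add, Prod.snd_add, Matrix.conjTranspose_add,
        Matrix.mul_add, map_add, add_apply]
      ring)
    (by
      intro r a c
      simp only [metricForm_eq, Prod.smul_fst, Prod.smul_snd, Matrix.conjTranspose_smul,
        star_trivial, Matrix.mul_smul, map_smul, smul_apply, smul_eq_mul]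
      ring)
    (by
      intro a b c
      simp only [metricForm_eq, Prod.fst_add, Prod.snd_add, Matrix.mul_add, map_add]
      ring)
    (by
      intro r a c
      simp only [metricForm_eq, Prod.smul_fst, Prod.smul_snd, Matrix.mul_smul, map_smul,
        smul_eq_mul]
      ring)

theorem metricForm_symm (α β : ℝ) (θ : MBar p k) (ξ η : Mat p k × Mat k k) :
    metricForm α β θ ξ η = metricForm α β θ η ξ := by
  have h1 := reTrMul_conjTranspose ξ.1ᴴ η.1
  have h2 := reTrMul_conjTranspose (θ.Uᴴ * ξ.1)ᴴ (θ.Uᴴ * η.1)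
  rw [Matrix.conjTranspose_conjTranspose, reTrMul_comm] at h1 h2
  rw [metricForm_eq, metricForm_eq, ← h1, ← h2, reTrMul_comm (θ.S⁻¹ * ξ.2), reTrTr_apply,
    reTrTr_apply, mul_comm (θ.S⁻¹ * ξ.2).trace]

theorem re_trace_conjTranspose_mul_self {m n : ℕ} (A : Mat m n) :
    (Aᴴ * A).trace.re = ∑ j, ∑ i, Complex.normSq (A i j) := by
  simp only [Matrix.trace, Matrix.diag, Matrix.mul_apply, Matrix.conjTranspose_apply,
    Complex.re_sum]
  refine Finset.sum_congr rfl fun j _ => Finset.sum_congr rfl fun i _ => ?_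
  simp [Complex.normSq_apply]

theorem re_trace_conjTranspose_mul_self_nonneg {m n : ℕ} (A : Mat m n) :
    0 ≤ (Aᴴ * A).trace.re := by
  rw [re_trace_conjTranspose_mul_self]
  exact Finset.sum_nonneg fun j _ => Finset.sum_nonneg fun i _ => Complex.normSq_nonneg _

theorem re_trace_conjTranspose_mul_self_pos {m n : ℕ} {A : Mat m n} (hA : A ≠ 0) :
    0 < (Aᴴ * A).trace.re := by
  refine lt_of_le_of_ne (re_trace_conjTranspose_mul_self_nonneg A) fun h => hA ?_
  rw [re_trace_conjTranspose_mul_self, eq_comm, Finset.sum_eq_zero_iff_of_nonneg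
    fun j _ => Finset.sum_nonneg fun i _ => Complex.normSq_nonneg _] at h
  ext i j
  have h1 := h j (Finset.mem_univ j)
  rw [Finset.sum_eq_zero_iff_of_nonneg fun i _ => Complex.normSq_nonneg _] at h1
  exact Complex.normSq_eq_zero.1 (h1 i (Finset.mem_univ i))

/-- The trace inequality `|tr A|² ≤ n ‖A‖²` for the Frobenius norm. -/
theorem re_trace_sq_le {n : ℕ} (A : Mat n n) : A.trace.re ^ 2 ≤ n * (Aᴴ * A).trace.re := by
  have h1 : A.trace.re = ∑ i, (A i i).re := by simp [Matrix.trace, Complex.re_sum]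
  have h2 := sq_sum_le_card_mul_sum_sq (s := Finset.univ) (f := fun i => (A i i).re)
  rw [Finset.card_univ, Fintype.card_fin] at h2
  rw [h1, re_trace_conjTranspose_mul_self]
  refine h2.trans (mul_le_mul_of_nonneg_left (Finset.sum_le_sum fun j _ => ?_) (Nat.cast_nonneg n))
  refine le_trans ?_ (Finset.single_le_sum (f := fun i => Complex.normSq (A i j))
    (fun i _ => Complex.normSq_nonneg _) (Finset.mem_univ j))
  rw [Complex.normSq_apply, sq]
  exact le_add_of_nonneg_right (mul_self_nonneg _)

/-- Positivity of the part of the metric on `H_k^{++}`: by the trace inequality, this is where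
`β > -α / k` is needed. -/
theorem posDef_part_pos {α β : ℝ} (hk : 0 < k) (hα : 0 < α) (hβ : -(α / k) < β) {S A : Mat k k}
    (hS : S.PosDef) (hA : Aᴴ = A) (hA0 : A ≠ 0) :
    0 < α * reTrMul k k (S⁻¹ * A) (S⁻¹ * A) + β * reTrTr k (S⁻¹ * A) (S⁻¹ * A) := by
  -- With `R = S^{-1/2}` and `Y = R A R`, the two pairings are `‖Y‖²` and `(tr Y)²`.
  obtain ⟨R, hR, hRR⟩ : ∃ R : Mat k k, R.PosDef ∧ R * R = S⁻¹ := ⟨_, sqrt_mat hS.inv⟩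
  set Y := R * A * R with hY
  have hYh : Yᴴ = Y := by
    rw [hY, Matrix.conjTranspose_mul, Matrix.conjTranspose_mul, hA, hR.1.eq, Matrix.mul_assoc]
  have h1 : (S⁻¹ * A).trace = Y.trace := by
    rw [← hRR, hY, Matrix.mul_assoc, Matrix.trace_mul_comm R]
  have h2 : (S⁻¹ * A * (S⁻¹ * A)).trace = (Yᴴ * Y).trace := by
    rw [hYh, ← hRR, hY]
    simp only [Matrix.mul_assoc]
    rw [Matrix.trace_mul_comm R]
    simp only [Matrix.mul_assoc]
  have hY0 : Y ≠ 0 := by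
    intro h
    apply hA0
    have hRd := (Matrix.isUnit_iff_isUnit_det _).1 hR.isUnit
    have h3 : R⁻¹ * Y * R⁻¹ = A := by
      rw [hY, ← Matrix.mul_assoc, ← Matrix.mul_assoc, Matrix.nonsing_inv_mul _ hRd, Matrix.one_mul,
        Matrix.mul_assoc, Matrix.mul_nonsing_inv _ hRd, Matrix.mul_one]
    rw [← h3, h]
    simp
  have him : Y.trace.im = 0 := by
    have h := congrArg Complex.im (congrArg Matrix.trace hYh)
    rw [Matrix.trace_conjTranspose] at h
    simp only [Complex.star_def, Complex.conj_im] at h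
    linarith
  have hq := re_trace_conjTranspose_mul_self_pos hY0
  have ht := re_trace_sq_le Y
  rw [reTrMul_apply, reTrTr_apply, h1, h2, Complex.mul_re, him]
  set q := (Yᴴ * Y).trace.re
  set t := Y.trace.re
  have hk' : (0 : ℝ) < k := Nat.cast_pos.2 hk
  have hβ' : 0 < α + β * k := by
    have h3 : -(α / k) * k < β * k := mul_lt_mul_of_pos_right hβ hk'
    rw [neg_mul, div_mul_cancel₀ _ hk'.ne'] at h3
    linarith
  rcases le_or_gt 0 β with hb | hb
  · have h4 : 0 ≤ β * (t * t) := mul_nonneg hb (mul_self_nonneg t)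
    have h5 : 0 < α * q := mul_pos hα hq
    linarith
  · have h4 : β * (k * q) ≤ β * t ^ 2 := mul_le_mul_of_nonpos_left ht hb.le
    have h5 : 0 < (α + β * k) * q := mul_pos hβ' hq
    linarith

/-- Since `I - U Uᴴ / 2 = I / 2 + N Nᴴ / 2` for an orthonormal basis `N` of the complement of `U`,
the first term of the metric is half a sum of squared norms. -/
theorem metricForm_pos {α β : ℝ} (hk : 0 < k) (hα : 0 < α) (hβ : -(α / k) < β) {θ : MBar p k}
    {Z : Mat p k × Mat k k} (hZ : Z ∈ tangentSet θ) (hZ0 : Z ≠ 0) : 0 < metricForm α β θ Z Z := by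
  have hU : θ.1.frame.U = θ.U := θ.1.frame_U
  have hg := θ.1.frame.gram Z.1
  rw [hU] at hg
  set B := θ.1.frame.Nᴴ * Z.1
  have h1 : reTrMul k p Z.1ᴴ Z.1 - 1 / 2 * reTrMul k k (θ.Uᴴ * Z.1)ᴴ (θ.Uᴴ * Z.1) =
      1 / 2 * (Z.1ᴴ * Z.1).trace.re + 1 / 2 * (Bᴴ * B).trace.re := by
    have h2 := congrArg (fun A : Mat k k => A.trace.re) hg
    simp only [Matrix.trace_add, Complex.add_re] at h2
    rw [reTrMul_apply, reTrMul_apply]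
    linarith
  have h3 := re_trace_conjTranspose_mul_self_nonneg B
  rw [metricForm_eq, h1]
  by_cases hS : Z.2 = 0
  · have h4 : Z.1 ≠ 0 := fun h => hZ0 (Prod.ext h hS)
    have h5 := re_trace_conjTranspose_mul_self_pos h4
    simp only [hS, Matrix.mul_zero, map_zero]
    linarith
  · have h5 := re_trace_conjTranspose_mul_self_nonneg Z.1
    have h6 := posDef_part_pos hk hα hβ θ.S_posDef hZ.2 hS
    linarith

theorem contMDiffAt_metricForm (α β : ℝ) {X Y : MBar p k → Mat p k × Mat k k} {θ : MBar p k}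
    (hX : ContMDiffAt (IBar p k) 𝓘(ℝ, Mat p k × Mat k k) ∞ X θ)
    (hY : ContMDiffAt (IBar p k) 𝓘(ℝ, Mat p k × Mat k k) ∞ Y θ) :
    ContMDiffAt (IBar p k) 𝓘(ℝ, ℝ) ∞ (fun y => metricForm α β y (X y) (Y y)) θ := by
  let Φ : (Mat p k × Mat k k) × (Mat p k × Mat k k) × (Mat p k × Mat k k) → ℝ := fun z =>
    reTrMul k p z.2.1.1ᴴ z.2.2.1 - 1 / 2 * reTrMul k k (z.1.1ᴴ * z.2.1.1)ᴴ (z.1.1ᴴ * z.2.2.1) +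
      α * reTrMul k k (z.1.2⁻¹ * z.2.1.2) (z.1.2⁻¹ * z.2.2.2) +
      β * reTrTr k (z.1.2⁻¹ * z.2.1.2) (z.1.2⁻¹ * z.2.2.2)
  have hΦ : ContDiffAt ℝ ∞ Φ (incl θ, X θ, Y θ) := by
    have hB : ∀ {A : Type} [NormedAddCommGroup A] [NormedSpace ℝ A] {V W : Type}
        [NormedAddCommGroup V] [NormedSpace ℝ V] [NormedAddCommGroup W] [NormedSpace ℝ W]
        (B : V →L[ℝ] W →L[ℝ] ℝ) {f : A → V} {g : A → W} {a : A}, ContDiffAt ℝ ∞ f a →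
        ContDiffAt ℝ ∞ g a → ContDiffAt ℝ ∞ (fun x => B (f x) (g x)) a :=
      fun B f g a hf hg => (ContDiffAt.comp a B.contDiff.contDiffAt hf).clm_apply hg
    set z₀ : (Mat p k × Mat k k) × (Mat p k × Mat k k) × (Mat p k × Mat k k) := (incl θ, X θ, Y θ)
    have hu : ContDiffAt ℝ ∞ (fun z : (Mat p k × Mat k k) × (Mat p k × Mat k k) ×
        (Mat p k × Mat k k) => z.1.1ᴴ) z₀ := contDiffAt_conjTranspose contDiffAt_fst.fst
    have hw : ContDiffAt ℝ ∞ (fun z : (Mat p k × Mat k k) × (Mat p k × Mat k k) ×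
        (Mat p k × Mat k k) => z.1.2⁻¹) z₀ := contDiffAt_inv contDiffAt_fst.snd θ.S_posDef.isUnit
    have h1 : ContDiffAt ℝ ∞ (fun z : (Mat p k × Mat k k) × (Mat p k × Mat k k) ×
        (Mat p k × Mat k k) => z.2.1.1) z₀ := contDiffAt_snd.fst.fst
    have h2 : ContDiffAt ℝ ∞ (fun z : (Mat p k × Mat k k) × (Mat p k × Mat k k) ×
        (Mat p k × Mat k k) => z.2.2.1) z₀ := contDiffAt_snd.snd.fst
    have h3 : ContDiffAt ℝ ∞ (fun z : (Mat p k × Mat k k) × (Mat p k × Mat k k) ×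
        (Mat p k × Mat k k) => z.2.1.2) z₀ := contDiffAt_snd.fst.snd
    have h4 : ContDiffAt ℝ ∞ (fun z : (Mat p k × Mat k k) × (Mat p k × Mat k k) ×
        (Mat p k × Mat k k) => z.2.2.2) z₀ := contDiffAt_snd.snd.snd
    have e1 := hB (reTrMul k p) (contDiffAt_conjTranspose h1) h2
    have e2 := hB (reTrMul k k) (contDiffAt_conjTranspose (contDiffAt_mul hu h1))
      (contDiffAt_mul hu h2)
    have e3 := hB (reTrMul k k) (contDiffAt_mul hw h3) (contDiffAt_mul hw h4)
    have e4 := hB (reTrTr k) (contDiffAt_mul hw h3) (contDiffAt_mul hw h4)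
    exact ((e1.sub (contDiffAt_const.mul e2)).add (contDiffAt_const.mul e3)).add
      (contDiffAt_const.mul e4)
  have h := ContMDiffAt.comp (f := fun y => (incl y, X y, Y y)) θ hΦ.contMDiffAt
    (contMDiff_incl.contMDiffAt.prodMk_space (hX.prodMk_space hY))
  refine h.congr_of_eventuallyEq (Filter.Eventually.of_forall fun y => ?_)
  exact metricForm_eq α β y (X y) (Y y)

/-- The metric of the product manifold. -/
def metricBar {α β : ℝ} (hk : 0 < k) (hα : 0 < α) (hβ : -(α / k) < β) :
    RiemMetric (IBar p k) (MBar p k) :=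
  RiemMetric.ofBilin
    (fun θ => (metricBilin α β θ).compl₁₂ (amb θ).toLinearMap (amb θ).toLinearMap)
    (fun θ v w => metricForm_symm α β θ (amb θ v) (amb θ w))
    (fun θ v hv => metricForm_pos hk hα hβ (amb_mem θ v) fun h => hv
      (amb_injective θ (h.trans (map_zero (amb θ)).symm)))
    (fun _ _ _ hX hY => contMDiffAt_metricForm α β
      (contMDiffAt_mvfderiv hX contMDiff_incl.contMDiffAt)
      (contMDiffAt_mvfderiv hY contMDiff_incl.contMDiffAt))

theorem metricBar_inner {α β : ℝ} (hk : 0 < k) (hα : 0 < α) (hβ : -(α / k) < β) (θ : MBar p k)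
    (ξ η : TangentSpace (IBar p k) θ) :
    (metricBar hk hα hβ).inner θ ξ η = metricForm α β θ (amb θ ξ) (amb θ η) := rfl

end MetricForm

/-! ### Algebra of the correction term -/

section ConnectionAlgebra

variable {p k : ℕ}

theorem herm_eq_self {n : ℕ} {A : Mat n n} (hA : Aᴴ = A) : herm A = A := by
  rw [herm, hA]
  module

theorem conjTranspose_S_inv (θ : MBar p k) : (θ.S⁻¹)ᴴ = θ.S⁻¹ := θ.S_posDef.inv.1

theorem conjTranspose_U_mul_compl (θ : MBar p k) : θ.Uᴴ * (1 - θ.U * θ.Uᴴ) = 0 := by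
  rw [Matrix.mul_sub, Matrix.mul_one, ← Matrix.mul_assoc, θ.U_mul, Matrix.one_mul, sub_self]

theorem tangentProj_mem (θ : MBar p k) (Z : Mat p k × Mat k k) :
    tangentProj θ Z ∈ tangentSet θ := by
  refine ⟨?_, herm_conjTranspose _⟩
  have h : θ.Uᴴ * (Z.1 - θ.U * herm (θ.Uᴴ * Z.1)) = skew (θ.Uᴴ * Z.1) := by
    rw [Matrix.mul_sub, ← Matrix.mul_assoc, θ.U_mul, Matrix.one_mul, herm, skew]
    module
  change (θ.Uᴴ * (Z.1 - θ.U * herm (θ.Uᴴ * Z.1)))ᴴ = -(θ.Uᴴ * (Z.1 - θ.U * herm (θ.Uᴴ * Z.1)))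
  rw [h, skew_conjTranspose]

theorem tangentProj_eq_self {θ : MBar p k} {Z : Mat p k × Mat k k} (hZ : Z ∈ tangentSet θ) :
    tangentProj θ Z = Z := by
  refine Prod.ext ?_ (herm_eq_self hZ.2)
  have h : herm (θ.Uᴴ * Z.1) = 0 := by
    rw [herm, hZ.1]
    simp
  change Z.1 - θ.U * herm (θ.Uᴴ * Z.1) = Z.1
  rw [h, Matrix.mul_zero, sub_zero]

theorem correction_mem (θ : MBar p k) (a b : Mat p k × Mat k k) :
    correction θ a b ∈ tangentSet θ := by
  refine ⟨?_, ?_⟩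
  · have h : θ.Uᴴ * (correction θ a b).1 = 0 := by
      change θ.Uᴴ * ((1 - θ.U * θ.Uᴴ) * herm (b.1 * a.1ᴴ) * θ.U) = 0
      rw [← Matrix.mul_assoc, ← Matrix.mul_assoc, conjTranspose_U_mul_compl, Matrix.zero_mul,
        Matrix.zero_mul]
    rw [h]
    simp
  · change (-herm (b.2 * θ.S⁻¹ * a.2))ᴴ = -herm (b.2 * θ.S⁻¹ * a.2)
    rw [Matrix.conjTranspose_neg, herm_conjTranspose]

theorem herm_conjTranspose_arg {n : ℕ} (A : Mat n n) : herm Aᴴ = herm A := by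
  rw [herm, herm, Matrix.conjTranspose_conjTranspose, add_comm]

theorem correction_symm {θ : MBar p k} {a b : Mat p k × Mat k k} (ha : a ∈ tangentSet θ)
    (hb : b ∈ tangentSet θ) : correction θ a b = correction θ b a := by
  have h1 : (a.1 * b.1ᴴ)ᴴ = b.1 * a.1ᴴ := by simp
  have h2 : (a.2 * θ.S⁻¹ * b.2)ᴴ = b.2 * θ.S⁻¹ * a.2 := by
    rw [Matrix.conjTranspose_mul, Matrix.conjTranspose_mul, conjTranspose_S_inv, ha.2, hb.2,
      Matrix.mul_assoc]
  rw [correction, correction, ← h1, ← h2, herm_conjTranspose_arg, herm_conjTranspose_arg]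

/-- The projection `P_θ` as a linear map. -/
def tangentProjL (θ : MBar p k) : Mat p k × Mat k k →ₗ[ℝ] Mat p k × Mat k k where
  toFun := tangentProj θ
  map_add' a b := by
    simp only [tangentProj, herm, Prod.fst_add, Prod.snd_add, Prod.mk_add_mk, Matrix.mul_add,
      Matrix.conjTranspose_add, Matrix.mul_smul]
    refine Prod.ext ?_ ?_ <;> simp only <;> module
  map_smul' c a := by
    simp only [tangentProj, herm, Prod.smul_fst, Prod.smul_snd, Matrix.mul_smul,
      Matrix.conjTranspose_smul, star_trivial, ← smul_add, RingHom.id_apply]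
    refine Prod.ext ?_ ?_
    · simp only [Prod.smul_mk, smul_sub, smul_comm c (1 / 2 : ℂ)]
    · simp only [Prod.smul_mk, smul_comm c (1 / 2 : ℂ)]

/-- The correction term as a bilinear map. -/
def correctionL (θ : MBar p k) :
    Mat p k × Mat k k →ₗ[ℝ] Mat p k × Mat k k →ₗ[ℝ] Mat p k × Mat k k :=
  LinearMap.mk₂ ℝ (correction θ)
    (by
      intro a b c
      simp only [correction, herm, Prod.fst_add, Prod.snd_add, Prod.mk_add_mk, Matrix.mul_add,
        Matrix.add_mul, Matrix.conjTranspose_add, Matrix.mul_smul, Matrix.smul_mul]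
      refine Prod.ext ?_ ?_ <;> simp only <;> module)
    (by
      intro r a c
      simp only [correction, herm, Prod.smul_fst, Prod.smul_snd, Matrix.mul_smul, Matrix.smul_mul,
        Matrix.conjTranspose_smul, star_trivial, ← smul_add, Prod.smul_mk, smul_neg,
        smul_comm r (1 / 2 : ℂ)])
    (by
      intro a b c
      simp only [correction, herm, Prod.fst_add, Prod.snd_add, Prod.mk_add_mk, Matrix.mul_add,
        Matrix.add_mul, Matrix.conjTranspose_add, Matrix.mul_smul, Matrix.smul_mul]
      refine Prod.ext ?_ ?_ <;> simp only <;> module)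
    (by
      intro r a c
      simp only [correction, herm, Prod.smul_fst, Prod.smul_snd, Matrix.mul_smul, Matrix.smul_mul,
        Matrix.conjTranspose_smul, star_trivial, ← smul_add, Prod.smul_mk, smul_neg,
        smul_comm r (1 / 2 : ℂ)])

theorem re_trace_skew_mul_conjTranspose {n : ℕ} {A : Mat n n} (hA : Aᴴ = -A) (X : Mat n n) :
    (A * Xᴴ).trace.re = -(A * X).trace.re := by
  rw [← re_trace_conjTranspose, Matrix.conjTranspose_mul, Matrix.conjTranspose_conjTranspose, hA,
    Matrix.mul_neg, Matrix.trace_neg, Complex.neg_re, Matrix.trace_mul_comm]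

theorem re_trace_skew_mul_herm {n : ℕ} {A X : Mat n n} (hA : Aᴴ = -A) (hX : Xᴴ = X) :
    (A * X).trace.re = 0 := by
  have h := re_trace_skew_mul_conjTranspose hA X
  rw [hX] at h
  linarith

theorem re_trace_half_smul {n : ℕ} (A : Mat n n) :
    ((1 / 2 : ℂ) • A).trace.re = 1 / 2 * A.trace.re := by
  rw [Matrix.trace_smul, smul_eq_mul, Complex.mul_re]
  norm_num

/-- The canonical pairing of a tangent vector `c` of the Stiefel manifold with the difference between
the covariant derivative and the coordinate derivative of a field with value `b`, along `a`. -/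
theorem stiefel_correction_pairing {U a b c : Mat p k} (hU : Uᴴ * U = 1)
    (hc : (Uᴴ * c)ᴴ = -(Uᴴ * c)) :
    reTrMul k p (U * herm (aᴴ * b) + (1 - U * Uᴴ) * herm (b * aᴴ) * U)ᴴ c -
      1 / 2 * reTrMul k k
        (Uᴴ * (U * herm (aᴴ * b) + (1 - U * Uᴴ) * herm (b * aᴴ) * U))ᴴ (Uᴴ * c) =
    1 / 2 * (Uᴴ * b * (aᴴ * (1 - U * Uᴴ) * c)).trace.re +
      1 / 2 * (Uᴴ * a * (bᴴ * (1 - U * Uᴴ) * c)).trace.re := by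
  set Q := 1 - U * Uᴴ with hQ
  have hUQ : Uᴴ * Q = 0 := by
    rw [hQ, Matrix.mul_sub, Matrix.mul_one, ← Matrix.mul_assoc, hU, Matrix.one_mul, sub_self]
  have hQh : Qᴴ = Q := by simp [hQ]
  have h1 : Uᴴ * (U * herm (aᴴ * b) + Q * herm (b * aᴴ) * U) = herm (aᴴ * b) := by
    rw [Matrix.mul_add, ← Matrix.mul_assoc, hU, Matrix.one_mul, ← Matrix.mul_assoc,
      ← Matrix.mul_assoc, hUQ]
    simp
  have h2 : (herm (aᴴ * b) * (Uᴴ * c)).trace.re = 0 := by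
    rw [Matrix.trace_mul_comm]
    exact re_trace_skew_mul_herm hc (herm_conjTranspose _)
  have h3 : (U * herm (aᴴ * b) + Q * herm (b * aᴴ) * U)ᴴ * c =
      herm (aᴴ * b) * (Uᴴ * c) + (1 / 2 : ℂ) • (Uᴴ * b * (aᴴ * Q * c)) +
        (1 / 2 : ℂ) • (Uᴴ * a * (bᴴ * Q * c)) := by
    have h4 : Uᴴ * (herm (b * aᴴ) * (Q * c)) = (1 / 2 : ℂ) • (Uᴴ * b * (aᴴ * Q * c)) +
        (1 / 2 : ℂ) • (Uᴴ * a * (bᴴ * Q * c)) := by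
      simp only [herm, Matrix.conjTranspose_mul, Matrix.conjTranspose_conjTranspose,
        Matrix.smul_mul, Matrix.mul_smul, Matrix.add_mul, Matrix.mul_add, smul_add,
        Matrix.mul_assoc]
    simp only [Matrix.conjTranspose_add, Matrix.conjTranspose_mul, herm_conjTranspose, hQh,
      Matrix.add_mul, Matrix.mul_assoc, h4, add_assoc]
  rw [h1, herm_conjTranspose, reTrMul_apply, reTrMul_apply, h2, h3]
  simp only [Matrix.trace_add, Complex.add_re, h2, re_trace_half_smul]
  ring

/-- Compatibility of the correction term with the canonical metric of the Stiefel manifold. -/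
theorem stiefel_compat {U a b c : Mat p k} (ha : (Uᴴ * a)ᴴ = -(Uᴴ * a))
    (hb : (Uᴴ * b)ᴴ = -(Uᴴ * b)) (hc : (Uᴴ * c)ᴴ = -(Uᴴ * c)) :
    -(1 / 2) * (reTrMul k k (aᴴ * b)ᴴ (Uᴴ * c) + reTrMul k k (aᴴ * c)ᴴ (Uᴴ * b)) =
    (1 / 2 * (Uᴴ * b * (aᴴ * (1 - U * Uᴴ) * c)).trace.re +
      1 / 2 * (Uᴴ * a * (bᴴ * (1 - U * Uᴴ) * c)).trace.re) +
    (1 / 2 * (Uᴴ * c * (aᴴ * (1 - U * Uᴴ) * b)).trace.re +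
      1 / 2 * (Uᴴ * a * (cᴴ * (1 - U * Uᴴ) * b)).trace.re) := by
  set Q := 1 - U * Uᴴ with hQ
  have hQh : Qᴴ = Q := by simp [hQ]
  have h1 : (bᴴ * Q * c)ᴴ = cᴴ * Q * b := by
    simp only [Matrix.conjTranspose_mul, Matrix.conjTranspose_conjTranspose, hQh, Matrix.mul_assoc]
  have h2 := re_trace_skew_mul_conjTranspose ha (bᴴ * Q * c)
  rw [h1] at h2
  have haU : aᴴ * U = -(Uᴴ * a) := by rw [← ha]; simp
  have h3 : ∀ z : Mat p k, aᴴ * Q * z = aᴴ * z + Uᴴ * a * (Uᴴ * z) := by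
    intro z
    rw [hQ, Matrix.mul_sub, Matrix.mul_one, ← Matrix.mul_assoc, haU, Matrix.sub_mul]
    simp only [Matrix.neg_mul, sub_neg_eq_add, Matrix.mul_assoc]
  set A := Uᴴ * a
  set B := Uᴴ * b
  set C := Uᴴ * c
  have h4 : (B * (A * C)).trace.re = -(C * (A * B)).trace.re := by
    rw [← re_trace_conjTranspose]
    simp only [Matrix.conjTranspose_mul, ha, hb, hc]
    simp [Matrix.mul_assoc]
  have h5 : ∀ (X Y : Mat k k), Yᴴ = -Y → reTrMul k k Xᴴ Y = -(Y * X).trace.re := by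
    intro X Y hY
    rw [reTrMul_comm, reTrMul_apply, re_trace_skew_mul_conjTranspose hY]
  rw [h5 _ _ hc, h5 _ _ hb, h3, h3, Matrix.mul_add, Matrix.mul_add, h2, Matrix.trace_add,
    Matrix.trace_add, Complex.add_re, Complex.add_re, h4]
  ring

/-- Compatibility of the correction term with the trace pairings on Hermitian matrices, where `W`
is the inverse of the base point. -/
theorem hpd_compat {W a b : Mat k k} (hW : Wᴴ = W) (ha : aᴴ = a) (hb : bᴴ = b) (c : Mat k k) :
    reTrMul k k (W * -herm (b * W * a)) (W * c) =
      -(1 / 2) * (W * b * (W * a) * (W * c)).trace.re -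
        1 / 2 * (W * a * (W * b) * (W * c)).trace.re ∧
    (W * -herm (b * W * a)).trace = (-(W * a * W) * b).trace := by
  have h : W * -herm (b * W * a) = -((1 / 2 : ℂ) • (W * b * (W * a))) -
      (1 / 2 : ℂ) • (W * a * (W * b)) := by
    simp only [herm, Matrix.conjTranspose_mul, hW, ha, hb, Matrix.mul_neg, Matrix.mul_smul,
      Matrix.mul_add, smul_add, Matrix.mul_assoc, neg_add, sub_eq_add_neg]
  constructor
  · rw [h, reTrMul_apply, Matrix.sub_mul, Matrix.neg_mul, Matrix.smul_mul, Matrix.smul_mul,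
      Matrix.trace_sub, Complex.sub_re, Matrix.trace_neg, Complex.neg_re, re_trace_half_smul,
      re_trace_half_smul]
    ring
  · rw [h, Matrix.trace_sub, Matrix.trace_neg, Matrix.trace_smul, Matrix.trace_smul,
      Matrix.trace_mul_comm (W * b), Matrix.neg_mul, Matrix.trace_neg]
    simp only [Matrix.mul_assoc, smul_eq_mul]
    ring

end ConnectionAlgebra

/-! ### The Levi-Civita connection of the product manifold -/

section Connection

variable {p k : ℕ}

/-- Derivative of the metric along a tangent vector, for fields in matrix coordinates. -/
theorem mvfderiv_metricForm (α β : ℝ) {X Y : MBar p k → Mat p k × Mat k k} {θ : MBar p k}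
    (hX : MDifferentiableAt (IBar p k) 𝓘(ℝ, Mat p k × Mat k k) X θ)
    (hY : MDifferentiableAt (IBar p k) 𝓘(ℝ, Mat p k × Mat k k) Y θ)
    (ξ : TangentSpace (IBar p k) θ) {a b b' c c' : Mat p k × Mat k k} (ha : amb θ ξ = a)
    (hb : X θ = b) (hb' : mvfderiv (IBar p k) X θ ξ = b') (hc : Y θ = c)
    (hc' : mvfderiv (IBar p k) Y θ ξ = c') :
    mvfderiv (IBar p k) (fun y => metricForm α β y (X y) (Y y)) θ ξ =
      (reTrMul k p b'.1ᴴ c.1 + reTrMul k p b.1ᴴ c'.1) -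
      1 / 2 * (reTrMul k k (a.1ᴴ * b.1 + θ.Uᴴ * b'.1)ᴴ (θ.Uᴴ * c.1) +
        reTrMul k k (θ.Uᴴ * b.1)ᴴ (a.1ᴴ * c.1 + θ.Uᴴ * c'.1)) +
      α * (reTrMul k k (-(θ.S⁻¹ * a.2 * θ.S⁻¹) * b.2 + θ.S⁻¹ * b'.2) (θ.S⁻¹ * c.2) +
        reTrMul k k (θ.S⁻¹ * b.2) (-(θ.S⁻¹ * a.2 * θ.S⁻¹) * c.2 + θ.S⁻¹ * c'.2)) +
      β * (reTrTr k (-(θ.S⁻¹ * a.2 * θ.S⁻¹) * b.2 + θ.S⁻¹ * b'.2) (θ.S⁻¹ * c.2) +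
        reTrTr k (θ.S⁻¹ * b.2) (-(θ.S⁻¹ * a.2 * θ.S⁻¹) * c.2 + θ.S⁻¹ * c'.2)) := by
  subst ha hb hb' hc hc'
  let L₁ := ContinuousLinearMap.fst ℝ (Mat p k) (Mat k k)
  let L₂ := ContinuousLinearMap.snd ℝ (Mat p k) (Mat k k)
  have key : ∀ {Z : MBar p k → Mat p k × Mat k k},
      MDifferentiableAt (IBar p k) 𝓘(ℝ, Mat p k × Mat k k) Z θ →
      (MDifferentiableAt (IBar p k) 𝓘(ℝ, Mat p k) (fun y => (Z y).1) θ ∧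
        mvfderiv (IBar p k) (fun y => (Z y).1) θ ξ = (mvfderiv (IBar p k) Z θ ξ).1) ∧
      (MDifferentiableAt (IBar p k) 𝓘(ℝ, Mat k k) (fun y => y.Uᴴ * (Z y).1) θ ∧
        mvfderiv (IBar p k) (fun y => y.Uᴴ * (Z y).1) θ ξ =
          (amb θ ξ).1ᴴ * (Z θ).1 + θ.Uᴴ * (mvfderiv (IBar p k) Z θ ξ).1) ∧
      (MDifferentiableAt (IBar p k) 𝓘(ℝ, Mat k k) (fun y => y.S⁻¹ * (Z y).2) θ ∧
        mvfderiv (IBar p k) (fun y => y.S⁻¹ * (Z y).2) θ ξ =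
          -(θ.S⁻¹ * (amb θ ξ).2 * θ.S⁻¹) * (Z θ).2 +
            θ.S⁻¹ * (mvfderiv (IBar p k) Z θ ξ).2) := by
    intro Z hZ
    have h1 : MDifferentiableAt (IBar p k) 𝓘(ℝ, Mat p k) (fun y => (Z y).1) θ :=
      L₁.differentiableAt.mdifferentiableAt.comp θ hZ
    have h2 : MDifferentiableAt (IBar p k) 𝓘(ℝ, Mat k k) (fun y => (Z y).2) θ :=
      L₂.differentiableAt.mdifferentiableAt.comp θ hZ
    have d1 : mvfderiv (IBar p k) (fun y => (Z y).1) θ ξ = (mvfderiv (IBar p k) Z θ ξ).1 :=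
      mvfderiv_clm_comp L₁ hZ ξ
    have d2 : mvfderiv (IBar p k) (fun y => (Z y).2) θ ξ = (mvfderiv (IBar p k) Z θ ξ).2 :=
      mvfderiv_clm_comp L₂ hZ ξ
    have hU := mdifferentiableAt_U θ
    have hS := mdifferentiableAt_S θ
    have hSi := mdifferentiableAt_matInv hS θ.S_posDef.isUnit
    refine ⟨⟨h1, d1⟩, ⟨mdifferentiableAt_matMul (mdifferentiableAt_conjTranspose hU) h1, ?_⟩,
      ⟨mdifferentiableAt_matMul hSi h2, ?_⟩⟩
    · rw [mvfderiv_matMul (mdifferentiableAt_conjTranspose hU) h1, mvfderiv_conjTranspose hU,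
        mvfderiv_U, d1]
    · rw [mvfderiv_matMul hSi h2, mvfderiv_matInv hS (fun y => y.S_posDef.isUnit), mvfderiv_S, d2]
  obtain ⟨⟨x1, dx1⟩, ⟨x2, dx2⟩, ⟨x3, dx3⟩⟩ := key hX
  obtain ⟨⟨y1, dy1⟩, ⟨y2, dy2⟩, ⟨y3, dy3⟩⟩ := key hY
  have hB : ∀ {V W : Type} [NormedAddCommGroup V] [NormedSpace ℝ V] [NormedAddCommGroup W]
      [NormedSpace ℝ W] (B : V →L[ℝ] W →L[ℝ] ℝ) {f : MBar p k → V} {g : MBar p k → W},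
      MDifferentiableAt (IBar p k) 𝓘(ℝ, V) f θ → MDifferentiableAt (IBar p k) 𝓘(ℝ, W) g θ →
      MDifferentiableAt (IBar p k) 𝓘(ℝ, ℝ) (fun x => B (f x) (g x)) θ :=
    fun B f g hf hg => (B.differentiableAt.mdifferentiableAt.comp θ hf).clm_apply hg
  have hm : ∀ {f : MBar p k → ℝ} (r : ℝ), MDifferentiableAt (IBar p k) 𝓘(ℝ, ℝ) f θ →
      MDifferentiableAt (IBar p k) 𝓘(ℝ, ℝ) (fun x => r * f x) θ ∧
      mvfderiv (IBar p k) (fun x => r * f x) θ ξ = r * mvfderiv (IBar p k) f θ ξ :=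
    fun r hf => ⟨(ContinuousLinearMap.mul ℝ ℝ r).differentiableAt.mdifferentiableAt.comp θ hf,
      mvfderiv_clm_comp (ContinuousLinearMap.mul ℝ ℝ r) hf ξ⟩
  have x1c := mdifferentiableAt_conjTranspose x1
  have x2c := mdifferentiableAt_conjTranspose x2
  have f1 := hB (reTrMul k p) x1c y1
  have f2 := hB (reTrMul k k) x2c y2
  have f3 := hB (reTrMul k k) x3 y3
  have f4 := hB (reTrTr k) x3 y3
  have e1 := mvfderiv_bilin (reTrMul k p) x1c y1 ξ
  have e2 := mvfderiv_bilin (reTrMul k k) x2c y2 ξ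
  have e3 := mvfderiv_bilin (reTrMul k k) x3 y3 ξ
  have e4 := mvfderiv_bilin (reTrTr k) x3 y3 ξ
  rw [mvfderiv_conjTranspose x1, dx1, dy1] at e1
  rw [mvfderiv_conjTranspose x2, dx2, dy2] at e2
  rw [dx3, dy3] at e3 e4
  have hsum := congrArg (fun l : TangentSpace (IBar p k) θ →L[ℝ] ℝ => l ξ)
    (mvfderiv_add ((f1.sub (hm (1 / 2) f2).1).add (hm α f3).1) (hm β f4).1)
  have hsum2 := congrArg (fun l : TangentSpace (IBar p k) θ →L[ℝ] ℝ => l ξ)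
    (mvfderiv_add (f1.sub (hm (1 / 2) f2).1) (hm α f3).1)
  have hsum3 := congrArg (fun l : TangentSpace (IBar p k) θ →L[ℝ] ℝ => l ξ)
    (mvfderiv_sub f1 (hm (1 / 2) f2).1)
  have g2 := (hm (1 / 2) f2).2
  have g3 := (hm α f3).2
  have g4 := (hm β f4).2
  rw [e2] at g2
  rw [e3] at g3
  rw [e4] at g4
  have h0 : (fun y => metricForm α β y (X y) (Y y)) = fun y =>
      reTrMul k p (X y).1ᴴ (Y y).1 - 1 / 2 * reTrMul k k (y.Uᴴ * (X y).1)ᴴ (y.Uᴴ * (Y y).1) +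
      α * reTrMul k k (y.S⁻¹ * (X y).2) (y.S⁻¹ * (Y y).2) +
      β * reTrTr k (y.S⁻¹ * (X y).2) (y.S⁻¹ * (Y y).2) :=
    funext fun y => metricForm_eq α β y (X y) (Y y)
  rw [h0]
  refine hsum.trans (congrArg₂ (· + ·) (hsum2.trans (congrArg₂ (· + ·)
    (hsum3.trans (congrArg₂ (· - ·) e1 g2)) g3)) g4)

/-- The covariant derivative of a field with value `b` and coordinate derivative `b'` along `a`. -/
def covForm (θ : MBar p k) (a b b' : Mat p k × Mat k k) : Mat p k × Mat k k :=
  tangentProj θ b' + correction θ a b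

theorem covForm_mem (θ : MBar p k) (a b b' : Mat p k × Mat k k) :
    covForm θ a b b' ∈ tangentSet θ :=
  add_mem (tangentProj_mem θ b') (correction_mem θ a b)

/-- The constraints on the coordinate derivative of a vector field, obtained by differentiating
`(Uᴴ η_U)ᴴ = -Uᴴ η_U` and `η_Σᴴ = η_Σ`. -/
theorem mvfderiv_amb_constraint {η : VField (IBar p k) (MBar p k)} {θ : MBar p k}
    (hη : VFieldDiffAt η θ) (ξ : TangentSpace (IBar p k) θ) :
    herm (θ.Uᴴ * (mvfderiv (IBar p k) (fun y => amb y (η y)) θ ξ).1) =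
        -herm ((amb θ ξ).1ᴴ * (amb θ (η θ)).1) ∧
      (mvfderiv (IBar p k) (fun y => amb y (η y)) θ ξ).2ᴴ =
        (mvfderiv (IBar p k) (fun y => amb y (η y)) θ ξ).2 := by
  have h := mdifferentiableAt_amb hη
  let L₁ := ContinuousLinearMap.fst ℝ (Mat p k) (Mat k k)
  let L₂ := ContinuousLinearMap.snd ℝ (Mat p k) (Mat k k)
  have h1 : MDifferentiableAt (IBar p k) 𝓘(ℝ, Mat p k) (fun y => (amb y (η y)).1) θ :=
    L₁.differentiableAt.mdifferentiableAt.comp θ h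
  have h2 : MDifferentiableAt (IBar p k) 𝓘(ℝ, Mat k k) (fun y => (amb y (η y)).2) θ :=
    L₂.differentiableAt.mdifferentiableAt.comp θ h
  have d1 : mvfderiv (IBar p k) (fun y => (amb y (η y)).1) θ ξ =
      (mvfderiv (IBar p k) (fun y => amb y (η y)) θ ξ).1 := mvfderiv_clm_comp L₁ h ξ
  have d2 : mvfderiv (IBar p k) (fun y => (amb y (η y)).2) θ ξ =
      (mvfderiv (IBar p k) (fun y => amb y (η y)) θ ξ).2 := mvfderiv_clm_comp L₂ h ξ
  constructor
  · have hU := mdifferentiableAt_conjTranspose (mdifferentiableAt_U θ)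
    have h3 := mdifferentiableAt_matMul hU h1
    have e1 := mvfderiv_conjTranspose h3 ξ
    have e2 := mvfderiv_clm_comp (-ContinuousLinearMap.id ℝ (Mat k k)) h3 ξ
    have e3 : (fun y : MBar p k => (y.Uᴴ * (amb y (η y)).1)ᴴ) =
        fun y => (-ContinuousLinearMap.id ℝ (Mat k k)) (y.Uᴴ * (amb y (η y)).1) :=
      funext fun y => (amb_mem y (η y)).1
    rw [e3, e2, mvfderiv_matMul hU h1, mvfderiv_conjTranspose (mdifferentiableAt_U θ), mvfderiv_U,
      d1] at e1
    have e4 : -((amb θ ξ).1ᴴ * (amb θ (η θ)).1 +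
        θ.Uᴴ * (mvfderiv (IBar p k) (fun y => amb y (η y)) θ ξ).1) =
        ((amb θ ξ).1ᴴ * (amb θ (η θ)).1 +
        θ.Uᴴ * (mvfderiv (IBar p k) (fun y => amb y (η y)) θ ξ).1)ᴴ := e1
    rw [Matrix.conjTranspose_add] at e4
    generalize (amb θ ξ).1ᴴ * (amb θ (η θ)).1 = A at e4 ⊢
    generalize θ.Uᴴ * (mvfderiv (IBar p k) (fun y => amb y (η y)) θ ξ).1 = B at e4 ⊢
    have e5 : B + Bᴴ = -(A + Aᴴ) := by
      rw [eq_sub_of_add_eq' e4.symm]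
      abel
    rw [herm, herm, e5, smul_neg]
  · have e1 := mvfderiv_conjTranspose h2 ξ
    rw [mvfderiv_congr (g := fun y => (amb y (η y)).2) (Filter.EventuallyEq.of_eq
      (funext fun y => (amb_mem y (η y)).2)), d2] at e1
    exact e1.symm

/-- The pairing of a covariant derivative with a tangent vector. By `h1` the normal part of the
coordinate derivative is expressed through `a` and `b`. -/
theorem metricForm_covForm (α β : ℝ) {θ : MBar p k} {a b b' c : Mat p k × Mat k k}
    (ha : a ∈ tangentSet θ) (hb : b ∈ tangentSet θ) (hc : c ∈ tangentSet θ)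
    (h1 : herm (θ.Uᴴ * b'.1) = -herm (a.1ᴴ * b.1)) (h2 : b'.2ᴴ = b'.2) :
    metricForm α β θ (covForm θ a b b') c =
      reTrMul k p b'.1ᴴ c.1 - 1 / 2 * reTrMul k k (θ.Uᴴ * b'.1)ᴴ (θ.Uᴴ * c.1) +
      (1 / 2 * (θ.Uᴴ * b.1 * (a.1ᴴ * (1 - θ.U * θ.Uᴴ) * c.1)).trace.re +
        1 / 2 * (θ.Uᴴ * a.1 * (b.1ᴴ * (1 - θ.U * θ.Uᴴ) * c.1)).trace.re) +
      α * (reTrMul k k (θ.S⁻¹ * b'.2) (θ.S⁻¹ * c.2) -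
        1 / 2 * (θ.S⁻¹ * b.2 * (θ.S⁻¹ * a.2) * (θ.S⁻¹ * c.2)).trace.re -
        1 / 2 * (θ.S⁻¹ * a.2 * (θ.S⁻¹ * b.2) * (θ.S⁻¹ * c.2)).trace.re) +
      β * reTrTr k (-(θ.S⁻¹ * a.2 * θ.S⁻¹) * b.2 + θ.S⁻¹ * b'.2) (θ.S⁻¹ * c.2) := by
  have e1 : (covForm θ a b b').1 = b'.1 + (θ.U * herm (a.1ᴴ * b.1) +
      (1 - θ.U * θ.Uᴴ) * herm (b.1 * a.1ᴴ) * θ.U) := by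
    change b'.1 - θ.U * herm (θ.Uᴴ * b'.1) + (1 - θ.U * θ.Uᴴ) * herm (b.1 * a.1ᴴ) * θ.U = _
    rw [h1, Matrix.mul_neg]
    abel
  have e2 : (covForm θ a b b').2 = b'.2 + -herm (b.2 * θ.S⁻¹ * a.2) := by
    change herm b'.2 + -herm (b.2 * θ.S⁻¹ * a.2) = _
    rw [herm_eq_self h2]
  have e3 := stiefel_correction_pairing (a := a.1) (b := b.1) θ.U_mul hc.1
  obtain ⟨e4, e5⟩ := hpd_compat (conjTranspose_S_inv θ) ha.2 hb.2 c.2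
  rw [metricForm_eq, e1, e2, ← e3]
  simp only [Matrix.mul_add θ.Uᴴ, Matrix.mul_add θ.S⁻¹, Matrix.conjTranspose_add b'.1,
    Matrix.conjTranspose_add (θ.Uᴴ * b'.1), map_add, add_apply, e4]
  have e6 : reTrTr k (θ.S⁻¹ * -herm (b.2 * θ.S⁻¹ * a.2)) (θ.S⁻¹ * c.2) =
      reTrTr k (-(θ.S⁻¹ * a.2 * θ.S⁻¹) * b.2) (θ.S⁻¹ * c.2) := by
    rw [reTrTr_apply, reTrTr_apply, e5]
  rw [e6]
  ring

/-- The derivative of the metric is the sum of the pairings with the two covariant derivatives. -/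
theorem metric_compat_aux (α β : ℝ) {θ : MBar p k} {a b c : Mat p k × Mat k k}
    (ha : a ∈ tangentSet θ) (hb : b ∈ tangentSet θ) (hc : c ∈ tangentSet θ)
    (b' c' : Mat p k × Mat k k) :
    (reTrMul k p b'.1ᴴ c.1 + reTrMul k p b.1ᴴ c'.1) -
      1 / 2 * (reTrMul k k (a.1ᴴ * b.1 + θ.Uᴴ * b'.1)ᴴ (θ.Uᴴ * c.1) +
        reTrMul k k (θ.Uᴴ * b.1)ᴴ (a.1ᴴ * c.1 + θ.Uᴴ * c'.1)) +
      α * (reTrMul k k (-(θ.S⁻¹ * a.2 * θ.S⁻¹) * b.2 + θ.S⁻¹ * b'.2) (θ.S⁻¹ * c.2) +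
        reTrMul k k (θ.S⁻¹ * b.2) (-(θ.S⁻¹ * a.2 * θ.S⁻¹) * c.2 + θ.S⁻¹ * c'.2)) +
      β * (reTrTr k (-(θ.S⁻¹ * a.2 * θ.S⁻¹) * b.2 + θ.S⁻¹ * b'.2) (θ.S⁻¹ * c.2) +
        reTrTr k (θ.S⁻¹ * b.2) (-(θ.S⁻¹ * a.2 * θ.S⁻¹) * c.2 + θ.S⁻¹ * c'.2)) =
    (reTrMul k p b'.1ᴴ c.1 - 1 / 2 * reTrMul k k (θ.Uᴴ * b'.1)ᴴ (θ.Uᴴ * c.1) +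
      (1 / 2 * (θ.Uᴴ * b.1 * (a.1ᴴ * (1 - θ.U * θ.Uᴴ) * c.1)).trace.re +
        1 / 2 * (θ.Uᴴ * a.1 * (b.1ᴴ * (1 - θ.U * θ.Uᴴ) * c.1)).trace.re) +
      α * (reTrMul k k (θ.S⁻¹ * b'.2) (θ.S⁻¹ * c.2) -
        1 / 2 * (θ.S⁻¹ * b.2 * (θ.S⁻¹ * a.2) * (θ.S⁻¹ * c.2)).trace.re -
        1 / 2 * (θ.S⁻¹ * a.2 * (θ.S⁻¹ * b.2) * (θ.S⁻¹ * c.2)).trace.re) +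
      β * reTrTr k (-(θ.S⁻¹ * a.2 * θ.S⁻¹) * b.2 + θ.S⁻¹ * b'.2) (θ.S⁻¹ * c.2)) +
    (reTrMul k p c'.1ᴴ b.1 - 1 / 2 * reTrMul k k (θ.Uᴴ * c'.1)ᴴ (θ.Uᴴ * b.1) +
      (1 / 2 * (θ.Uᴴ * c.1 * (a.1ᴴ * (1 - θ.U * θ.Uᴴ) * b.1)).trace.re +
        1 / 2 * (θ.Uᴴ * a.1 * (c.1ᴴ * (1 - θ.U * θ.Uᴴ) * b.1)).trace.re) +
      α * (reTrMul k k (θ.S⁻¹ * c'.2) (θ.S⁻¹ * b.2) -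
        1 / 2 * (θ.S⁻¹ * c.2 * (θ.S⁻¹ * a.2) * (θ.S⁻¹ * b.2)).trace.re -
        1 / 2 * (θ.S⁻¹ * a.2 * (θ.S⁻¹ * c.2) * (θ.S⁻¹ * b.2)).trace.re) +
      β * reTrTr k (-(θ.S⁻¹ * a.2 * θ.S⁻¹) * c.2 + θ.S⁻¹ * c'.2) (θ.S⁻¹ * b.2)) := by
  have hst := stiefel_compat ha.1 hb.1 hc.1
  have hsymm : ∀ {m : ℕ} (x y : Mat m k), reTrMul k m xᴴ y = reTrMul k m yᴴ x := by
    intro m x y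
    rw [← reTrMul_conjTranspose, Matrix.conjTranspose_conjTranspose, reTrMul_comm]
  have hTr : ∀ x y : Mat k k, reTrTr k x y = reTrTr k y x := by
    intro x y
    rw [reTrTr_apply, reTrTr_apply, mul_comm]
  set W := θ.S⁻¹
  have hcyc : ∀ x y z : Mat k k, (x * y * z).trace.re = (y * z * x).trace.re := by
    intro x y z
    rw [Matrix.mul_assoc, Matrix.trace_mul_comm]
  have m1 : reTrMul k k (-(W * a.2 * W) * b.2) (W * c.2) =
      -(W * a.2 * (W * b.2) * (W * c.2)).trace.re := by
    rw [reTrMul_apply]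
    simp only [Matrix.neg_mul, Matrix.trace_neg, Complex.neg_re, Matrix.mul_assoc]
  have m2 : reTrMul k k (W * b.2) (-(W * a.2 * W) * c.2) =
      -(W * b.2 * (W * a.2) * (W * c.2)).trace.re := by
    rw [reTrMul_apply]
    simp only [Matrix.neg_mul, Matrix.mul_neg, Matrix.trace_neg, Complex.neg_re, Matrix.mul_assoc]
  have m3 := hcyc (W * c.2) (W * a.2) (W * b.2)
  have m4 := (hcyc (W * b.2) (W * a.2) (W * c.2)).symm
  rw [m3, m4, hTr (W * b.2), hsymm c'.1, hsymm (θ.Uᴴ * c'.1), hsymm (θ.Uᴴ * b.1) (_ + _),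
    reTrMul_comm (W * c'.2)]
  rw [hsymm (a.1ᴴ * c.1)] at hst
  simp only [Matrix.conjTranspose_add (a.1ᴴ * b.1), Matrix.conjTranspose_add (a.1ᴴ * c.1), map_add,
    add_apply, m1, m2]
  rw [hsymm (a.1ᴴ * c.1), hsymm (θ.Uᴴ * c'.1)]
  linear_combination hst

/-- The formula of `covForm` defines the Levi-Civita connection of the product manifold. -/
theorem exists_isLeviCivita_metricBar {α β : ℝ} (hk : 0 < k) (hα : 0 < α) (hβ : -(α / k) < β) :
    ∃ D : AffineConnection (IBar p k) (MBar p k), IsLeviCivita (metricBar hk hα hβ) D ∧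
      ∀ (η : VField (IBar p k) (MBar p k)) (θ : MBar p k) (ξ : TangentSpace (IBar p k) θ),
        amb θ (D η θ ξ) = covForm θ (amb θ ξ) (amb θ (η θ))
          (mvfderiv (IBar p k) (fun y => amb y (η y)) θ ξ) := by
  choose L hL1 hL2 using fun θ : MBar p k => exists_amb_inverse θ
  let D₀ : VField (IBar p k) (MBar p k) →
      ∀ θ, TangentSpace (IBar p k) θ →L[ℝ] TangentSpace (IBar p k) θ := fun η θ =>
    L θ ∘L ((tangentProjL θ).toContinuousLinearMap ∘L
      mvfderiv (IBar p k) (fun y => amb y (η y)) θ +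
      ((correctionL θ).flip (amb θ (η θ))).toContinuousLinearMap ∘L amb θ)
  have hD₀ : ∀ η θ ξ, amb θ (D₀ η θ ξ) = covForm θ (amb θ ξ) (amb θ (η θ))
      (mvfderiv (IBar p k) (fun y => amb y (η y)) θ ξ) := fun η θ ξ =>
    hL2 θ _ (covForm_mem θ (amb θ ξ) (amb θ (η θ)) _)
  have hcov : IsCovariantDerivativeOn (MBarModel p k) D₀ Set.univ := by
    constructor
    · intro σ σ' θ hσ hσ' _
      ext1 ξ
      apply amb_injective θ
      have h1 := congrArg (fun l : TangentSpace (IBar p k) θ →L[ℝ] Mat p k × Mat k k => l ξ)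
        (mvfderiv_add (mdifferentiableAt_amb hσ) (mdifferentiableAt_amb hσ'))
      have h2 : (fun y => amb y ((σ + σ') y)) =
          (fun y => amb y (σ y)) + fun y => amb y (σ' y) :=
        funext fun y => map_add (amb y) (σ y) (σ' y)
      have h3 : amb θ ((σ + σ') θ) = amb θ (σ θ) + amb θ (σ' θ) := map_add (amb θ) _ _
      have h4 := (map_add (amb θ) (D₀ σ θ ξ) (D₀ σ' θ ξ))
      refine Eq.trans ?_ h4.symm
      rw [hD₀, hD₀, hD₀, h2, h3]
      refine (congrArg₂ (fun u v => tangentProjL θ u + v) h1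
        (map_add (correctionL θ (amb θ ξ)) _ _)).trans ?_
      refine (congrArg (· + _) (map_add (tangentProjL θ) _ _)).trans ?_
      exact add_add_add_comm _ _ _ _
    · intro σ r θ hσ hr _
      ext1 ξ
      apply amb_injective θ
      have h1 := congrArg (fun l : TangentSpace (IBar p k) θ →L[ℝ] Mat p k × Mat k k => l ξ)
        (mvfderiv_smul hr (mdifferentiableAt_amb hσ))
      have h2 : (fun y => amb y ((r • σ) y)) = r • fun y => amb y (σ y) :=
        funext fun y => map_smul (amb y) (r y) (σ y)
      have h3 : amb θ ((r • σ) θ) = r θ • amb θ (σ θ) := map_smul (amb θ) _ _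
      have h4 : amb θ (r θ • D₀ σ θ ξ + mvfderiv (IBar p k) r θ ξ • σ θ) =
          r θ • amb θ (D₀ σ θ ξ) + mvfderiv (IBar p k) r θ ξ • amb θ (σ θ) := by
        rw [map_add, map_smul, map_smul]
      refine Eq.trans ?_ h4.symm
      rw [hD₀, hD₀, h2, h3]
      refine (congrArg₂ (fun u v => tangentProjL θ u + v) h1
        (map_smul (correctionL θ (amb θ ξ)) _ _)).trans ?_
      have h5 : ∀ (u z : Mat p k × Mat k k) (s t : ℝ), z ∈ tangentSet θ →
          tangentProjL θ (s • u + t • z) + s • correctionL θ (amb θ ξ) z =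
            s • covForm θ (amb θ ξ) z u + t • z := by
        intro u z s t hz
        have h6 : tangentProjL θ z = z := tangentProj_eq_self hz
        have h7 : covForm θ (amb θ ξ) z u = tangentProjL θ u + correctionL θ (amb θ ξ) z := rfl
        rw [h7, map_add, map_smul, map_smul, h6, smul_add]
        abel
      exact h5 _ _ _ _ (amb_mem θ (σ θ))
  refine ⟨⟨D₀, hcov⟩, ⟨?_, ?_⟩, hD₀⟩
  · rw [CovariantDerivative.torsion_eq_zero_iff]
    intro X Y θ hX hY
    apply amb_injective θ
    have h1 := mvfderiv_mlieBracket hX hY (contMDiff_incl (p := p) (k := k)).contMDiffAt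
    have h2 : amb θ (D₀ Y θ (X θ) - D₀ X θ (Y θ)) =
        amb θ (D₀ Y θ (X θ)) - amb θ (D₀ X θ (Y θ)) := map_sub (amb θ) _ _
    refine h2.trans ?_
    rw [hD₀, hD₀, covForm, covForm, correction_symm (amb_mem θ (X θ)) (amb_mem θ (Y θ)),
      add_sub_add_right_eq_sub]
    refine (map_sub (tangentProjL θ) _ _).symm.trans ?_
    refine (congrArg (tangentProjL θ) h1.symm).trans ?_
    exact tangentProj_eq_self (amb_mem θ _)
  · intro θ ξ σ τ hσ hτ
    have h1 := mvfderiv_metricForm α β (mdifferentiableAt_amb hσ) (mdifferentiableAt_amb hτ) ξ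
      rfl rfl rfl rfl rfl
    refine h1.trans ?_
    obtain ⟨s1, s2⟩ := mvfderiv_amb_constraint hσ ξ
    obtain ⟨t1, t2⟩ := mvfderiv_amb_constraint hτ ξ
    have ha := amb_mem θ ξ
    have hb := amb_mem θ (σ θ)
    have hc := amb_mem θ (τ θ)
    have e1 : (metricBar hk hα hβ).inner θ (D₀ σ θ ξ) (τ θ) = _ :=
      (metricBar_inner hk hα hβ θ (D₀ σ θ ξ) (τ θ)).trans
      ((congrArg (metricForm α β θ · (amb θ (τ θ))) (hD₀ σ θ ξ)).trans
        (metricForm_covForm α β ha hb hc s1 s2))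
    have e2 : (metricBar hk hα hβ).inner θ (σ θ) (D₀ τ θ ξ) = _ :=
      ((metricBar hk hα hβ).symm θ (σ θ) (D₀ τ θ ξ)).trans
      ((metricBar_inner hk hα hβ θ (D₀ τ θ ξ) (σ θ)).trans
      ((congrArg (metricForm α β θ · (amb θ (σ θ))) (hD₀ τ θ ξ)).trans
        (metricForm_covForm α β ha hc hb t1 t2)))
    refine Eq.trans ?_ (congrArg₂ (· + ·) e1.symm e2.symm)
    exact metric_compat_aux α β ha hb hc _ _

end Connection

/-! ### The projection onto the quotient -/

section Projection

variable {p k : ℕ}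

/-- The coordinates of a Hermitian matrix in a frame, as a continuous linear map. -/
def Frame.coordL (F : Frame p k) : Mat p p →L[ℝ] MQuotModel p k :=
  LinearMap.toContinuousLinearMap
    { toFun := F.coord
      map_add' := fun a b => by
        refine Prod.ext (Herm.ext ?_) ?_
        · change herm (F.Uᴴ * (a + b) * F.U) = herm (F.Uᴴ * a * F.U) + herm (F.Uᴴ * b * F.U)
          simp only [herm, Matrix.mul_add, Matrix.add_mul, Matrix.conjTranspose_add]
          module
        · change F.Nᴴ * (a + b) * F.U = F.Nᴴ * a * F.U + F.Nᴴ * b * F.U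
          rw [Matrix.mul_add, Matrix.add_mul]
      map_smul' := fun c a => by
        refine Prod.ext (Herm.ext ?_) ?_
        · change herm (F.Uᴴ * (c • a) * F.U) = c • herm (F.Uᴴ * a * F.U)
          simp only [herm, Matrix.mul_smul, Matrix.smul_mul, Matrix.conjTranspose_smul,
            star_trivial, ← smul_add]
          rw [smul_comm]
        · change F.Nᴴ * (c • a) * F.U = c • (F.Nᴴ * a * F.U)
          rw [Matrix.mul_smul, Matrix.smul_mul] }

theorem contMDiff_toMat :
    ContMDiff (IBar p k) 𝓘(ℝ, Mat p p) ∞ (MBar.toMat : MBar p k → Mat p p) := by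
  let Ψ : Mat p k × Mat k k → Mat p p := fun Z => Z.1 * Z.2 * Z.1ᴴ
  have hΨ : ContDiff ℝ ∞ Ψ := by
    rw [contDiff_iff_contDiffAt]
    intro Z
    have h1 : ContDiffAt ℝ ∞ (fun Z : Mat p k × Mat k k => Z.1) Z := contDiffAt_fst
    have h2 : ContDiffAt ℝ ∞ (fun Z : Mat p k × Mat k k => Z.2) Z := contDiffAt_snd
    exact contDiffAt_mul (contDiffAt_mul h1 h2) (contDiffAt_conjTranspose h1)
  have h : ContMDiff (IBar p k) 𝓘(ℝ, Mat p p) ∞ (fun θ : MBar p k => Ψ (incl θ)) :=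
    ContMDiff.comp (g := Ψ) hΨ.contMDiff contMDiff_incl
  exact h

theorem contMDiff_proj : ContMDiff (IBar p k) (IQuot p k) ∞ (proj p k) := by
  intro θ
  rw [contMDiffAt_iff_target]
  refine ⟨continuous_quotient_mk'.continuousAt, ?_⟩
  exact ((proj p k θ).frame.contDiff_coord.contMDiff.comp contMDiff_toMat).contMDiffAt

/-- The differential of `(U, Σ) ↦ U Σ Uᴴ`. -/
def toMatDeriv (θ : MBar p k) (a : Mat p k × Mat k k) : Mat p p :=
  a.1 * θ.S * θ.Uᴴ + θ.U * a.2 * θ.Uᴴ + θ.U * θ.S * a.1ᴴ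

theorem mvfderiv_toMat (θ : MBar p k) (ξ : TangentSpace (IBar p k) θ) :
    mvfderiv (IBar p k) MBar.toMat θ ξ = toMatDeriv θ (amb θ ξ) := by
  have hU := mdifferentiableAt_U θ
  have hS := mdifferentiableAt_S θ
  have h := mvfderiv_matMul (mdifferentiableAt_matMul hU hS) (mdifferentiableAt_conjTranspose hU) ξ
  rw [mvfderiv_matMul hU hS, mvfderiv_conjTranspose hU, mvfderiv_U, mvfderiv_S,
    Matrix.add_mul] at h
  exact h

/-- The differential of the projection, in the chart at the image point. -/
theorem mfderiv_proj (θ : MBar p k) (ξ : TangentSpace (IBar p k) θ) :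
    (mfderiv (IBar p k) (IQuot p k) (proj p k) θ ξ : MQuotModel p k) =
      (proj p k θ).frame.coord (toMatDeriv θ (amb θ ξ)) := by
  have h1 := mvfderiv_clm_comp (proj p k θ).frame.coordL
    (contMDiff_toMat.contMDiffAt.mdifferentiableAt (by simp)) ξ
  have h2 := mfderiv_comp_apply (I := IBar p k) (I' := IQuot p k) (I'' := 𝓘(ℝ, MQuotModel p k))
    (g := extChartAt (IQuot p k) (proj p k θ)) θ
    (mdifferentiableAt_extChartAt (mem_chart_source _ _))
    (contMDiff_proj.contMDiffAt.mdifferentiableAt (by simp)) ξ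
  have h3 := mvfderiv_extChartAt_self (I := IQuot p k) (proj p k θ)
    (mfderiv (IBar p k) (IQuot p k) (proj p k) θ ξ)
  rw [mvfderiv_toMat] at h1
  exact h3.symm.trans (h2.symm.trans h1)

/-- In an adapted frame `(U O, N)`, the vector `(N C Oᴴ Σ⁻¹, O A Oᴴ)` is mapped to the vector with
coordinates `(A, C)`. -/
theorem surjective_mfderiv_proj (θ : MBar p k) :
    Function.Surjective (mfderiv (IBar p k) (IQuot p k) (proj p k) θ) := by
  intro z
  obtain ⟨A, C⟩ : MQuotModel p k := z
  set F := (proj p k θ).frame with hF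
  have hrel : θ ≈ Quotient.out (proj p k θ) := Setoid.symm (Quotient.mk_out θ)
  obtain ⟨O, hO, hU, -⟩ := hrel
  have hFU : F.U = θ.U * O := ((Quotient.out (proj p k θ)).1.frame_U).trans hU
  have hO1 : O * Oᴴ = 1 := Matrix.mem_unitaryGroup_iff.1 hO
  have hO2 : Oᴴ * O = 1 := Matrix.mem_unitaryGroup_iff'.1 hO
  have hUF : θ.U = F.U * Oᴴ := by rw [hFU, Matrix.mul_assoc, hO1, Matrix.mul_one]
  have hUh : θ.Uᴴ * F.U = O := by
    rw [hFU, ← Matrix.mul_assoc, θ.U_mul, Matrix.one_mul]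
  have hFUh : F.Uᴴ * θ.U = Oᴴ := by
    rw [← hUh, Matrix.conjTranspose_mul, Matrix.conjTranspose_conjTranspose]
  have hUN : θ.Uᴴ * F.N = 0 := by
    rw [hUF, Matrix.conjTranspose_mul, Matrix.mul_assoc, F.UN, Matrix.mul_zero]
  have hNU : F.Nᴴ * θ.U = 0 := by
    rw [hUF, ← Matrix.mul_assoc, F.NU, Matrix.zero_mul]
  have hSi : θ.S⁻¹ * θ.S = 1 :=
    Matrix.nonsing_inv_mul _ ((Matrix.isUnit_iff_isUnit_det _).1 θ.S_posDef.isUnit)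
  let a : Mat p k × Mat k k := (F.N * (C.val * Oᴴ * θ.S⁻¹), O * A.val * Oᴴ)
  have ha : a ∈ tangentSet θ := by
    refine ⟨?_, ?_⟩
    · change (θ.Uᴴ * (F.N * (C.val * Oᴴ * θ.S⁻¹)))ᴴ = -(θ.Uᴴ * (F.N * (C.val * Oᴴ * θ.S⁻¹)))
      rw [← Matrix.mul_assoc, hUN]
      simp
    · change (O * A.val * Oᴴ)ᴴ = O * A.val * Oᴴ
      simp only [Matrix.conjTranspose_mul, Matrix.conjTranspose_conjTranspose,
        A.conjTranspose_val, Matrix.mul_assoc]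
  obtain ⟨ξ, hξ⟩ := exists_amb_eq ha
  refine ⟨ξ, (mfderiv_proj θ ξ).trans ?_⟩
  rw [hξ, ← hF]
  have e1 : toMatDeriv θ a * F.U =
      F.N * C.val + θ.U * (O * A.val) + θ.U * θ.S * (a.1ᴴ * F.U) := by
    rw [toMatDeriv, Matrix.add_mul, Matrix.add_mul]
    refine congrArg₂ (· + ·) (congrArg₂ (· + ·) ?_ ?_) (Matrix.mul_assoc _ _ _)
    · rw [Matrix.mul_assoc, hUh]
      change F.N * (C.val * Oᴴ * θ.S⁻¹) * θ.S * O = F.N * C.val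
      simp only [Matrix.mul_assoc]
      rw [← Matrix.mul_assoc θ.S⁻¹, hSi, Matrix.one_mul, hO2, Matrix.mul_one]
    · rw [Matrix.mul_assoc, hUh]
      change θ.U * (O * A.val * Oᴴ) * O = θ.U * (O * A.val)
      rw [Matrix.mul_assoc, Matrix.mul_assoc, Matrix.mul_assoc, hO2, Matrix.mul_one]
  have e2 : a.1ᴴ * F.U = 0 := by
    change (F.N * (C.val * Oᴴ * θ.S⁻¹))ᴴ * F.U = 0
    rw [Matrix.conjTranspose_mul, Matrix.mul_assoc, F.NU, Matrix.mul_zero]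
  rw [e2, Matrix.mul_zero, add_zero] at e1
  refine Prod.ext (Herm.ext ?_) ?_
  · change herm (F.Uᴴ * toMatDeriv θ a * F.U) = A.val
    rw [Matrix.mul_assoc, e1, Matrix.mul_add, ← Matrix.mul_assoc, F.UN, Matrix.zero_mul, zero_add,
      ← Matrix.mul_assoc, hFUh, ← Matrix.mul_assoc, hO2, Matrix.one_mul,
      herm_eq_self A.conjTranspose_val]
  · change F.Nᴴ * toMatDeriv θ a * F.U = C.val
    rw [Matrix.mul_assoc, e1, Matrix.mul_add, ← Matrix.mul_assoc, F.NN, Matrix.one_mul,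
      ← Matrix.mul_assoc, hNU, Matrix.zero_mul, add_zero]

theorem surjective_proj : Function.Surjective (proj p k) := Quotient.exists_rep

/-- The hypothesis `k ≤ p` says that there are orthonormal `k`-frames in `ℂ^p`. -/
theorem nonempty_MBar (hkp : k ≤ p) : Nonempty (MBar p k) := by
  let U : Mat p k := (1 : Mat p p).submatrix id (Fin.castLE hkp)
  have hU : Uᴴ * U = 1 := by
    have h : Uᴴ = (1 : Mat p p).submatrix (Fin.castLE hkp) id := by
      rw [Matrix.conjTranspose_submatrix, Matrix.conjTranspose_one]
    rw [h]
    refine (Matrix.submatrix_mul _ _ (Fin.castLE hkp) id (Fin.castLE hkp)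
      Function.bijective_id).symm.trans ?_
    rw [Matrix.mul_one]
    exact Matrix.submatrix_one _ (Fin.castLE_injective hkp)
  exact ⟨MBar.mk U 1 hU Matrix.PosDef.one⟩

/-- The action of `O` on pairs of matrices. -/
def act (O : Mat k k) : Mat p k × Mat k k →ₗ[ℝ] Mat p k × Mat k k where
  toFun Z := (Z.1 * O, Oᴴ * Z.2 * O)
  map_add' a b := by
    simp only [Prod.fst_add, Prod.snd_add, Matrix.add_mul, Matrix.mul_add, Prod.mk_add_mk]
  map_smul' c a := by
    simp only [Prod.smul_fst, Prod.smul_snd, Matrix.smul_mul, Matrix.mul_smul, Prod.smul_mk,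
      RingHom.id_apply]

/-- The unitary group acts by isometries along the fibres of the projection. -/
theorem exists_fibre_isometry {α β : ℝ} (hk : 0 < k) (hα : 0 < α) (hβ : -(α / k) < β)
    (θ θ' : MBar p k) (h : proj p k θ = proj p k θ') :
    ∃ a : TangentSpace (IBar p k) θ →ₗ[ℝ] TangentSpace (IBar p k) θ',
      (∀ ξ η, (metricBar hk hα hβ).inner θ' (a ξ) (a η) = (metricBar hk hα hβ).inner θ ξ η) ∧
      ∀ ξ, (mfderiv (IBar p k) (IQuot p k) (proj p k) θ' (a ξ) : MQuotModel p k) =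
        mfderiv (IBar p k) (IQuot p k) (proj p k) θ ξ := by
  have hrel : θ ≈ θ' := Quotient.exact h
  obtain ⟨O, hO, hU, hS⟩ := hrel
  have hO1 : O * Oᴴ = 1 := Matrix.mem_unitaryGroup_iff.1 hO
  have hO2 : Oᴴ * O = 1 := Matrix.mem_unitaryGroup_iff'.1 hO
  have hSi : θ'.S⁻¹ = Oᴴ * θ.S⁻¹ * O := by
    apply Matrix.inv_eq_right_inv
    rw [hS]
    simp only [Matrix.mul_assoc]
    rw [← Matrix.mul_assoc O, hO1, Matrix.one_mul, ← Matrix.mul_assoc θ.S, θ.S_inv,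
      Matrix.one_mul, hO2]
  obtain ⟨L, -, hL⟩ := exists_amb_inverse θ'
  have hmem : ∀ Z ∈ tangentSet θ, act O Z ∈ tangentSet θ' := by
    rintro Z ⟨h1, h2⟩
    refine ⟨?_, ?_⟩
    · have h3 : θ'.Uᴴ * (Z.1 * O) = Oᴴ * (θ.Uᴴ * Z.1) * O := by
        rw [hU, Matrix.conjTranspose_mul]
        simp only [Matrix.mul_assoc]
      change (θ'.Uᴴ * (Z.1 * O))ᴴ = -(θ'.Uᴴ * (Z.1 * O))
      rw [h3, Matrix.conjTranspose_mul, Matrix.conjTranspose_mul, h1,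
        Matrix.conjTranspose_conjTranspose]
      simp only [Matrix.neg_mul, Matrix.mul_neg, Matrix.mul_assoc]
    · change (Oᴴ * Z.2 * O)ᴴ = Oᴴ * Z.2 * O
      rw [Matrix.conjTranspose_mul, Matrix.conjTranspose_mul, h2,
        Matrix.conjTranspose_conjTranspose, Matrix.mul_assoc]
  have hamb : ∀ ξ, amb θ' (L (act O (amb θ ξ))) = act O (amb θ ξ) := fun ξ =>
    hL _ (hmem _ (amb_mem θ ξ))
  have hconj : ∀ X : Mat k k, (Oᴴ * X * O).trace = X.trace := by
    intro X
    rw [Matrix.trace_mul_comm, ← Matrix.mul_assoc, hO1, Matrix.one_mul]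
  have hsol : ∀ Z : Mat k k, θ'.S⁻¹ * (Oᴴ * Z * O) = Oᴴ * (θ.S⁻¹ * Z) * O := by
    intro Z
    rw [hSi]
    simp only [Matrix.mul_assoc]
    rw [← Matrix.mul_assoc O Oᴴ, hO1, Matrix.one_mul]
  have hmul : ∀ X Y : Mat k k, Oᴴ * X * O * (Oᴴ * Y * O) = Oᴴ * (X * Y) * O := by
    intro X Y
    simp only [Matrix.mul_assoc]
    rw [← Matrix.mul_assoc O Oᴴ, hO1, Matrix.one_mul]
  have hform : ∀ Z Z' : Mat p k × Mat k k,
      metricForm α β θ' (act O Z) (act O Z') = metricForm α β θ Z Z' := by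
    intro Z Z'
    have h1 : (Z.1 * O)ᴴ * (Z'.1 * O) = Oᴴ * (Z.1ᴴ * Z'.1) * O := by
      rw [Matrix.conjTranspose_mul]
      simp only [Matrix.mul_assoc]
    have h2 : ∀ X : Mat p k, θ'.Uᴴ * (X * O) = Oᴴ * (θ.Uᴴ * X) * O := by
      intro X
      rw [hU, Matrix.conjTranspose_mul]
      simp only [Matrix.mul_assoc]
    have h3 : (Oᴴ * (θ.Uᴴ * Z.1) * O)ᴴ = Oᴴ * (θ.Uᴴ * Z.1)ᴴ * O := by
      simp only [Matrix.conjTranspose_mul, Matrix.conjTranspose_conjTranspose, Matrix.mul_assoc]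
    have h4 : act O Z = (Z.1 * O, Oᴴ * Z.2 * O) := rfl
    have h5 : act O Z' = (Z'.1 * O, Oᴴ * Z'.2 * O) := rfl
    rw [metricForm_eq, metricForm_eq, h4, h5]
    simp only [reTrMul_apply, reTrTr_apply, h1, h2, h3, hsol, hmul, hconj]
  refine ⟨(L.toLinearMap ∘ₗ act O) ∘ₗ (amb θ).toLinearMap, fun ξ η => ?_, fun ξ => ?_⟩
  · change metricForm α β θ' (amb θ' (L (act O (amb θ ξ)))) (amb θ' (L (act O (amb θ η)))) = _
    rw [hamb, hamb, hform]
    rfl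
  · refine (mfderiv_proj θ' (L (act O (amb θ ξ)))).trans (Eq.trans ?_ (mfderiv_proj θ ξ).symm)
    rw [hamb, h]
    have h6 : toMatDeriv θ' (act O (amb θ ξ)) = toMatDeriv θ (amb θ ξ) := by
      have h7 : act O (amb θ ξ) = ((amb θ ξ).1 * O, Oᴴ * (amb θ ξ).2 * O) := rfl
      rw [h7, toMatDeriv, toMatDeriv, hU, hS]
      simp only [Matrix.conjTranspose_mul, Matrix.mul_assoc]
      simp only [← Matrix.mul_assoc O Oᴴ, hO1, Matrix.one_mul]
    rw [h6]

end Projection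

end FixedRank

end

open FixedRank

theorem mainTheorem3 (p k : ℕ) (hk : 0 < k) (hkp : k ≤ p) (α β : ℝ) (hα : 0 < α)
    (hβ : -(α / k) < β) :
    ∃ (gbar : RiemMetric (IBar p k) (MBar p k)) (g : RiemMetric (IQuot p k) (MQuot p k)),
      (∀ (θ : MBar p k) (ξ η : TangentSpace (IBar p k) θ),
        gbar.inner θ ξ η = metricForm α β θ (ambient θ ξ) (ambient θ η)) ∧
      IsRiemannianSubmersion (IQuot p k) gbar g (proj p k) ∧
      (∃ Dbar, IsLeviCivita gbar Dbar) ∧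
      (∃ D, IsLeviCivita g D) ∧
      ∀ (Dbar : AffineConnection (IBar p k) (MBar p k))
        (D : AffineConnection (IQuot p k) (MQuot p k)),
        IsLeviCivita gbar Dbar → IsLeviCivita g D →
        (∀ (θ : MBar p k) (ξ : TangentSpace (IBar p k) θ) (η : VField (IBar p k) (MBar p k)),
          VFieldDiffAt η θ →
          ambient θ (Dbar η θ ξ) =
            tangentProj θ (dirDeriv η θ ξ) + correction θ (ambient θ ξ) (ambient θ (η θ))) ∧
        (∀ (θ : MBar p k) (η : VField (IQuot p k) (MQuot p k))
          (ηbar : VField (IBar p k) (MBar p k)),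
          VFieldDiffAt η (proj p k θ) →
          (∀ x, IsHorizontalRep (IQuot p k) gbar (proj p k) x (η (proj p k x)) (ηbar x)) →
          ∀ ξ ∈ horizontal (IQuot p k) gbar (proj p k) θ,
            IsHorizontalRep (IQuot p k) gbar (proj p k) θ
              (D η (proj p k θ) (mfderiv (IBar p k) (IQuot p k) (proj p k) θ ξ))
              (horizontalProj (IQuot p k) gbar (proj p k) θ (Dbar ηbar θ ξ))) := by
  have hiso := exists_fibre_isometry (p := p) hk hα hβ
  obtain ⟨g, hg⟩ := exists_isRiemannianSubmersion (metricBar hk hα hβ) contMDiff_proj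
    surjective_mfderiv_proj surjective_proj hiso
  obtain ⟨D₀, hD₀, hD₀_eq⟩ := exists_isLeviCivita_metricBar (p := p) hk hα hβ
  refine ⟨metricBar hk hα hβ, g, ?_, hg, ⟨D₀, hD₀⟩, ?_, ?_⟩
  · intro θ ξ η
    rw [ambient_eq, ambient_eq]
    exact metricBar_inner hk hα hβ θ ξ η
  · obtain ⟨D, hD, -⟩ := exists_isLeviCivita_descent hg surjective_proj hD₀
      (nonempty_MBar hkp).some
    exact ⟨D, hD⟩
  · intro Dbar D hDbar hD
    refine ⟨fun θ ξ η hη => ?_, fun θ η ηbar hη hηbar ξ hξ => ?_⟩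
    · rw [hDbar.unique hD₀ hη, dirDeriv_eq hη, ambient_eq, ambient_eq, ambient_eq]
      exact hD₀_eq η θ ξ
    · exact IsLeviCivita.isHorizontalRep hg surjective_proj hDbar hD hη hηbar hξ
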